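/- Let $q>0$ be real, $q\neq1$ (i.e. $q=e^{\hbar\kappa}$ with $\hbar\kappa\ne0$ real), $[x]=\frac{q^{x/2}-q^{-x/2}}{q^{1/2}-q^{-1/2}}$, and $d_j=2j+1$ for a spin $j\in\mathbb N/2$. **Spinor operators.** On $\bigoplus_j V_j$ with basis $|j,m\rangle$, $-j\le m\le j$, define $a|j,m\rangle=\sqrt{[j+m]}\,|j-\tfrac12,m-\tfrac12\rangle$, $a^\dagger|j,m\rangle=\sqrt{[j+m+1]}\,|j+\tfrac12,m+\tfrac12\rangle$, $b|j,m\rangle=\sqrt{[j-m]}\,|j-\tfrac12,m+\tfrac12\rangle$, $b^\dagger|j,m\rangle=\sqrt{[j-m+1]}\,|j+\tfrac12,m-\tfrac12\rangle$, $N_a|j,m\rangle=(j+m)|j,m\rangle$, $N_b|j,m\rangle=(j-m)|j,m\rangle$. The quantum spinor $\mathbf t^{\epsilon}_A$ ($\epsilon=\pm$, $A=\pm\frac12$) is $$\mathbf t^-_{+}=q^{N_b/4}a,\quad \mathbf t^-_-=q^{-N_a/4}b,\quad \mathbf t^+_+=-b^\dagger q^{-(N_a+1)/4},\quad \mathbf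 t^+_-=a^\dagger q^{(N_b+1)/4},$$ and $\boldsymbol\tau^\epsilon_A$ is obtained from $\mathbf t^\epsilon_A$ by $q\to q^{-1}$. **Graph and spin networks.** $\Gamma$ is a finite oriented trivalent ribbon graph, and $f$ a face of degree $d\ge2$ visiting each of its edges and vertices once. The edges of $f$ are $e_1,\dots,e_d$, counter-clockwise, indices modulo $d$; $e_i$ joins $v_i$ to $v_{i+1}$; $o_i=1$ if $e_i$ is oriented from $v_i$ to $v_{i+1}$ and $o_i=-1$ otherwise; the third edge at $v_i$ is $e_i'$. The edges at $v_i$ are ordered as $(e_{i-1},e_i,e'_i)$, and those at every other vertex by its cyclic order and a choice of first half-edge. An edge $e$ of spin $j$ carries $V_j$ at its target end and $V_j^*$ at its source end. A labelling $\{k_e\}$ of the edges by spins is *admissible* if at each vertex the three spins $(x,y,z)$ have integer sum and satisfy the triangle inequalities. The spin network states $|\{k_e\}\rangle=\bigotimes_v i_v$ are indexed by the admissible labellings; $i_v=i_{j_1j_2j_3}$ (for the ordered edges at $v$) is given by $q$-Clebsch–Gordan coefficients: $$i_{j_1j_2j_3}=\sum_{m_1,m_2,m_3}{}_qC^{j_1\,j_2\,j_3}_{m_1\,m_2\,-m_3}\;{}_qC^{j_3\,j_3\,0}_{-m_3\,m_3\,0}\;|j_1,m_1\rangle\otimes|j_2,m_2\rangle\otimes|j_3,m_3\rangle$$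 if the three edges are incoming, and then for each outgoing edge the corresponding factor is dualized by $|j,m\rangle\mapsto(-1)^{j-m}q^{m/2}\langle j,-m|$ in positions $1,3$ and by $|j,m\rangle\mapsto(-1)^{j+m}q^{m/2}\langle j,-m|$ in position $2$. Here ${}_qC^{j\,j\,0}_{m\,-m\,0}=(-1)^{j-m}q^{m/2}/\sqrt{[d_j]}$. The state $|\psi\rangle=\sum\psi(\{j_e\})|\{j_e\}\rangle$, the sum running over the admissible $\{j_e\}$, has arbitrary complex coefficients, and $\psi$ is set to $0$ on labellings that are not admissible. The basis vectors $|j,m\rangle$, $\langle j,m|$ are orthonormal, and $\langle\{k_e\}|\mathbf H|\psi\rangle=\sum_{\{j_e\}}\psi(\{j_e\})\langle\{k_e\}|\mathbf H|\{j_e\}\rangle$ (a finite sum for the operators below). **Scalar operators.** At $v_i$, with $o=o_{i-1}$, $o'=o_i$, $$\mathbf E^{\epsilon',\epsilon}_{e_ie_{i-1}}=-o\,(-1)^{\frac{1-o}2\frac{1+\epsilon}2}(-1)^{\frac{1-o'}2\frac{1+\epsilon'}2}\sum_{A=\pm\frac12}(-1)^{\frac12-A}q^{oA/2}\;\mathbf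 T_{e_{i-1},A}\otimes\mathbf T_{e_i,-A},$$ where $\mathbf T_{e_{i-1},A}$ is $\mathbf t^{\epsilon}_A$ acting on the $V$'s if $o=1$ and the transpose of $\boldsymbol\tau^{-\epsilon}_A$ acting on the $V^*$'s if $o=-1$, and $\mathbf T_{e_i,A}$ is $\boldsymbol\tau^{\epsilon'}_A$ acting on the $V$'s if $o'=-1$ and the transpose of $\mathbf t^{-\epsilon'}_A$ acting on the $V^*$'s if $o'=1$. Let $\mathbf N_{ev}$ be multiplication by $[d_{j}]$ on the spin-$j$ part of the space carried by the end of $e$ at $v$. **Hamiltonian.** Let $p\in\{2,\dots,d\}$ and fix signs $\epsilon_1,\epsilon_p,\epsilon_{p+1},\dots,\epsilon_d\in\{\pm\}$, with $\epsilon_{d+1}=\epsilon_1$. With $\tilde\epsilon_1=\tilde\epsilon_{d+1}=\epsilon_1$ and $\tilde\epsilon_p=\epsilon_p$, let $$\mathbf h=\frac1{\mathbf N_{e_1v_2}}\sum_{\tilde\epsilon_2,\dots,\tilde\epsilon_{p-1}=\pm}\ \prod_{i=2}^{p}\mathbf E^{\tilde\epsilon_i,\tilde\epsilon_{i-1}}_{e_ie_{i-1}}\frac{o_i\tilde\epsilon_i}{\mathbf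 N_{e_iv_i}}+(-1)^{d-p}\epsilon_1\epsilon_p\frac1{\mathbf N_{e_pv_{p+1}}}\sum_{\tilde\epsilon_{p+1},\dots,\tilde\epsilon_d=\pm}\ \prod_{i=p+1}^{d+1}\mathbf E^{-\tilde\epsilon_i,-\tilde\epsilon_{i-1}}_{e_ie_{i-1}}\frac{o_i\tilde\epsilon_i}{\mathbf N_{e_iv_i}},$$ $$\mathbf H^{\epsilon_1,\epsilon_p,\epsilon_{p+1},\dots,\epsilon_d}_{f,e_1,e_p}=\Bigl[\prod_{i=p+1}^{d+1}\mathbf E^{\epsilon_i,\epsilon_{i-1}}_{e_ie_{i-1}}\Bigr]\mathbf h .$$ **Theorem.** For every $|\psi\rangle$, the constraint $$\langle\{k_e\}|\,\mathbf H^{\epsilon_1,\epsilon_p,\epsilon_{p+1},\dots,\epsilon_d}_{f,e_1,e_p}\,|\psi\rangle=0\qquad\text{for all admissible }\{k_e\}$$ is equivalent to the following difference equations, for all admissible $\{k_e\}$ (with $k_i=k_{e_i}$, $l_i=k_{e'_i}$): $$\sum_{\tilde\epsilon_2,\dots,\tilde\epsilon_{p-1}=\pm}\Bigl(\prod_{i=2}^pA^{\tilde\epsilon_i,\tilde\epsilon_{i-1}}_{o_i}(k_i,k_{i-1},l_i)\Bigr)\psi\bigl(k_1-\tfrac{\epsilon_1}2,k_2-\tfrac{\tilde\epsilon_2}2,\dots,k_{p-1}-\tfrac{\tilde\epsilon_{p-1}}2,k_p-\tfrac{\epsilon_p}2,\dots,k_d-\tfrac{\epsilon_d}2,\{k_e\}_{e\notin\partial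 f}\bigr)$$ $$+(-1)^{d-p}\alpha^{\epsilon_1,\epsilon_p}(k_1,k_p)\sum_{\tilde\epsilon_{p+1},\dots,\tilde\epsilon_d=\pm}\Bigl(\prod_{i=p+1}^{d+1}B^{\tilde\epsilon_i,\tilde\epsilon_{i-1}}_{o_i}\bigl(k_i-\tfrac{\epsilon_i}2,k_{i-1}-\tfrac{\epsilon_{i-1}}2,l_i\bigr)\Bigr)\psi\bigl(k_1,\dots,k_p,k_{p+1}-\tfrac{\epsilon_{p+1}}2+\tfrac{\tilde\epsilon_{p+1}}2,\dots,k_d-\tfrac{\epsilon_d}2+\tfrac{\tilde\epsilon_d}2,\{k_e\}_{e\notin\partial f}\bigr)=0,$$ where $$A^{\epsilon,\epsilon'}_{o}(k,k',l)=o\,\epsilon\,[d_k](-1)^{k+k'+l}\begin{Bmatrix}k&k-\frac{\epsilon}2&\frac12\\k'-\frac{\epsilon'}2&k'&l\end{Bmatrix}_q,\qquad B^{\epsilon,\epsilon'}_{o}(k,k',l)=o\,\epsilon\,[d_k](-1)^{k+k'+l}\begin{Bmatrix}k&k+\frac{\epsilon}2&\frac12\\k'+\frac{\epsilon'}2&k'&l\end{Bmatrix}_q,$$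 $$\alpha^{\epsilon_1,\epsilon_p}(k_1,k_p)=\epsilon_1\epsilon_p\frac{[d_{k_p}]}{[d_{k_1-\epsilon_1/2}]}.$$ The $q$-$6j$ symbols are those of Racah's formula and vanish when one of their triads violates the triangle inequalities, has a non-integer sum or contains a negative entry; a term in which a $B$-factor vanishes is $0$ (even if the denominator of $\alpha$ vanishes). -/

import Mathlib

/-! Conventions.  A spin `j ∈ ℕ/2` is stored as the integer `2j`, and a basis vector `|j,m⟩` as the
pair `(j+m, j-m) ∈ ℕ × ℕ` of occupation numbers `(N_a, N_b)` of two `q`-bosons.  Signs `±` and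
magnetic indices `A = ±1/2` are elements of `ℤˣ` (the latter stored as `2A`). -/

noncomputable section

namespace QHam

/-! ### `q`-numbers, Clebsch-Gordan coefficients and `6j`-symbols -/

/-- The `q`-number `[x] = (q^{x/2} - q^{-x/2}) / (q^{1/2} - q^{-1/2})`. -/
def qnum (q x : ℝ) : ℝ :=
  (q ^ (x / 2) - q ^ (-x / 2)) / (q ^ (1 / 2 : ℝ) - q ^ (-1 / 2 : ℝ))

/-- The `q`-factorial `[n]!`. -/
def qfact (q : ℝ) (n : ℕ) : ℝ := ∏ i ∈ Finset.range n, qnum q (i + 1)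

/-- `1 / [n]!`, with the usual convention that it vanishes for negative `n`. -/
def qfactInv (q : ℝ) (n : ℤ) : ℝ := if 0 ≤ n then (qfact q n.toNat)⁻¹ else 0

/-- `(-1)^n` for an integer `n`. -/
def sgn (n : ℤ) : ℝ := ((n.negOnePow : ℤ) : ℝ)

/-- Triangle inequalities and integrality of the sum, for three (doubled) spins. -/
def Triad (a b c : ℤ) : Prop :=
  0 ≤ a ∧ 0 ≤ b ∧ 0 ≤ c ∧ Even (a + b + c) ∧ a ≤ b + c ∧ b ≤ a + c ∧ c ≤ a + b

instance (a b c : ℤ) : Decidable (Triad a b c) := by unfold Triad; infer_instance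

/-- The triangle coefficient
`Δ(a,b,c) = √([a+b-c]! [a-b+c]! [-a+b+c]! / [a+b+c+1]!)` (arguments are doubled spins). -/
def triCoeff (q : ℝ) (a b c : ℤ) : ℝ :=
  Real.sqrt (qfact q ((a + b - c) / 2).toNat * qfact q ((a - b + c) / 2).toNat *
    qfact q ((-a + b + c) / 2).toNat / qfact q ((a + b + c) / 2 + 1).toNat)

/-- The `q`-`6j`-symbol `{a b c; d e f}_q` by Racah's formula (arguments are doubled spins);
zero when one of the four triads is not admissible. -/
def sixj (q : ℝ) (a b c d e f : ℤ) : ℝ :=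
  if Triad a b c ∧ Triad a e f ∧ Triad d b f ∧ Triad d e c then
    triCoeff q a b c * triCoeff q a e f * triCoeff q d b f * triCoeff q d e c *
      ∑ z ∈ Finset.range (((a + b + d + e) / 2).toNat + 1),
        (-1 : ℝ) ^ z * qfact q (z + 1) *
          (qfactInv q (z - (a + b + c) / 2) * qfactInv q (z - (a + e + f) / 2) *
            qfactInv q (z - (d + b + f) / 2) * qfactInv q (z - (d + e + c) / 2)) *
          (qfactInv q ((a + b + d + e) / 2 - z) * qfactInv q ((b + c + e + f) / 2 - z) *
            qfactInv q ((a + c + d + f) / 2 - z))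
  else 0

/-- Doubled spin `2j` of the basis vector `(j+m, j-m)`. -/
def dspin (n : ℕ × ℕ) : ℤ := n.1 + n.2

/-- Doubled magnetic number `2m` of the basis vector `(j+m, j-m)`. -/
def dmag (n : ℕ × ℕ) : ℤ := n.1 - n.2

/-- The Clebsch-Gordan coefficient `_qC^{j₁ j₂ j₃}_{m₁ m₂ m₃}` of `U_q(su(2))`, where
`x = (j₁+m₁, j₁-m₁)`, `y = (j₂+m₂, j₂-m₂)`, `w = (j₃+m₃, j₃-m₃)`.  In the sum,
`j₃-j₂+m₁ = w.1 - y.1` and `j₃-j₁-m₂ = w.2 - x.2`. -/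
def cg (q : ℝ) (x y w : ℕ × ℕ) : ℝ :=
  if Triad (dspin x) (dspin y) (dspin w) ∧ dmag x + dmag y = dmag w then
    q ^ (((dspin x + dspin y - dspin w : ℤ) : ℝ) / 2 *
          (((dspin x + dspin y + dspin w : ℤ) : ℝ) / 2 + 1) / 4 +
        ((dspin x * dmag y - dspin y * dmag x : ℤ) : ℝ) / 8) *
      triCoeff q (dspin x) (dspin y) (dspin w) *
      Real.sqrt (qnum q (dspin w + 1) * (qfact q x.1 * qfact q x.2 * qfact q y.1 * qfact q y.2 *
        qfact q w.1 * qfact q w.2)) *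
      ∑ z ∈ Finset.range (((dspin x + dspin y - dspin w) / 2).toNat + 1),
        (-1 : ℝ) ^ z *
          q ^ (-(z : ℝ) / 2 * (((dspin x + dspin y + dspin w : ℤ) : ℝ) / 2 + 1)) *
          (qfactInv q z * qfactInv q ((dspin x + dspin y - dspin w) / 2 - z) *
            qfactInv q ((x.2 : ℤ) - z) * qfactInv q ((y.1 : ℤ) - z) *
            qfactInv q ((w.1 : ℤ) - y.1 + z) * qfactInv q ((w.2 : ℤ) - x.2 + z))
  else 0

/-- `_qC^{j j 0}_{m,-m,0} = (-1)^{j-m} q^{m/2} / √[2j+1]` for the basis vector `x = (j+m, j-m)`. -/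
def cgSinglet (q : ℝ) (x : ℕ × ℕ) : ℝ :=
  (-1 : ℝ) ^ x.2 * q ^ ((dmag x : ℝ) / 4) / Real.sqrt (qnum q (dspin x + 1))

/-! ### Quantum spinors -/

/-- The Fock space of two `q`-bosons: the algebraic direct sum `⨁_j V_j`. -/
abbrev Fock : Type := (ℕ × ℕ) →₀ ℂ

/-- The diagonal operator `|n⟩ ↦ g(n) |n⟩`. -/
def diagOp (g : ℕ × ℕ → ℝ) : Module.End ℂ Fock :=
  Finsupp.linearCombination ℂ fun n => Finsupp.single n (g n : ℂ)

/-- `a |j,m⟩ = √[j+m] |j-1/2,m-1/2⟩`. -/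
def annA (q : ℝ) : Module.End ℂ Fock :=
  Finsupp.linearCombination ℂ fun n =>
    Finsupp.single (n.1 - 1, n.2) ((Real.sqrt (qnum q n.1) : ℝ) : ℂ)

/-- `a† |j,m⟩ = √[j+m+1] |j+1/2,m+1/2⟩`. -/
def creA (q : ℝ) : Module.End ℂ Fock :=
  Finsupp.linearCombination ℂ fun n =>
    Finsupp.single (n.1 + 1, n.2) ((Real.sqrt (qnum q (n.1 + 1)) : ℝ) : ℂ)

/-- `b |j,m⟩ = √[j-m] |j-1/2,m+1/2⟩`. -/
def annB (q : ℝ) : Module.End ℂ Fock :=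
  Finsupp.linearCombination ℂ fun n =>
    Finsupp.single (n.1, n.2 - 1) ((Real.sqrt (qnum q n.2) : ℝ) : ℂ)

/-- `b† |j,m⟩ = √[j-m+1] |j+1/2,m-1/2⟩`. -/
def creB (q : ℝ) : Module.End ℂ Fock :=
  Finsupp.linearCombination ℂ fun n =>
    Finsupp.single (n.1, n.2 + 1) ((Real.sqrt (qnum q (n.2 + 1)) : ℝ) : ℂ)

/-- The quantum spinor `t^ε_A`:
`t^- = (q^{N_b/4} a, q^{-N_a/4} b)`, `t^+ = (-b† q^{-(N_a+1)/4}, a† q^{(N_b+1)/4})`.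
The spinor `τ^ε_A` is `spinor q⁻¹ ε A`. -/
def spinor (q : ℝ) (ε A : ℤˣ) : Module.End ℂ Fock :=
  if ε = 1 then
    if A = 1 then -(creB q * diagOp fun n => q ^ (-((n.1 : ℝ) + 1) / 4))
    else creA q * diagOp fun n => q ^ (((n.2 : ℝ) + 1) / 4)
  else
    if A = 1 then (diagOp fun n => q ^ ((n.2 : ℝ) / 4)) * annA q
    else (diagOp fun n => q ^ (-(n.1 : ℝ) / 4)) * annB q

/-! ### Trivalent ribbon graphs, spin labels, faces -/

/-- An oriented trivalent ribbon graph with vertex set `V` and edge set `E`, given by its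
half-edges: `(e, true)` is the target end of the edge `e`, `(e, false)` its source end, and
`dart (v, 0), dart (v, 1), dart (v, 2)` are the half-edges met around `v` in cyclic order, starting
from a half-edge of reference. -/
structure RibbonGraph (V E : Type*) where
  dart : V × Fin 3 ≃ E × Bool

/-- The boundary of a face of degree `d`, with edges `e_i = edge i` and vertices `v_i = vert i`,
`i` modulo `d`, all distinct; `e_i` joins `v_i` to `v_{i+1}`, and `o i = 1` if it is oriented from
`v_i` to `v_{i+1}`, `o i = -1` otherwise.  The half-edges of reference are such that the edges
around `v_i` are, in this order, `e_{i-1}`, `e_i` and a third edge `e'_i`. -/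
structure Face {V E : Type*} (Γ : RibbonGraph V E) (d : ℕ) where
  vert : ZMod d → V
  edge : ZMod d → E
  o : ZMod d → ℤˣ
  vert_injective : Function.Injective vert
  edge_injective : Function.Injective edge
  dart_zero : ∀ i, Γ.dart (vert i, 0) = (edge (i - 1), decide (o (i - 1) = 1))
  dart_one : ∀ i, Γ.dart (vert i, 1) = (edge i, decide (o i = -1))

section Graph

variable {V E : Type*}

/-- The (doubled) spins `k` label a spin network state: at each vertex they form a triad. -/
def RibbonGraph.Admissible (Γ : RibbonGraph V E) (k : E → ℤ) : Prop :=
  ∀ v, Triad (k (Γ.dart (v, 0)).1) (k (Γ.dart (v, 1)).1) (k (Γ.dart (v, 2)).1)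

/-- The labels `{k_e}` of the spin network basis. -/
abbrev RibbonGraph.Label (Γ : RibbonGraph V E) : Type _ := {k : E → ℤ // Γ.Admissible k}

open Classical in
/-- The spin network coefficient `ψ({k_e})`, set to zero when `{k_e}` does not label a state. -/
def RibbonGraph.coeff (Γ : RibbonGraph V E) (ψ : Γ.Label → ℂ) (k : E → ℤ) : ℂ :=
  if h : Γ.Admissible k then ψ ⟨k, h⟩ else 0

/-- Every half-edge `x` carries a copy of `⨁_j V_j` if it is the target end of its edge, and a copy
of `⨁_j V_j^*` if it is the source end.  This is the tensor product of all these spaces, in terms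
of its basis made of the tensor products of vectors `|j,m⟩` or `⟨j,m|`. -/
abbrev BigFock (E : Type*) : Type _ := ((E × Bool) → ℕ × ℕ) →₀ ℂ

open Classical in
/-- The operator `T` acting on the half-edge `x`: on a target end as
`|n⟩ ↦ T|n⟩ = ∑_s ⟨s|T|n⟩ |s⟩`, on a source end by transposition,
`⟨n| ↦ ⟨n|T = ∑_s ⟨n|T|s⟩ ⟨s|`. -/
def actAt (x : E × Bool) (T : Module.End ℂ Fock) : Module.End ℂ (BigFock E) :=
  Finsupp.linearCombination ℂ fun n =>
    ∑ᶠ s : ℕ × ℕ, Finsupp.single (Function.update n x s)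
      (if x.2 then T (Finsupp.single (n x) 1) s else T (Finsupp.single s 1) (n x))

/-- `1 / N` on the half-edge `x`, where `N |j,m⟩ = [2j+1] |j,m⟩`. -/
def invN (q : ℝ) (x : E × Bool) : Module.End ℂ (BigFock E) :=
  actAt x (diagOp fun n => (qnum q (dspin n + 1))⁻¹)

/-- Passing from the slot `V_j` to the slot `V_j^*` of an intertwiner, through
`|j,m⟩ ↦ (-1)^{j-m} q^{m/2} ⟨j,-m|` in the slots `0`, `2` and
`|j,m⟩ ↦ (-1)^{j+m} q^{m/2} ⟨j,-m|` in the slot `1`: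
coefficient of the basis vector `⟨j,m'|`, `x = (j+m', j-m')`. -/
def dualCoeff (q : ℝ) (s : Fin 3) (x : ℕ × ℕ) : ℝ :=
  (-1 : ℝ) ^ (if s = 1 then x.2 else x.1) * q ^ (-(dmag x : ℝ) / 4)

/-- Components of the intertwiner `i_{j₀ j₁ j₂}`.  If all three edges are incoming it is
`∑ C^{j₀ j₁ j₂}_{m₀ m₁ -m₂} C^{j₂ j₂ 0}_{-m₂ m₂ 0} |j₀,m₀⟩ ⊗ |j₁,m₁⟩ ⊗ |j₂,m₂⟩`;
the slots of outgoing edges (`inc s = false`) are then dualized. -/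
def intertwiner (q : ℝ) (inc : Fin 3 → Bool) (n : Fin 3 → ℕ × ℕ) : ℝ :=
  let y : Fin 3 → ℕ × ℕ := fun s => if inc s then n s else (n s).swap
  (∏ s, if inc s then 1 else dualCoeff q s (n s)) *
    (cg q (y 0) (y 1) (y 2).swap * cgSinglet q (y 2).swap)

open Classical in
/-- The spin network state `|{k_e}⟩ = ⨂_v i_v`. -/
def RibbonGraph.net [Fintype V] [Fintype E] (Γ : RibbonGraph V E) (q : ℝ) (k : E → ℤ) :
    BigFock E :=
  ∑ n ∈ Fintype.piFinset fun x : E × Bool => Finset.HasAntidiagonal.antidiagonal (k x.1).toNat,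
    Finsupp.single n
      ((∏ v, intertwiner q (fun s => (Γ.dart (v, s)).2) (fun s => n (Γ.dart (v, s))) : ℝ) : ℂ)

/-- The Hermitian product for which the tensor product basis is orthonormal. -/
def braket (φ χ : BigFock E) : ℂ := φ.sum fun n c => (starRingEnd ℂ) c * χ n

/-- `⟨{k_e}| H |ψ⟩ = ∑_j ψ({j_e}) ⟨{k_e}| H |{j_e}⟩` for `|ψ⟩ = ∑_j ψ({j_e}) |{j_e}⟩`; for the
operators below, only finitely many terms are non-zero, so that `ψ` is arbitrary. -/
def RibbonGraph.matrixElement [Fintype V] [Fintype E] (Γ : RibbonGraph V E) (q : ℝ)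
    (H : Module.End ℂ (BigFock E)) (k : Γ.Label) (ψ : Γ.Label → ℂ) : ℂ :=
  ∑ᶠ j : Γ.Label, ψ j * braket (Γ.net q k.1) (H (Γ.net q j.1))

/-! ### Scalar operators and the quantum Hamiltonian -/

variable {Γ : RibbonGraph V E} {d : ℕ}

/-- The end of `e_{i-1}` at `v_i`. -/
def Face.dartIn (F : Face Γ d) (i : ZMod d) : E × Bool := Γ.dart (F.vert i, 0)

/-- The end of `e_i` at `v_i`. -/
def Face.dartOut (F : Face Γ d) (i : ZMod d) : E × Bool := Γ.dart (F.vert i, 1)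

/-- `(-1)^{(1-o)/2 · (1+ε)/2}`. -/
def orientSign (o ε : ℤˣ) : ℂ := if o = -1 ∧ ε = 1 then -1 else 1

/-- The basis vector `|1/2, A⟩`. -/
def halfVec (A : ℤˣ) : ℕ × ℕ := if A = 1 then (1, 0) else (0, 1)

/-- The scalar operator `E^{ε', ε}_{e_i e_{i-1}}` at `v_i`
(`ε'` is the sign of `e_i`, `ε` that of `e_{i-1}`):
`-o √[2] (±)(±) ∑_A _{q^o}C^{1/2 1/2 0}_{A -A 0} T^{oε}_{e_{i-1} v_i, A} ⊗ T^{-o'ε'}_{e_i v_i, -A}`,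
where `o = o_{i-1}`, `o' = o_i`.  On `e_{i-1}`, `T` is `t^ε` if `o = 1` and (acting on the
dual space) `τ^{-ε}` if `o = -1`; on `e_i`, it is `τ^{ε'}` if `o' = -1` and (acting on the dual
space) `t^{-ε'}` if `o' = 1`. -/
def Face.scalarOp (F : Face Γ d) (q : ℝ) (i : ZMod d) (ε' ε : ℤˣ) : Module.End ℂ (BigFock E) :=
  (-((F.o (i - 1) : ℤ) : ℂ) * (Real.sqrt (qnum q 2) : ℂ) *
      orientSign (F.o (i - 1)) ε * orientSign (F.o i) ε') •
    ∑ A : ℤˣ, (cgSinglet (q ^ (F.o (i - 1) : ℤ)) (halfVec A) : ℂ) •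
      (actAt (F.dartIn i) (spinor (q ^ (F.o (i - 1) : ℤ)) (F.o (i - 1) * ε) A) *
        actAt (F.dartOut i) (spinor (q ^ (F.o i : ℤ)) (-(F.o i * ε')) (-A)))

open Classical in
/-- The families of signs that are free at the positions in `s` and equal to `ε` elsewhere. -/
def freeSigns [NeZero d] (s : Finset ℕ) (ε : ZMod d → ℤˣ) : Finset (ZMod d → ℤˣ) :=
  Finset.univ.filter fun η => ∀ i, i ∉ s.image (Nat.cast : ℕ → ZMod d) → η i = ε i

/-- `h^{ε_1,ε_p}_{f,e_1,e_p}`, which is the sum of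
`N_{e_1 v_2}⁻¹ ∑_{η_2,…,η_{p-1}} ∏_{i=2}^{p} E^{η_i,η_{i-1}}_{e_i e_{i-1}} o_i η_i N_{e_i v_i}⁻¹`
and of `(-1)^{d-p} ε_1 ε_p N_{e_p v_{p+1}}⁻¹
∑_{η_{p+1},…,η_d} ∏_{i=p+1}^{d+1} E^{-η_i,-η_{i-1}}_{e_i e_{i-1}} o_i η_i N_{e_i v_i}⁻¹`,
with `η_1 = ε_1`, `η_p = ε_p`. -/
def Face.preHamiltonian [NeZero d] (F : Face Γ d) (q : ℝ) (p : ℕ) (ε : ZMod d → ℤˣ) :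
    Module.End ℂ (BigFock E) :=
  invN q (F.dartIn 2) *
      (∑ η ∈ freeSigns (Finset.Ioo 1 p) ε,
        ((List.range' 2 (p - 1)).map fun i : ℕ =>
          F.scalarOp q i (η i) (η (i - 1)) *
            ((((F.o i * η i : ℤˣ) : ℤ) : ℂ) • invN q (F.dartOut i))).prod) +
    ((-1 : ℂ) ^ (d - p) * (((ε 1 * ε p : ℤˣ) : ℤ) : ℂ)) •
      (invN q (F.dartIn (p + 1)) *
        (∑ η ∈ freeSigns (Finset.Ioc p d) ε,
          ((List.range' (p + 1) (d + 1 - p)).map fun i : ℕ =>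
            F.scalarOp q i (-(η i)) (-(η (i - 1))) *
              ((((F.o i * η i : ℤˣ) : ℤ) : ℂ) • invN q (F.dartOut i))).prod))

/-- The quantum Hamiltonian
`H^{ε_1,ε_p,ε_{p+1},…,ε_d}_{f,e_1,e_p} = (∏_{i=p+1}^{d+1} E^{ε_i,ε_{i-1}}_{e_i e_{i-1}}) h`. -/
def Face.hamiltonian [NeZero d] (F : Face Γ d) (q : ℝ) (p : ℕ) (ε : ZMod d → ℤˣ) :
    Module.End ℂ (BigFock E) :=
  ((List.range' (p + 1) (d + 1 - p)).map fun i : ℕ => F.scalarOp q i (ε i) (ε (i - 1))).prod *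
    F.preHamiltonian q p ε

/-! ### The difference equations -/

/-- `A^{ε,ε'}_o(k, k', l) = o ε [2k+1] (-1)^{k+k'+l} {k, k-ε/2, 1/2; k'-ε'/2, k', l}_q`
(doubled spins). -/
def coeffA (q : ℝ) (o ε ε' : ℤˣ) (k k' l : ℤ) : ℝ :=
  ((o * ε : ℤˣ) : ℤ) * qnum q (k + 1) * sgn ((k + k' + l) / 2) *
    sixj q k (k - (ε : ℤ)) 1 (k' - (ε' : ℤ)) k' l

/-- `B^{ε,ε'}_o(k, k', l) = o ε [2k+1] (-1)^{k+k'+l} {k, k+ε/2, 1/2; k'+ε'/2, k', l}_q`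
(doubled spins). -/
def coeffB (q : ℝ) (o ε ε' : ℤˣ) (k k' l : ℤ) : ℝ :=
  ((o * ε : ℤˣ) : ℤ) * qnum q (k + 1) * sgn ((k + k' + l) / 2) *
    sixj q k (k + (ε : ℤ)) 1 (k' + (ε' : ℤ)) k' l

/-- `α^{ε,ε'}(k, k') = ε ε' [2k'+1] / [2(k - ε/2)+1]` (doubled spins). -/
def coeffAlpha (q : ℝ) (ε ε' : ℤˣ) (k k' : ℤ) : ℝ :=
  ((ε * ε' : ℤˣ) : ℤ) * (qnum q (k' + 1) / qnum q (k - ((ε : ℤ) : ℝ) + 1))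

open Classical in
/-- The labels `k` with `s i` added on the edge `e_i` for every `i`. -/
def Face.shift [NeZero d] (F : Face Γ d) (k : E → ℤ) (s : ZMod d → ℤ) : E → ℤ :=
  fun e => k e + ∑ i, if F.edge i = e then s i else 0

/-- The edge `e'_i`. -/
def Face.legEdge (F : Face Γ d) (i : ZMod d) : E := (Γ.dart (F.vert i, 2)).1

/-- Left-hand side of the difference equation at `{k_e}`. -/
def Face.differenceLHS [NeZero d] (F : Face Γ d) (q : ℝ) (p : ℕ) (ε : ZMod d → ℤˣ)
    (ψ : Γ.Label → ℂ) (k : E → ℤ) : ℂ :=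
  (∑ η ∈ freeSigns (Finset.Ioo 1 p) ε,
      ((∏ i ∈ Finset.Icc 2 p, coeffA q (F.o i) (η i) (η (i - 1))
          (k (F.edge i)) (k (F.edge (i - 1))) (k (F.legEdge i)) : ℝ) : ℂ) *
        Γ.coeff ψ (F.shift k fun i => -(η i : ℤ))) +
    (-1 : ℂ) ^ (d - p) *
      (coeffAlpha q (ε 1) (ε p) (k (F.edge 1)) (k (F.edge p)) : ℂ) *
      ∑ η ∈ freeSigns (Finset.Ioc p d) ε,
        ((∏ i ∈ Finset.Icc (p + 1) (d + 1), coeffB q (F.o i) (η i) (η (i - 1))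
            (k (F.edge i) - (ε i : ℤ)) (k (F.edge (i - 1)) - (ε (i - 1) : ℤ))
            (k (F.legEdge i)) : ℝ) : ℂ) *
          Γ.coeff ψ (F.shift k fun i => -(ε i : ℤ) + (η i : ℤ))

end Graph

end QHam

end

noncomputable section

namespace QHam

/-! ### q-numbers and inverse q-factorials. -/

section QNumbers

variable {q : ℝ}

/-! The equivalence holds separately at each label `k`: up to the norm of the network, the matrix
element is the left-hand side of the difference equation times a factor that is either non-zero or
accompanied by the vanishing of both expressions.

The local input is a Wigner-Eckart statement. A scalar operator contracts two spinors into a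
singlet, so it should send an intertwiner to a multiple of the intertwiner whose first two spins are
shifted by the chosen signs. This is proved by explicit computation: three contiguous relations for
the alternating sum in the Clebsch-Gordan coefficient (`cgSum_lower_lower`, `cgSum_raise_raise`,
`cgSum_raise_lower`) give the action of the contracted spinors, and for spin 1/2 Racah's sum has a
single term, which identifies the multiple with a 6j-symbol times square roots of quantum dimensions
(`mul_spinorPairing`). Pulling dualized legs back to incoming ones makes the result independent of
orientations (`scalar_intertwiner`).

One scalar operator moves the spin at only one end of each of two edges, so products are followed in
`splitNet`, where every half-edge has its own label. Operators at distinct vertices do not see each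
other's shifts (`Face.list_prod_splitNet`), and after a full turn both ends of each edge of the face
have moved equally (`Face.sum_bumpAt`). Hence the Hamiltonian maps networks to combinations of
networks (`Face.hamiltonian_splitNet`). Distinct networks are orthogonal and admissible ones have
non-zero norm, so the constraint at `k` becomes a linear relation between values of `ψ`.

It remains to match coefficients. Let `N_i` be the square root of the product of the quantum
dimensions of `e_i` before and after a shift. A vertex factor divided by the quantum dimension
before the shift is the coefficient `A` or `B` times `N_{i-1} / N_i`. These ratios telescope, to
`N_1 / N_p` in the first sum and `N_p / N_1` in the second; the discrepancy is the dimension ratio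
in `α`. The remaining common factor contains the scalar coefficients at `v_{p+1}, …, v_{d+1}`. It is
non-zero when the labels lowered by `ε` form triads there. If one of these triads fails, it occurs
in every term on both sides: in the label at which `ψ` is evaluated in the first sum, and in a
coefficient in the second (`Face.sums_eq_zero`). -/

theorem qnum_den_ne_zero (hq : 0 < q) (hq1 : q ≠ 1) :
    q ^ (1 / 2 : ℝ) - q ^ (-1 / 2 : ℝ) ≠ 0 := by
  intro h
  have h1 : q ^ (1 / 2 : ℝ) = q ^ (-1 / 2 : ℝ) := sub_eq_zero.mp h
  have h2 := congrArg Real.log h1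
  rw [Real.log_rpow hq, Real.log_rpow hq] at h2
  have : Real.log q ≠ 0 := Real.log_ne_zero_of_pos_of_ne_one hq hq1
  apply this
  linarith

@[simp] theorem qnum_zero (q : ℝ) : qnum q 0 = 0 := by simp [qnum]

theorem qnum_one (hq : 0 < q) (hq1 : q ≠ 1) : qnum q 1 = 1 :=
  div_self (qnum_den_ne_zero hq hq1)

theorem qnum_inv (hq : 0 < q) (x : ℝ) : qnum q⁻¹ x = qnum q x := by
  have h : ∀ y : ℝ, q⁻¹ ^ y = q ^ (-y) := fun y => by
    rw [Real.inv_rpow hq.le, Real.rpow_neg hq.le]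
  simp only [qnum, h]
  rw [show -(x / 2) = -x / 2 by ring, show -(-x / 2) = x / 2 by ring,
    show -(1 / 2 : ℝ) = -1 / 2 by ring, show -(-1 / 2 : ℝ) = 1 / 2 by ring,
    ← neg_sub (q ^ (x / 2)), ← neg_sub (q ^ (1 / 2 : ℝ)), neg_div_neg_eq]

theorem qnum_add (hq : 0 < q) (x y : ℝ) :
    qnum q (x + y) = q ^ (y / 2) * qnum q x + q ^ (-x / 2) * qnum q y := by
  simp only [qnum]
  rw [mul_div_assoc', mul_div_assoc', ← add_div, mul_sub, mul_sub, ← Real.rpow_add hq,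
    ← Real.rpow_add hq, ← Real.rpow_add hq, ← Real.rpow_add hq]
  ring_nf

theorem qnum_add_mul_add (hq : 0 < q) (u v s : ℝ) :
    qnum q (u + s) * qnum q (v + s) = qnum q u * qnum q v + qnum q s * qnum q (u + v + s) := by
  simp only [qnum, div_mul_div_comm, ← add_div]
  congr 1
  simp only [sub_mul, mul_sub, ← Real.rpow_add hq]
  ring_nf

theorem qnum_pos (hq : 0 < q) (hq1 : q ≠ 1) {x : ℝ} (hx : 0 < x) : 0 < qnum q x := by
  -- For base above 1 numerator and denominator are both positive; the symmetry under inversion of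
  -- `q` gives the rest.
  have key : ∀ r : ℝ, 1 < r → 0 < qnum r x := fun r hr => by
    have h0 : (0 : ℝ) < r := by linarith
    unfold qnum
    apply div_pos <;> rw [sub_pos] <;> apply Real.rpow_lt_rpow_of_exponent_lt hr <;> linarith
  rcases lt_or_gt_of_ne hq1 with h | h
  · rw [← qnum_inv hq]
    exact key _ ((one_lt_inv₀ hq).mpr h)
  · exact key q h

theorem qnum_nonneg (hq : 0 < q) (hq1 : q ≠ 1) {x : ℝ} (hx : 0 ≤ x) : 0 ≤ qnum q x := by
  rcases hx.eq_or_lt with rfl | h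
  · simp
  · exact (qnum_pos hq hq1 h).le

theorem qfact_succ (q : ℝ) (n : ℕ) : qfact q (n + 1) = qnum q (n + 1) * qfact q n := by
  rw [qfact, Finset.prod_range_succ, mul_comm, ← qfact]

@[simp] theorem qfact_zero (q : ℝ) : qfact q 0 = 1 := by simp [qfact]

theorem qfact_pos (hq : 0 < q) (hq1 : q ≠ 1) (n : ℕ) : 0 < qfact q n :=
  Finset.prod_pos fun i _ => qnum_pos hq hq1 (by positivity)

@[simp] theorem qfactInv_natCast (q : ℝ) (n : ℕ) : qfactInv q n = (qfact q n)⁻¹ := by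
  simp [qfactInv]

theorem qfactInv_of_neg (q : ℝ) {n : ℤ} (h : n < 0) : qfactInv q n = 0 := by
  simp [qfactInv, h]

/-- The recursion survives at every integer: at `n = 0` because `[0] = 0`, below because both sides
vanish. This lets the contiguous relations be checked term by term without treating the boundary of
the summation range separately. -/
theorem qfactInv_sub_one (hq : 0 < q) (hq1 : q ≠ 1) (n : ℤ) :
    qfactInv q (n - 1) = qnum q n * qfactInv q n := by
  rcases lt_trichotomy n 0 with h | rfl | h
  · rw [qfactInv_of_neg q h, qfactInv_of_neg q (by omega), mul_zero]
  · rw [qfactInv_of_neg q (by omega)]; simp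
  · obtain ⟨m, rfl⟩ : ∃ m : ℕ, n = m + 1 := ⟨(n - 1).toNat, by omega⟩
    rw [add_sub_cancel_right, qfactInv_natCast, ← Nat.cast_succ, qfactInv_natCast, qfact_succ]
    have := (qnum_pos hq hq1 (x := (m : ℝ) + 1) (by positivity)).ne'
    have h2 := (qfact_pos hq hq1 m).ne'
    push_cast
    field_simp

end QNumbers

/-! ### Contiguous relations for the Clebsch-Gordan sum. -/

section ClebschGordanSums

/-- The summand of the Clebsch-Gordan coefficient. -/
def cgTerm (q : ℝ) (a p t u v : ℤ) (z : ℕ) : ℝ :=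
  (-1 : ℝ) ^ z * q ^ (-(z : ℝ) / 2 * (((a + p + t + u + v : ℤ) : ℝ) + 1)) *
    (qfactInv q z * qfactInv q (a - z) * qfactInv q (p - z) * qfactInv q (t - z) *
      qfactInv q (u + z) * qfactInv q (v + z))

/-- The sum occurring in the Clebsch-Gordan coefficient. -/
def cgSum (q : ℝ) (a p t u v : ℤ) : ℝ :=
  ∑ z ∈ Finset.range (a.toNat + 1), cgTerm q a p t u v z

variable {q : ℝ}

theorem cgTerm_eq_zero (a p t u v : ℤ) {z : ℕ} (h : a < z) : cgTerm q a p t u v z = 0 := by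
  rw [cgTerm, qfactInv_of_neg q (n := a - z) (by omega)]
  ring

theorem cgSum_eq_sum_range (a p t u v : ℤ) {N : ℕ} (h : a.toNat + 1 ≤ N) :
    cgSum q a p t u v = ∑ z ∈ Finset.range N, cgTerm q a p t u v z := by
  apply Finset.sum_subset
  · intro z; simp; omega
  · intro z _ hz
    apply cgTerm_eq_zero
    simp at hz; omega

theorem cgSum_symm (a p t u v : ℤ) : cgSum q a p t u v = cgSum q a t p v u := by
  apply Finset.sum_congr rfl
  intro z _
  rw [cgTerm, cgTerm, show a + t + p + v + u = a + p + t + u + v by ring]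
  ring

/-- In the application `a = j₁+j₂-j₃`, `p = j₁-m₁`, `t = j₂+m₂`, `u = j₃-j₂+m₁`, `v = j₃-j₁-m₂`, so
that `a + u = j₁+m₁` and `a + v = j₂-m₂`. The two sums on the left are the two magnetic components
produced when both spins are lowered by 1/2. -/
theorem cgSum_lower_lower (hq : 0 < q) (hq1 : q ≠ 1) (a p t u v : ℤ) :
    qnum q (a + u + 1) * qnum q (a + v + 1) * cgSum q (a + 1) p t u v -
      qnum q (p + 1) * qnum q (t + 1) * cgSum q (a + 1) (p + 1) (t + 1) (u - 1) (v - 1) =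
    q ^ (-((p : ℝ) + t + 1) / 2) * qnum q (a + p + t + u + v + 2) * cgSum q a p t u v := by
  set N := (a + 1).toNat + 1 with hN
  -- Telescoping certificate: once the second sum is shifted by one index, the summands combine to
  -- `G z - G (z + 1)`. `G N` vanishes since `a + 1 - N < 0`, and `G 0` is the term of the second
  -- sum left out by the shift.
  set G : ℕ → ℝ := fun z => (-1 : ℝ) ^ z *
    q ^ (-(z : ℝ) / 2 * ((a : ℝ) + p + t + u + v + 2)) *
    (qfactInv q z * qfactInv q (a + 1 - z) * qfactInv q (p - z) * qfactInv q (t - z) *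
      qfactInv q (u + z - 1) * qfactInv q (v + z - 1)) with hG
  have hf := qfactInv_sub_one hq hq1
  have key : ∀ z : ℕ, qnum q (a + u + 1) * qnum q (a + v + 1) * cgTerm q (a + 1) p t u v z -
      qnum q (p + 1) * qnum q (t + 1) *
        cgTerm q (a + 1) (p + 1) (t + 1) (u - 1) (v - 1) (z + 1) -
      q ^ (-((p : ℝ) + t + 1) / 2) * qnum q (a + p + t + u + v + 2) * cgTerm q a p t u v z
      = G z - G (z + 1) := by
    intro z
    -- All inverse factorials are reduced to one common set, so that only an identity between
    -- q-numbers and powers of `q` is left.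
    have e1 : qfactInv q z = qnum q (z + 1) * qfactInv q (z + 1) := by
      have := hf (z + 1); push_cast at this; rwa [add_sub_cancel_right] at this
    have e2 : qfactInv q (a - z) = qnum q (a + 1 - z) * qfactInv q (a + 1 - z) := by
      have := hf (a + 1 - z); push_cast at this
      rwa [show a + 1 - (z : ℤ) - 1 = a - z by ring] at this
    have e3 : qfactInv q (p - (z + 1)) = qnum q (p - z) * qfactInv q (p - z) := by
      have := hf (p - z); push_cast at this; rwa [sub_sub] at this
    have e4 : qfactInv q (t - (z + 1)) = qnum q (t - z) * qfactInv q (t - z) := by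
      have := hf (t - z); push_cast at this; rwa [sub_sub] at this
    have e5 : qfactInv q (u + z - 1) = qnum q (u + z) * qfactInv q (u + z) := by
      have := hf (u + z); push_cast at this; exact this
    have e6 : qfactInv q (v + z - 1) = qnum q (v + z) * qfactInv q (v + z) := by
      have := hf (v + z); push_cast at this; exact this
    have h1 := qnum_add_mul_add hq (u + z) (v + z) (a + 1 - z)
    have h2 := qnum_add_mul_add hq (p - z) (t - z) (z + 1)
    have h3 := qnum_add hq (p + t - z + 1) (a + u + v + z + 1)
    have h4 : q ^ (-((p : ℝ) + t + 1) / 2) * q ^ (-(z : ℝ) / 2 * ((a : ℝ) + p + t + u + v + 1)) =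
        q ^ (-(p + t - z + 1 : ℝ) / 2) * q ^ (-(z : ℝ) / 2 * ((a : ℝ) + p + t + u + v + 2)) := by
      rw [← Real.rpow_add hq, ← Real.rpow_add hq]; ring_nf
    have h5 : q ^ (-((z : ℝ) + 1) / 2 * ((a : ℝ) + p + t + u + v + 2)) =
        q ^ (-(z : ℝ) / 2 * ((a : ℝ) + p + t + u + v + 2)) *
          (q ^ (-(p + t - z + 1 : ℝ) / 2) * q ^ (-(a + u + v + z + 1 : ℝ) / 2)) := by
      rw [← Real.rpow_add hq, ← Real.rpow_add hq]; ring_nf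
    have h6 : q ^ ((a + u + v + z + 1 : ℝ) / 2) * q ^ (-(a + u + v + z + 1 : ℝ) / 2) = 1 := by
      rw [← Real.rpow_add hq, ← Real.rpow_zero q]; ring_nf
    have h7 : q ^ ((p + t - z + 1 : ℝ) / 2) * q ^ (-(p + t - z + 1 : ℝ) / 2) = 1 := by
      rw [← Real.rpow_add hq, ← Real.rpow_zero q]; ring_nf
    have h8 : qnum q (a + p + t + u + v + 2) =
        q ^ ((p + t - z + 1 : ℝ) / 2) * qnum q (a + u + v + z + 1) +
          q ^ (-(a + u + v + z + 1 : ℝ) / 2) * qnum q (p + t - z + 1) := by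
      rw [← qnum_add hq]; ring_nf
    simp only [cgTerm, hG]
    push_cast
    rw [show p + 1 - ((z : ℤ) + 1) = p - z by ring, show t + 1 - ((z : ℤ) + 1) = t - z by ring,
      show u - 1 + ((z : ℤ) + 1) = u + z by ring, show v - 1 + ((z : ℤ) + 1) = v + z by ring,
      show a + 1 - ((z : ℤ) + 1) = a - z by ring, show u + ((z : ℤ) + 1) - 1 = u + z by ring,
      show v + ((z : ℤ) + 1) - 1 = v + z by ring, e1, e2, e3, e4, e5, e6,
      show (a : ℝ) + 1 + p + t + u + v + 1 = a + p + t + u + v + 2 by ring,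
      show (a : ℝ) + 1 + (p + 1) + (t + 1) + (u - 1) + (v - 1) + 1 = a + p + t + u + v + 2 by ring,
      h5]
    rw [show (u : ℝ) + z + (a + 1 - z) = a + u + 1 by ring,
      show (v : ℝ) + z + (a + 1 - z) = a + v + 1 by ring,
      show (u : ℝ) + z + (v + z) + (a + 1 - z) = a + u + v + z + 1 by ring] at h1
    rw [show (p : ℝ) - z + (z + 1) = p + 1 by ring, show (t : ℝ) - z + (z + 1) = t + 1 by ring,
      show (p : ℝ) - z + (t - z) + (z + 1) = p + t - z + 1 by ring] at h2
    generalize qnum q (a + u + 1) = n1 at *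
    generalize qnum q (a + v + 1) = n2 at *
    generalize qnum q (p + 1) = n3 at *
    generalize qnum q (t + 1) = n4 at *
    generalize qfactInv q (z + 1) = f1 at *
    generalize qfactInv q (a + 1 - z) = f2 at *
    generalize qfactInv q (p - z) = f3 at *
    generalize qfactInv q (t - z) = f4 at *
    generalize qfactInv q (u + z) = f5 at *
    generalize qfactInv q (v + z) = f6 at *
    generalize qnum q (u + z) = m1 at *
    generalize qnum q (v + z) = m2 at *
    generalize qnum q (p - z) = m3 at *
    generalize qnum q (t - z) = m4 at *
    generalize qnum q (z + 1) = m5 at *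
    generalize qnum q (a + 1 - z) = m6 at *
    generalize qnum q (p + t - z + 1) = m7 at *
    generalize qnum q (a + u + v + z + 1) = m8 at *
    rw [h8]
    generalize q ^ (-(z : ℝ) / 2 * ((a : ℝ) + p + t + u + v + 2)) = W at *
    generalize q ^ (-(z : ℝ) / 2 * ((a : ℝ) + p + t + u + v + 1)) = W' at *
    generalize q ^ (-((p : ℝ) + t + 1) / 2) = Y at *
    generalize q ^ ((p + t - z + 1 : ℝ) / 2) = B at *
    generalize q ^ (-(p + t - z + 1 : ℝ) / 2) = B' at *
    generalize q ^ (-(a + u + v + z + 1 : ℝ) / 2) = A' at *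
    rw [pow_succ]
    generalize (-1 : ℝ) ^ z = σ at *
    linear_combination (σ * W * m5 * f1 * f2 * f3 * f4 * f5 * f6) * h1 +
      (σ * W * B' * A' * m6 * f1 * f2 * f3 * f4 * f5 * f6) * h2 -
      (σ * (B * m8 + A' * m7) * m5 * m6 * f1 * f2 * f3 * f4 * f5 * f6) * h4 -
      (σ * W * m5 * m6 * f1 * f2 * f3 * f4 * f5 * f6 * m8) * h7
  have hsum : ∑ z ∈ Finset.range N, (G z - G (z + 1)) = G 0 - G N :=
    Finset.sum_range_sub' G N
  have hGN : G N = 0 := by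
    simp only [hG]
    rw [qfactInv_of_neg q (n := a + 1 - (N : ℕ)) (by omega)]
    ring
  have hG0 : G 0 = qnum q (p + 1) * qnum q (t + 1) *
      cgTerm q (a + 1) (p + 1) (t + 1) (u - 1) (v - 1) 0 := by
    have e3 := hf (p + 1)
    have e4 := hf (t + 1)
    push_cast at e3 e4
    rw [add_sub_cancel_right] at e3 e4
    simp only [hG, cgTerm]
    simp [e3, e4]
    ring
  rw [← Finset.sum_congr rfl (fun z _ => key z)] at hsum
  rw [Finset.sum_sub_distrib, Finset.sum_sub_distrib, ← Finset.mul_sum, ← Finset.mul_sum,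
    ← Finset.mul_sum, hGN, hG0] at hsum
  rw [cgSum_eq_sum_range (a + 1) p t u v (N := N) le_rfl,
    cgSum_eq_sum_range (a + 1) (p + 1) (t + 1) (u - 1) (v - 1) (N := N + 1) (by omega),
    cgSum_eq_sum_range a p t u v (N := N) (by omega), Finset.sum_range_succ' _ N]
  linear_combination hsum

/-- No telescoping is needed: term `z + 1` of the first sum and term `z` of the second combine by
the addition formula for `[a] = [(a-1-z) + (z+1)]`, and the term `z = 0` of the first sum is the
recursion for `1/[a]!`. -/
theorem cgSum_raise_raise (hq : 0 < q) (hq1 : q ≠ 1) (a p t u v : ℤ) :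
    cgSum q (a - 1) p t u v - q ^ (-((2 * a + u + v + p + t : ℤ) : ℝ) / 2) *
      cgSum q (a - 1) (p - 1) (t - 1) (u + 1) (v + 1) = qnum q a * cgSum q a p t u v := by
  set N := a.toNat + 1 with hN
  have hf := qfactInv_sub_one hq hq1
  rw [cgSum_eq_sum_range (a - 1) p t u v (N := N + 1) (by omega),
    cgSum_eq_sum_range (a - 1) (p - 1) (t - 1) (u + 1) (v + 1) (N := N) (by omega),
    cgSum_eq_sum_range a p t u v (N := N + 1) (by omega), Finset.mul_sum, Finset.mul_sum,
    Finset.sum_range_succ', Finset.sum_range_succ' _ N]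
  rw [add_sub_right_comm, ← Finset.sum_sub_distrib]
  congr 1
  · apply Finset.sum_congr rfl
    intro z _
    have e1 : qfactInv q z = qnum q (z + 1) * qfactInv q (z + 1) := by
      have := hf (z + 1); push_cast at this; rwa [add_sub_cancel_right] at this
    have e2 : qfactInv q (a - 1 - z - 1) = qnum q (a - 1 - z) * qfactInv q (a - 1 - z) := by
      have := hf (a - 1 - z); push_cast at this; exact this
    have h1 : qnum q a = q ^ (-((z : ℝ) + 1) / 2) * qnum q (a - 1 - z) +
        q ^ ((a - 1 - z : ℝ) / 2) * qnum q (z + 1) := by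
      have := qnum_add hq (z + 1) (a - 1 - z)
      rw [show (z : ℝ) + 1 + (a - 1 - z) = a by ring] at this
      rw [this]; ring
    have h2 : q ^ (-((2 * a + u + v + p + t : ℤ) : ℝ) / 2) *
        q ^ (-(z : ℝ) / 2 * ((a : ℝ) + p + t + u + v)) =
        q ^ (-((z : ℝ) + 1) / 2 * ((a : ℝ) + p + t + u + v + 1)) *
          q ^ (-(a - 1 - z : ℝ) / 2) := by
      rw [← Real.rpow_add hq, ← Real.rpow_add hq]; push_cast; ring_nf
    have h3 : q ^ (-((z : ℝ) + 1) / 2 * ((a : ℝ) + p + t + u + v)) =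
        q ^ (-((z : ℝ) + 1) / 2 * ((a : ℝ) + p + t + u + v + 1)) * q ^ (((z : ℝ) + 1) / 2) := by
      rw [← Real.rpow_add hq]; ring_nf
    have h4 : qnum q a = q ^ (((z : ℝ) + 1) / 2) * qnum q (a - 1 - z) +
        q ^ (-(a - 1 - z : ℝ) / 2) * qnum q (z + 1) := by
      have := qnum_add hq (a - 1 - z) (z + 1)
      rw [show (a - 1 - z : ℝ) + (z + 1) = a by ring] at this
      rw [this]
    simp only [cgTerm]
    push_cast at h2 ⊢
    rw [show p - 1 - (z : ℤ) = p - (z + 1) by ring, show t - 1 - (z : ℤ) = t - (z + 1) by ring,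
      show u + 1 + (z : ℤ) = u + (z + 1) by ring, show v + 1 + (z : ℤ) = v + (z + 1) by ring,
      show a - 1 - ((z : ℤ) + 1) = a - 1 - z - 1 by ring,
      show a - ((z : ℤ) + 1) = a - 1 - z by ring, e1, e2,
      show (a : ℝ) - 1 + p + t + u + v + 1 = a + p + t + u + v by ring,
      show (a : ℝ) - 1 + (p - 1) + (t - 1) + (u + 1) + (v + 1) + 1 = a + p + t + u + v by ring,
      h3, h4, pow_succ]
    linear_combination ((-1) ^ z * (qnum q (z + 1) * qfactInv q (z + 1) *
      qfactInv q (a - 1 - z) * qfactInv q (p - (z + 1)) * qfactInv q (t - (z + 1)) *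
      qfactInv q (u + (z + 1)) * qfactInv q (v + (z + 1)))) * (-h2)
  · have e2 := hf a
    simp only [cgTerm]
    simp [e2]
    ring

theorem cgSum_raise_lower (hq : 0 < q) (hq1 : q ≠ 1) (a p t u v : ℤ) :
    q ^ (-((a : ℝ) + u) / 2) * qnum q (a + v + 1) * cgSum q a (p - 1) t u (v + 1) +
      q ^ ((p : ℝ) / 2) * qnum q (t + 1) * cgSum q a p (t + 1) (u - 1) v =
    qnum q (u + p) * cgSum q a p t u v := by
  set N := a.toNat + 1 with hN
  have hf := qfactInv_sub_one hq hq1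
  -- Telescoping certificate with no boundary terms: `1/[z-1]!` kills `G 0` and `1/[a-N]!` kills `G
  -- N`.
  set G : ℕ → ℝ := fun z => (-1 : ℝ) ^ z *
    (q ^ (-(z : ℝ) / 2 * ((a : ℝ) + p + t + u + v + 1)) * q ^ (((p : ℝ) + t + 1 - z) / 2)) *
    (qfactInv q (z - 1) * qfactInv q (a - z) * qfactInv q (p - z) * qfactInv q (t + 1 - z) *
      qfactInv q (u + z - 1) * qfactInv q (v + z)) with hG
  have key : ∀ z : ℕ,
      q ^ (-((a : ℝ) + u) / 2) * qnum q (a + v + 1) * cgTerm q a (p - 1) t u (v + 1) z +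
      q ^ ((p : ℝ) / 2) * qnum q (t + 1) * cgTerm q a p (t + 1) (u - 1) v z -
      qnum q (u + p) * cgTerm q a p t u v z = G z - G (z + 1) := by
    intro z
    have e1 : qfactInv q (z - 1) = qnum q z * qfactInv q z := by
      have := hf z; push_cast at this; exact this
    have e2 : qfactInv q (a - (z + 1)) = qnum q (a - z) * qfactInv q (a - z) := by
      have := hf (a - z); push_cast at this; rwa [sub_sub] at this
    have e3 : qfactInv q (p - (z + 1)) = qnum q (p - z) * qfactInv q (p - z) := by
      have := hf (p - z); push_cast at this; rwa [sub_sub] at this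
    have e4 : qfactInv q (t - z) = qnum q (t + 1 - z) * qfactInv q (t + 1 - z) := by
      have := hf (t + 1 - z); push_cast at this
      rwa [show t + 1 - (z : ℤ) - 1 = t - z by ring] at this
    have e5 : qfactInv q (u + z - 1) = qnum q (u + z) * qfactInv q (u + z) := by
      have := hf (u + z); push_cast at this; exact this
    have e6 : qfactInv q (v + z) = qnum q (v + z + 1) * qfactInv q (v + z + 1) := by
      have := hf (v + z + 1); push_cast at this; rwa [add_sub_cancel_right] at this
    have h1 : qnum q (a + v + 1) = q ^ (-(v + z + 1 : ℝ) / 2) * qnum q (a - z) +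
        q ^ ((a - z : ℝ) / 2) * qnum q (v + z + 1) := by
      have := qnum_add hq (v + z + 1) (a - z)
      rw [show (v : ℝ) + z + 1 + (a - z) = a + v + 1 by ring] at this
      rw [this]; ring
    have h2 : qnum q (t + 1) = q ^ (-(z : ℝ) / 2) * qnum q (t + 1 - z) +
        q ^ ((t + 1 - z : ℝ) / 2) * qnum q z := by
      have := qnum_add hq z (t + 1 - z)
      rw [show (z : ℝ) + (t + 1 - z) = t + 1 by ring] at this
      rw [this]; ring
    have h3 : qnum q (u + p) = q ^ ((p - z : ℝ) / 2) * qnum q (u + z) +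
        q ^ (-(u + z : ℝ) / 2) * qnum q (p - z) := by
      have := qnum_add hq (u + z) (p - z)
      rw [show (u : ℝ) + z + (p - z) = u + p by ring] at this
      exact this
    have x1 : q ^ (-((a : ℝ) + u) / 2) * q ^ ((a - z : ℝ) / 2) = q ^ (-(u + z : ℝ) / 2) := by
      rw [← Real.rpow_add hq]; ring_nf
    have x2 : q ^ ((p : ℝ) / 2) * q ^ (-(z : ℝ) / 2) = q ^ ((p - z : ℝ) / 2) := by
      rw [← Real.rpow_add hq]; ring_nf
    have x3 : q ^ ((p : ℝ) / 2) * q ^ ((t + 1 - z : ℝ) / 2) =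
        q ^ (((p : ℝ) + t + 1 - z) / 2) := by
      rw [← Real.rpow_add hq]; ring_nf
    have x4 : q ^ (-((z : ℝ) + 1) / 2 * ((a : ℝ) + p + t + u + v + 1)) *
        q ^ (((p : ℝ) + t + 1 - (z + 1)) / 2) =
        q ^ (-(z : ℝ) / 2 * ((a : ℝ) + p + t + u + v + 1)) *
          (q ^ (-((a : ℝ) + u) / 2) * q ^ (-(v + z + 1 : ℝ) / 2)) := by
      rw [← Real.rpow_add hq, ← Real.rpow_add hq, ← Real.rpow_add hq]; ring_nf
    simp only [cgTerm, hG]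
    push_cast
    rw [x4]
    rw [show p - 1 - (z : ℤ) = p - (z + 1) by ring, show v + 1 + (z : ℤ) = v + z + 1 by ring,
      show u - 1 + (z : ℤ) = u + z - 1 by ring, show (z : ℤ) + 1 - 1 = z by ring,
      show t + 1 - ((z : ℤ) + 1) = t - z by ring, show u + ((z : ℤ) + 1) - 1 = u + z by ring,
      show v + ((z : ℤ) + 1) = v + z + 1 by ring, e1, e2, e3, e4, e5, e6,
      show (a : ℝ) + (p - 1) + t + u + (v + 1) + 1 = a + p + t + u + v + 1 by ring,
      show (a : ℝ) + p + (t + 1) + (u - 1) + v + 1 = a + p + t + u + v + 1 by ring, h1, h2, h3,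
      ← x1, ← x2, ← x3, pow_succ]
    ring
  have hsum : ∑ z ∈ Finset.range N, (G z - G (z + 1)) = G 0 - G N :=
    Finset.sum_range_sub' G N
  have hGN : G N = 0 := by
    simp only [hG]
    rw [qfactInv_of_neg q (n := a - (N : ℕ)) (by omega)]
    ring
  have hG0 : G 0 = 0 := by
    simp only [hG]
    rw [qfactInv_of_neg q (n := ((0 : ℕ) : ℤ) - 1) (by simp)]
    ring
  rw [← Finset.sum_congr rfl (fun z _ => key z), hGN, hG0, Finset.sum_sub_distrib,
    Finset.sum_add_distrib, ← Finset.mul_sum, ← Finset.mul_sum, ← Finset.mul_sum] at hsum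
  rw [cgSum, cgSum, cgSum]
  linear_combination hsum

/-- In terms of spins, these are the cases of a negative occupation number or a violated triangle
inequality. Each forces, in every term, one of the factorial arguments to be negative. -/
theorem cgSum_eq_zero {a p t u v : ℤ}
    (h : a < 0 ∨ p < 0 ∨ t < 0 ∨ a + u < 0 ∨ a + v < 0 ∨ p + u < 0 ∨ t + v < 0) :
    cgSum q a p t u v = 0 := by
  apply Finset.sum_eq_zero
  intro z _
  have hz : a - z < 0 ∨ p - z < 0 ∨ t - z < 0 ∨ u + z < 0 ∨ v + z < 0 := by omega
  rw [cgTerm]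
  rcases hz with h | h | h | h | h <;> rw [qfactInv_of_neg q h] <;> ring

end ClebschGordanSums

/-! ### The 6j-symbols with a spin 1/2. -/

section SixJ

variable {q : ℝ}

theorem Triad.swap {a b c : ℤ} (h : Triad a b c) : Triad b a c := by
  obtain ⟨h1, h2, h3, h4, h5, h6, h7⟩ := h
  exact ⟨h2, h1, h3, by rwa [add_comm b a], h6, h5, by omega⟩

theorem Triad.swap_iff {a b c : ℤ} : Triad b a c ↔ Triad a b c :=
  ⟨Triad.swap, Triad.swap⟩

theorem triCoeff_swap (q : ℝ) (a b c : ℤ) : triCoeff q b a c = triCoeff q a b c := by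
  unfold triCoeff
  rw [add_comm b a, show b - a + c = -a + b + c by ring, show -b + a + c = a - b + c by ring]
  congr 1
  ring

/-- Exchanging the first two columns interchanges the spins before and after a shift, so raising
coefficients follow from lowering ones. -/
theorem sixj_swap (q : ℝ) (a b c d e f : ℤ) : sixj q b a c e d f = sixj q a b c d e f := by
  unfold sixj
  have hiff : (Triad b a c ∧ Triad b d f ∧ Triad e a f ∧ Triad e d c) ↔
      (Triad a b c ∧ Triad a e f ∧ Triad d b f ∧ Triad d e c) := by
    rw [Triad.swap_iff (a := a) (b := b), Triad.swap_iff (a := d) (b := b),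
      Triad.swap_iff (a := a) (b := e), Triad.swap_iff (a := d) (b := e)]
    tauto
  by_cases h : Triad a b c ∧ Triad a e f ∧ Triad d b f ∧ Triad d e c
  · rw [if_pos h, if_pos (hiff.mpr h), triCoeff_swap q a b, triCoeff_swap q d b,
      triCoeff_swap q a e, triCoeff_swap q d e, show b + a + e + d = a + b + d + e by ring,
      show b + a + c = a + b + c by ring, show b + d + f = d + b + f by ring,
      show e + a + f = a + e + f by ring, show e + d + c = d + e + c by ring,
      show a + c + d + f = a + c + d + f by ring]
    congr 1
    · ring
    · apply Finset.sum_congr rfl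
      intro z _
      ring
  · rw [if_neg h, if_neg fun h' => h (hiff.mp h')]

/-- A triad of doubled spins in terms of the numbers of lines joining them. -/
theorem Triad.exists_lines {j k l : ℤ} (h : Triad j k l) :
    ∃ a b c : ℕ, j = a + b ∧ k = a + c ∧ l = b + c := by
  obtain ⟨h1, h2, h3, ⟨r, h4⟩, h5, h6, h7⟩ := h
  exact ⟨(r - l).toNat, (r - k).toNat, (r - j).toNat, by omega, by omega, by omega⟩

theorem triad_lines (a b c : ℕ) : Triad (a + b) (a + c) (b + c) :=
  ⟨by positivity, by positivity, by positivity, ⟨a + b + c, by ring⟩, by omega, by omega, by omega⟩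

theorem triCoeff_lines (q : ℝ) (a b c : ℕ) :
    triCoeff q (a + b) (a + c) (b + c) =
      Real.sqrt (qfact q a * qfact q b * qfact q c / qfact q (a + b + c + 1)) := by
  unfold triCoeff
  rw [show ((a : ℤ) + b + (a + c) - (b + c)) / 2 = a by omega,
    show ((a : ℤ) + b - (a + c) + (b + c)) / 2 = b by omega,
    show (-((a : ℤ) + b) + (a + c) + (b + c)) / 2 = c by omega,
    show ((a : ℤ) + b + (a + c) + (b + c)) / 2 + 1 = (a + b + c + 1 : ℕ) by push_cast; omega]
  simp only [Int.toNat_natCast]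

theorem qfact_one (hq : 0 < q) (hq1 : q ≠ 1) : qfact q 1 = 1 := by
  rw [qfact_succ]; simp [qnum_one hq hq1]

theorem triCoeff_half (hq : 0 < q) (hq1 : q ≠ 1) (k : ℕ) :
    triCoeff q k (k + 1) 1 = (Real.sqrt (qnum q (k + 1) * qnum q (k + 2)))⁻¹ := by
  have h := triCoeff_lines q k 0 1
  have h1 := (qfact_pos hq hq1 k).ne'
  push_cast at h
  rw [add_zero (k : ℤ)] at h
  rw [h, ← Real.sqrt_inv]
  congr 1
  rw [add_zero, qfact_one hq hq1, qfact_succ, qfact_succ]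
  push_cast
  rw [qfact_zero, show (k : ℝ) + 1 + 1 = k + 2 by ring, mul_inv]
  field_simp

theorem sgn_natCast (n : ℕ) : sgn n = (-1) ^ n := by
  simp [sgn, Int.negOnePow]

/-- Racah's sum collapses to `z = a + b + c + 1`: the triad `(a+b+1, a+c+1, b+c)` has this half-sum
and bounds `z` below, and one of the upper factorials bounds it above by the same number. -/
theorem sixj_lower_lower (hq : 0 < q) (hq1 : q ≠ 1) (a b c : ℕ) :
    sixj q (a + c) (a + c + 1) 1 (a + b + 1) (a + b) (b + c) =
      -(-1) ^ (a + b + c) * Real.sqrt (qnum q (a + 1) * qnum q (a + b + c + 2)) /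
        (Real.sqrt (qnum q (a + c + 1) * qnum q (a + c + 2)) *
          Real.sqrt (qnum q (a + b + 1) * qnum q (a + b + 2))) := by
  have hf := qfact_pos hq hq1
  have t1 : Triad (a + c) (a + c + 1) 1 := by
    have := triad_lines (a + c) 0 1; push_cast at this; simpa using this
  have t2 : Triad (a + c : ℤ) (a + b) (b + c) := (triad_lines a b c).swap
  have t3 : Triad (a + b + 1 : ℤ) (a + c + 1) (b + c) := by
    have := triad_lines (a + 1) b c; push_cast at this
    rwa [add_right_comm, add_right_comm (a : ℤ) 1 (c : ℤ)] at this
  have t4 : Triad (a + b + 1) (a + b) 1 := by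
    have := (triad_lines (a + b) 0 1).swap; push_cast at this; simpa using this
  have d1 : triCoeff q (a + c) (a + c + 1) 1 =
      (Real.sqrt (qnum q (a + c + 1) * qnum q (a + c + 2)))⁻¹ := by
    have := triCoeff_half hq hq1 (a + c); push_cast at this; exact this
  have d4 : triCoeff q (a + b + 1) (a + b) 1 =
      (Real.sqrt (qnum q (a + b + 1) * qnum q (a + b + 2)))⁻¹ := by
    rw [triCoeff_swap]
    have := triCoeff_half hq hq1 (a + b); push_cast at this; exact this
  -- The triads of these two triangle coefficients differ by a single line in `a`, so their product
  -- is a square root of two q-numbers times a quotient of factorials.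
  have d2 : triCoeff q (a + c : ℤ) (a + b) (b + c) * triCoeff q (a + b + 1 : ℤ) (a + c + 1) (b + c) =
      Real.sqrt (qnum q (a + 1) * qnum q (a + b + c + 2)) *
        (qfact q a * qfact q b * qfact q c / qfact q (a + b + c + 2)) := by
    rw [triCoeff_swap, triCoeff_lines]
    have := triCoeff_lines q (a + 1) b c
    push_cast at this
    rw [add_right_comm, add_right_comm (a : ℤ) 1 (c : ℤ)] at this
    rw [this, ← Real.sqrt_mul (div_pos (mul_pos (mul_pos (hf _) (hf _)) (hf _)) (hf _)).le]
    rw [Real.sqrt_eq_iff_mul_self_eq_of_pos]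
    · rw [show a + 1 + b + c + 1 = a + b + c + 1 + 1 by ring, qfact_succ, qfact_succ q a]
      have h1 := hf (a + b + c + 1)
      have h2 : 0 < qnum q (a + 1) := qnum_pos hq hq1 (by positivity)
      have h3 : 0 < qnum q (a + b + c + 2) := qnum_pos hq hq1 (by positivity)
      push_cast
      rw [show (a : ℝ) + b + c + 1 + 1 = a + b + c + 2 by ring]
      have h4 := Real.mul_self_sqrt (mul_nonneg h2.le h3.le)
      field_simp
      rw [show ∀ x : ℝ, x ^ 2 = x * x from fun x => sq x, h4]
    · have h2 : 0 < qnum q (a + 1) := qnum_pos hq hq1 (by positivity)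
      have h3 : 0 < qnum q (a + b + c + 2) := qnum_pos hq hq1 (by positivity)
      have := hf a; have := hf b; have := hf c; have := hf (a + b + c + 2)
      positivity
  unfold sixj
  rw [if_pos ⟨t1, t2, t3, t4⟩, Finset.sum_eq_single_of_mem (a + b + c + 1)]
  · rw [mul_assoc (triCoeff _ _ _ _), d1, d4, d2,
      show ((a + b + c + 1 : ℕ) : ℤ) - ((a : ℤ) + c + (a + c + 1) + 1) / 2 = b by omega,
      show ((a + b + c + 1 : ℕ) : ℤ) - ((a : ℤ) + c + (a + b) + (b + c)) / 2 = (1 : ℕ) by omega,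
      show ((a + b + c + 1 : ℕ) : ℤ) - ((a : ℤ) + b + 1 + (a + c + 1) + (b + c)) / 2 = (0 : ℕ) by
        omega,
      show ((a + b + c + 1 : ℕ) : ℤ) - ((a : ℤ) + b + 1 + (a + b) + 1) / 2 = c by omega,
      show ((a : ℤ) + c + (a + c + 1) + (a + b + 1) + (a + b)) / 2 - (a + b + c + 1 : ℕ) = a by
        omega,
      show ((a : ℤ) + c + 1 + 1 + (a + b) + (b + c)) / 2 - (a + b + c + 1 : ℕ) = (0 : ℕ) by omega,
      show ((a : ℤ) + c + 1 + (a + b + 1) + (b + c)) / 2 - (a + b + c + 1 : ℕ) = (0 : ℕ) by omega]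
    simp only [qfactInv_natCast]
    rw [qfact_one hq hq1, qfact_zero, pow_succ]
    have := (hf a).ne'; have := (hf b).ne'; have := (hf c).ne'
    have := (hf (a + b + c + 2)).ne'
    have : a + b + c + 1 + 1 = a + b + c + 2 := rfl
    rw [this]
    field_simp
  · simp; omega
  · intro z _ hz
    rcases lt_or_gt_of_ne hz with h | h
    · rw [qfactInv_of_neg q (n := z - ((a : ℤ) + b + 1 + (a + c + 1) + (b + c)) / 2) (by omega)]
      ring
    · rw [qfactInv_of_neg q (n := ((a : ℤ) + c + 1 + 1 + (a + b) + (b + c)) / 2 - z) (by omega)]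
      ring

/-- Again only `z = a + b + c + 1` survives; the lower bound now comes from the triad `(a+b, a+c+1,
b+c+1)`. -/
theorem sixj_raise_lower (hq : 0 < q) (hq1 : q ≠ 1) (a b c : ℕ) :
    sixj q (a + c) (a + c + 1) 1 (a + b) (a + b + 1) (b + c + 1) =
      -(-1) ^ (a + b + c) * Real.sqrt (qnum q (b + 1) * qnum q (c + 1)) /
        (Real.sqrt (qnum q (a + c + 1) * qnum q (a + c + 2)) *
          Real.sqrt (qnum q (a + b + 1) * qnum q (a + b + 2))) := by
  have hf := qfact_pos hq hq1
  have t1 : Triad (a + c) (a + c + 1) 1 := by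
    have := triad_lines (a + c) 0 1; push_cast at this; simpa using this
  have t2 : Triad (a + c : ℤ) (a + b + 1) (b + c + 1) := by
    have := (triad_lines a (b + 1) c).swap; push_cast at this
    rwa [← add_assoc, add_right_comm (b : ℤ) 1 (c : ℤ)] at this
  have t3 : Triad (a + b : ℤ) (a + c + 1) (b + c + 1) := by
    have := triad_lines a b (c + 1); push_cast at this
    rwa [← add_assoc, ← add_assoc] at this
  have t4 : Triad (a + b) (a + b + 1) 1 := by
    have := triad_lines (a + b) 0 1; push_cast at this; simpa using this
  have d1 : triCoeff q (a + c) (a + c + 1) 1 =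
      (Real.sqrt (qnum q (a + c + 1) * qnum q (a + c + 2)))⁻¹ := by
    have := triCoeff_half hq hq1 (a + c); push_cast at this; exact this
  have d4 : triCoeff q (a + b) (a + b + 1) 1 =
      (Real.sqrt (qnum q (a + b + 1) * qnum q (a + b + 2)))⁻¹ := by
    have := triCoeff_half hq hq1 (a + b); push_cast at this; exact this
  have d2 : triCoeff q (a + c : ℤ) (a + b + 1) (b + c + 1) *
      triCoeff q (a + b : ℤ) (a + c + 1) (b + c + 1) =
      Real.sqrt (qnum q (b + 1) * qnum q (c + 1)) *
        (qfact q a * qfact q b * qfact q c / qfact q (a + b + c + 2)) := by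
    have e1 := triCoeff_lines q a (b + 1) c
    have e2 := triCoeff_lines q a b (c + 1)
    push_cast at e1 e2
    rw [← add_assoc, add_right_comm (b : ℤ) 1 (c : ℤ)] at e1
    rw [← add_assoc, ← add_assoc] at e2
    rw [triCoeff_swap, e1, e2, ← Real.sqrt_mul (div_pos (mul_pos (mul_pos (hf _) (hf _)) (hf _)) (hf _)).le]
    rw [Real.sqrt_eq_iff_mul_self_eq_of_pos]
    · rw [show a + (b + 1) + c + 1 = a + b + c + 2 by ring,
        show a + b + (c + 1) + 1 = a + b + c + 2 by ring, qfact_succ q b, qfact_succ q c]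
      have h1 := hf (a + b + c + 2)
      have h2 : 0 < qnum q (b + 1) := qnum_pos hq hq1 (by positivity)
      have h3 : 0 < qnum q (c + 1) := qnum_pos hq hq1 (by positivity)
      have h4 := Real.mul_self_sqrt (mul_nonneg h2.le h3.le)
      field_simp
      rw [show ∀ x : ℝ, x ^ 2 = x * x from fun x => sq x, h4]
    · have h2 : 0 < qnum q (b + 1) := qnum_pos hq hq1 (by positivity)
      have h3 : 0 < qnum q (c + 1) := qnum_pos hq hq1 (by positivity)
      have := hf a; have := hf b; have := hf c; have := hf (a + b + c + 2)
      positivity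
  unfold sixj
  rw [if_pos ⟨t1, t2, t3, t4⟩, Finset.sum_eq_single_of_mem (a + b + c + 1)]
  · rw [mul_assoc (triCoeff _ _ _ _), d1, d4, d2,
      show ((a + b + c + 1 : ℕ) : ℤ) - ((a : ℤ) + c + (a + c + 1) + 1) / 2 = b by omega,
      show ((a + b + c + 1 : ℕ) : ℤ) - ((a : ℤ) + c + (a + b + 1) + (b + c + 1)) / 2 = (0 : ℕ) by
        omega,
      show ((a + b + c + 1 : ℕ) : ℤ) - ((a : ℤ) + b + (a + c + 1) + (b + c + 1)) / 2 = (0 : ℕ) by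
        omega,
      show ((a + b + c + 1 : ℕ) : ℤ) - ((a : ℤ) + b + (a + b + 1) + 1) / 2 = c by omega,
      show ((a : ℤ) + c + (a + c + 1) + (a + b) + (a + b + 1)) / 2 - (a + b + c + 1 : ℕ) = a by
        omega,
      show ((a : ℤ) + c + 1 + 1 + (a + b + 1) + (b + c + 1)) / 2 - (a + b + c + 1 : ℕ) = (1 : ℕ) by
        omega,
      show ((a : ℤ) + c + 1 + (a + b) + (b + c + 1)) / 2 - (a + b + c + 1 : ℕ) = (0 : ℕ) by omega]
    simp only [qfactInv_natCast]
    rw [qfact_one hq hq1, qfact_zero, pow_succ]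
    have := (hf a).ne'; have := (hf b).ne'; have := (hf c).ne'
    have := (hf (a + b + c + 2)).ne'
    have : a + b + c + 1 + 1 = a + b + c + 2 := rfl
    rw [this]
    field_simp
  · simp; omega
  · intro z _ hz
    rcases lt_or_gt_of_ne hz with h | h
    · rw [qfactInv_of_neg q (n := z - ((a : ℤ) + b + (a + c + 1) + (b + c + 1)) / 2) (by omega)]
      ring
    · rw [qfactInv_of_neg q (n := ((a : ℤ) + c + 1 + (a + b) + (b + c + 1)) / 2 - z) (by omega)]
      ring

end SixJ

/-! ### Contracted spinors acting on Clebsch-Gordan coefficients. -/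

section ScalarAction

variable {q : ℝ}

/-- The occupation numbers that the spinor component `t^ε_A` sends to `m`. -/
def spinorSrc (ε A : ℤˣ) (m : ℕ × ℕ) : ℕ × ℕ :=
  if ε = 1 then if A = 1 then (m.1, m.2 - 1) else (m.1 - 1, m.2)
  else if A = 1 then (m.1 + 1, m.2) else (m.1, m.2 + 1)

/-- The matrix element of `t^ε_A` from `spinorSrc ε A m` to `m`. -/
def spinorWt (q : ℝ) (ε A : ℤˣ) (m : ℕ × ℕ) : ℝ :=
  if ε = 1 then
    if A = 1 then -(Real.sqrt (qnum q m.2) * q ^ (-((m.1 : ℝ) + 1) / 4))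
    else Real.sqrt (qnum q m.1) * q ^ (((m.2 : ℝ) + 1) / 4)
  else
    if A = 1 then q ^ ((m.2 : ℝ) / 4) * Real.sqrt (qnum q (m.1 + 1))
    else q ^ (-(m.1 : ℝ) / 4) * Real.sqrt (qnum q (m.2 + 1))

/-- The scalar combination of two spinors applied to the Clebsch-Gordan coefficients. -/
def spinorPairing (q : ℝ) (ε ε' : ℤˣ) (x y w : ℕ × ℕ) : ℝ :=
  ∑ A : ℤˣ, cgSinglet q (halfVec A) * (spinorWt q ε A x * spinorWt q⁻¹ ε' (-A) y *
    cg q (spinorSrc ε A x) (spinorSrc ε' (-A) y) w)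

theorem sum_intUnits {M : Type*} [AddCommMonoid M] (f : ℤˣ → M) : ∑ A, f A = f 1 + f (-1) := by
  rw [UnitsInt.univ, Finset.sum_pair (by decide)]

/-- `√([n₁]! [n₂]!)`. -/
def sqrtFact (q : ℝ) (n : ℕ × ℕ) : ℝ := Real.sqrt (qfact q n.1) * Real.sqrt (qfact q n.2)

theorem sqrt_qnum_mul_sqrtFact_fst (hq : 0 < q) (hq1 : q ≠ 1) (m n : ℕ) :
    Real.sqrt (qnum q (m + 1)) * sqrtFact q (m + 1, n) = qnum q (m + 1) * sqrtFact q (m, n) := by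
  have h : 0 ≤ qnum q (m + 1) := qnum_nonneg hq hq1 (by positivity)
  rw [sqrtFact, sqrtFact, qfact_succ, Real.sqrt_mul h]
  linear_combination Real.sqrt (qfact q m) * Real.sqrt (qfact q n) * Real.mul_self_sqrt h

theorem sqrt_qnum_mul_sqrtFact_snd (hq : 0 < q) (hq1 : q ≠ 1) (m n : ℕ) :
    Real.sqrt (qnum q (n + 1)) * sqrtFact q (m, n + 1) = qnum q (n + 1) * sqrtFact q (m, n) := by
  have h : 0 ≤ qnum q (n + 1) := qnum_nonneg hq hq1 (by positivity)
  rw [sqrtFact, sqrtFact, qfact_succ, Real.sqrt_mul h]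
  linear_combination Real.sqrt (qfact q m) * Real.sqrt (qfact q n) * Real.mul_self_sqrt h

theorem sqrtFact_succ_fst (hq : 0 < q) (hq1 : q ≠ 1) (m n : ℕ) :
    Real.sqrt (qnum q (m + 1)) * sqrtFact q (m, n) = 1 * sqrtFact q (m + 1, n) := by
  have h : 0 ≤ qnum q (m + 1) := qnum_nonneg hq hq1 (by positivity)
  rw [sqrtFact, sqrtFact, qfact_succ, Real.sqrt_mul h]
  ring

theorem sqrtFact_succ_snd (hq : 0 < q) (hq1 : q ≠ 1) (m n : ℕ) :
    Real.sqrt (qnum q (n + 1)) * sqrtFact q (m, n) = 1 * sqrtFact q (m, n + 1) := by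
  have h : 0 ≤ qnum q (n + 1) := qnum_nonneg hq hq1 (by positivity)
  rw [sqrtFact, sqrtFact, qfact_succ, Real.sqrt_mul h]
  ring

/-- The balance equations say that `a = j₁+j₂-j₃` and that the magnetic numbers add up. Factoring
the square root into one `sqrtFact` per leg lets the weights of the spinors be absorbed leg by leg.
-/
theorem cg_eq_of_balance (hq : 0 < q) (hq1 : q ≠ 1) {x y w : ℕ × ℕ} {a : ℤ}
    (h1 : (x.1 : ℤ) + y.1 = a + w.1) (h2 : (x.2 : ℤ) + y.2 = a + w.2)
    (h : Triad (dspin x) (dspin y) (dspin w)) :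
    cg q x y w = q ^ ((a * (a + w.1 + w.2 + 1) + x.2 * y.1 - x.1 * y.2 : ℝ) / 4) *
      triCoeff q (dspin x) (dspin y) (dspin w) * Real.sqrt (qnum q (dspin w + 1)) *
      (sqrtFact q x * sqrtFact q y * sqrtFact q w) *
      cgSum q a x.2 y.1 (w.1 - y.1) (w.2 - x.2) := by
  have hm : dmag x + dmag y = dmag w := by unfold dmag; omega
  have ha : (dspin x + dspin y - dspin w) / 2 = a := by unfold dspin; omega
  have e1 : (x.1 : ℝ) = a + w.1 - y.1 := by
    have : (x.1 : ℤ) = a + w.1 - y.1 := by omega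
    exact_mod_cast this
  have e2 : (y.2 : ℝ) = a + w.2 - x.2 := by
    have : (y.2 : ℤ) = a + w.2 - x.2 := by omega
    exact_mod_cast this
  have hf := fun n => (qfact_pos hq hq1 n).le
  have hn : 0 ≤ qnum q (dspin w + 1) := qnum_nonneg hq hq1 (by unfold dspin; positivity)
  unfold cg
  rw [if_pos ⟨h, hm⟩, ha, Real.sqrt_mul hn,
    Real.sqrt_mul (mul_nonneg (mul_nonneg (mul_nonneg (mul_nonneg (hf _) (hf _)) (hf _)) (hf _))
      (hf _)),
    Real.sqrt_mul (mul_nonneg (mul_nonneg (mul_nonneg (hf _) (hf _)) (hf _)) (hf _)),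
    Real.sqrt_mul (mul_nonneg (mul_nonneg (hf _) (hf _)) (hf _)),
    Real.sqrt_mul (mul_nonneg (hf _) (hf _)), Real.sqrt_mul (hf _)]
  have hexp : ((dspin x + dspin y - dspin w : ℤ) : ℝ) / 2 *
          (((dspin x + dspin y + dspin w : ℤ) : ℝ) / 2 + 1) / 4 +
        ((dspin x * dmag y - dspin y * dmag x : ℤ) : ℝ) / 8 =
      (a * (a + w.1 + w.2 + 1) + x.2 * y.1 - x.1 * y.2 : ℝ) / 4 := by
    unfold dspin dmag
    push_cast
    rw [e1, e2]
    ring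
  rw [hexp]
  have hsum : ∑ z ∈ Finset.range (a.toNat + 1), (-1 : ℝ) ^ z *
          q ^ (-(z : ℝ) / 2 * (((dspin x + dspin y + dspin w : ℤ) : ℝ) / 2 + 1)) *
          (qfactInv q z * qfactInv q (a - z) *
            qfactInv q ((x.2 : ℤ) - z) * qfactInv q ((y.1 : ℤ) - z) *
            qfactInv q ((w.1 : ℤ) - y.1 + z) * qfactInv q ((w.2 : ℤ) - x.2 + z)) =
      cgSum q a x.2 y.1 (w.1 - y.1) (w.2 - x.2) := by
    apply Finset.sum_congr rfl
    intro z _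
    rw [cgTerm]
    congr 4
    unfold dspin
    push_cast
    rw [e1, e2]
    ring
  rw [hsum]
  simp only [sqrtFact]
  ring

theorem cg_eq_zero {x y w : ℕ × ℕ}
    (h : ¬(Triad (dspin x) (dspin y) (dspin w) ∧ dmag x + dmag y = dmag w)) : cg q x y w = 0 :=
  if_neg h

/-- A Clebsch-Gordan coefficient at neighbouring arguments, with its prefactor brought back to
the arguments `x`, `y`. -/
theorem mul_cg_eq (hq : 0 < q) (hq1 : q ≠ 1) {x y x' y' w : ℕ × ℕ} {a' j k : ℤ} {r s cx cy : ℝ}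
    (hx : r * sqrtFact q x' = cx * sqrtFact q x) (hy : s * sqrtFact q y' = cy * sqrtFact q y)
    (h1 : (x'.1 : ℤ) + y'.1 = a' + w.1) (h2 : (x'.2 : ℤ) + y'.2 = a' + w.2)
    (hj : dspin x' = j) (hk : dspin y' = k) (h : Triad j k (dspin w)) :
    r * s * cg q x' y' w =
      q ^ ((a' * (a' + w.1 + w.2 + 1) + x'.2 * y'.1 - x'.1 * y'.2 : ℝ) / 4) *
      (triCoeff q j k (dspin w) * Real.sqrt (qnum q (dspin w + 1)) *
      (sqrtFact q x * sqrtFact q y * sqrtFact q w)) *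
      (cx * cy * cgSum q a' x'.2 y'.1 (w.1 - y'.1) (w.2 - x'.2)) := by
  subst hj hk
  rw [cg_eq_of_balance hq hq1 h1 h2 h]
  linear_combination (q ^ ((a' * (a' + w.1 + w.2 + 1) + x'.2 * y'.1 - x'.1 * y'.2 : ℝ) / 4) *
      (triCoeff q (dspin x') (dspin y') (dspin w) * Real.sqrt (qnum q (dspin w + 1)) *
       sqrtFact q w) * cgSum q a' x'.2 y'.1 (w.1 - y'.1) (w.2 - x'.2)) *
    (s * sqrtFact q y' * hx + cx * sqrtFact q x * hy)

theorem sqrt_two_mul_cgSinglet_up (hq : 0 < q) (hq1 : q ≠ 1) :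
    Real.sqrt (qnum q 2) * cgSinglet q (halfVec 1) = q ^ (1 / 4 : ℝ) := by
  have := (Real.sqrt_pos.mpr (qnum_pos hq hq1 (x := 2) (by norm_num))).ne'
  have h : cgSinglet q (halfVec 1) = q ^ (1 / 4 : ℝ) / Real.sqrt (qnum q 2) := by
    simp [cgSinglet, halfVec, dmag, dspin]
    norm_num
  rw [h]
  field_simp

theorem sqrt_two_mul_cgSinglet_down (hq : 0 < q) (hq1 : q ≠ 1) :
    Real.sqrt (qnum q 2) * cgSinglet q (halfVec (-1)) = -q ^ (-1 / 4 : ℝ) := by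
  have := (Real.sqrt_pos.mpr (qnum_pos hq hq1 (x := 2) (by norm_num))).ne'
  have h : cgSinglet q (halfVec (-1)) = -q ^ (-1 / 4 : ℝ) / Real.sqrt (qnum q 2) := by
    simp [cgSinglet, halfVec, dmag, dspin]
    norm_num
  rw [h]
  field_simp

theorem inv_rpow_eq (hq : 0 < q) (y : ℝ) : q⁻¹ ^ y = q ^ (-y) := by
  rw [Real.inv_rpow hq.le, Real.rpow_neg hq.le]

/-- The triangle condition concerns the spins before the operator acts; those of `x`, `y`, `w` may
violate it. After the powers of `q` of the two components are brought to one prefactor (`g1`, `g2`),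
what is left is `cgSum_lower_lower`. -/
theorem spinorPairing_lower_lower (hq : 0 < q) (hq1 : q ≠ 1) {x y w : ℕ × ℕ} {a : ℤ}
    (h1 : (x.1 : ℤ) + y.1 = a + w.1) (h2 : (x.2 : ℤ) + y.2 = a + w.2)
    (h : Triad (dspin x + 1) (dspin y + 1) (dspin w)) :
    Real.sqrt (qnum q 2) * spinorPairing q (-1) (-1) x y w =
      q ^ ((a * (a + w.1 + w.2 + 1) + x.2 * y.1 - x.1 * y.2 : ℝ) / 4) *
      (triCoeff q (dspin x + 1) (dspin y + 1) (dspin w) * Real.sqrt (qnum q (dspin w + 1)) *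
      (sqrtFact q x * sqrtFact q y * sqrtFact q w)) *
      (qnum q (a + w.1 + w.2 + 2) * cgSum q a x.2 y.1 (w.1 - y.1) (w.2 - x.2)) := by
  obtain ⟨x1, x2⟩ := x
  obtain ⟨y1, y2⟩ := y
  obtain ⟨w1, w2⟩ := w
  simp only at h1 h2 ⊢
  have r1 : (x1 : ℝ) = a + w1 - y1 := by
    have : (x1 : ℤ) = a + w1 - y1 := by omega
    exact_mod_cast this
  have r2 : (y2 : ℝ) = a + w2 - x2 := by
    have : (y2 : ℤ) = a + w2 - x2 := by omega
    exact_mod_cast this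
  have c1 := mul_cg_eq hq hq1 (x := (x1, x2)) (y := (y1, y2)) (w := (w1, w2)) (a' := a + 1)
    (sqrt_qnum_mul_sqrtFact_fst hq hq1 x1 x2) (sqrt_qnum_mul_sqrtFact_snd hq hq1 y1 y2)
    (by push_cast; omega) (by push_cast; omega)
    (show dspin (x1 + 1, x2) = dspin (x1, x2) + 1 by simp [dspin]; ring)
    (show dspin (y1, y2 + 1) = dspin (y1, y2) + 1 by simp [dspin]; ring) h
  have c2 := mul_cg_eq hq hq1 (x := (x1, x2)) (y := (y1, y2)) (w := (w1, w2)) (a' := a + 1)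
    (sqrt_qnum_mul_sqrtFact_snd hq hq1 x1 x2) (sqrt_qnum_mul_sqrtFact_fst hq hq1 y1 y2)
    (by push_cast; omega) (by push_cast; omega)
    (show dspin (x1, x2 + 1) = dspin (x1, x2) + 1 by simp [dspin]; ring)
    (show dspin (y1 + 1, y2) = dspin (y1, y2) + 1 by simp [dspin]; ring) h
  have rel := cgSum_lower_lower hq hq1 a x2 y1 (w1 - y1) (w2 - x2)
  push_cast at c1 c2 rel
  rw [show (a : ℝ) + (w1 - y1) + 1 = x1 + 1 by rw [r1]; ring,
    show (a : ℝ) + (w2 - x2) + 1 = y2 + 1 by rw [r2]; ring,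
    show (a : ℝ) + x2 + y1 + (w1 - y1) + (w2 - x2) + 2 = a + w1 + w2 + 2 by ring] at rel
  rw [show (w1 : ℤ) - (y1 + 1) = w1 - y1 - 1 by ring,
    show (w2 : ℤ) - (x2 + 1) = w2 - x2 - 1 by ring] at c2
  rw [spinorPairing, sum_intUnits, mul_add,
    ← mul_assoc _ (cgSinglet q (halfVec 1)), ← mul_assoc _ (cgSinglet q (halfVec (-1))),
    sqrt_two_mul_cgSinglet_up hq hq1, sqrt_two_mul_cgSinglet_down hq hq1]
  simp only [spinorWt, spinorSrc, qnum_inv hq, inv_rpow_eq hq, neg_neg,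
    show ((-1 : ℤˣ) = 1) = False by decide, if_true, if_false]
  have g1 : q ^ (1 / 4 : ℝ) * q ^ ((x2 : ℝ) / 4) * q ^ (-(-(y1 : ℝ) / 4)) *
      q ^ (((a + 1) * (a + 1 + w1 + w2 + 1) + x2 * y1 - (x1 + 1) * (y2 + 1) : ℝ) / 4) =
      q ^ ((a * (a + w1 + w2 + 1) + x2 * y1 - x1 * y2 : ℝ) / 4) * q ^ (((x2 : ℝ) + y1 + 1) / 2) := by
    simp only [← Real.rpow_add hq]; rw [r1, r2]; ring_nf
  have g2 : q ^ (-1 / 4 : ℝ) * q ^ (-(x1 : ℝ) / 4) * q ^ (-((y2 : ℝ) / 4)) *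
      q ^ (((a + 1) * (a + 1 + w1 + w2 + 1) + (x2 + 1) * (y1 + 1) - x1 * y2 : ℝ) / 4) =
      q ^ ((a * (a + w1 + w2 + 1) + x2 * y1 - x1 * y2 : ℝ) / 4) * q ^ (((x2 : ℝ) + y1 + 1) / 2) := by
    simp only [← Real.rpow_add hq]; rw [r1, r2]; ring_nf
  have g3 : q ^ (((x2 : ℝ) + y1 + 1) / 2) * q ^ (-((x2 : ℝ) + y1 + 1) / 2) = 1 := by
    rw [← Real.rpow_add hq, ← Real.rpow_zero q]; ring_nf
  set C := triCoeff q (dspin (x1, x2) + 1) (dspin (y1, y2) + 1) (dspin (w1, w2)) *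
    Real.sqrt (qnum q (dspin (w1, w2) + 1)) *
      (sqrtFact q (x1, x2) * sqrtFact q (y1, y2) * sqrtFact q (w1, w2))
  linear_combination q ^ (1 / 4 : ℝ) * q ^ ((x2 : ℝ) / 4) * q ^ (-(-(y1 : ℝ) / 4)) * c1 -
    q ^ (-1 / 4 : ℝ) * q ^ (-(x1 : ℝ) / 4) * q ^ (-((y2 : ℝ) / 4)) * c2 +
    C * qnum q (x1 + 1) * qnum q (y2 + 1) * cgSum q (a + 1) x2 y1 (w1 - y1) (w2 - x2) * g1 -
    C * qnum q (x2 + 1) * qnum q (y1 + 1) *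
      cgSum q (a + 1) (x2 + 1) (y1 + 1) (w1 - y1 - 1) (w2 - x2 - 1) * g2 +
    C * q ^ ((a * (a + w1 + w2 + 1) + x2 * y1 - x1 * y2 : ℝ) / 4) *
      q ^ (((x2 : ℝ) + y1 + 1) / 2) * rel +
    C * q ^ ((a * (a + w1 + w2 + 1) + x2 * y1 - x1 * y2 : ℝ) / 4) *
      qnum q (a + w1 + w2 + 2) * cgSum q a x2 y1 (w1 - y1) (w2 - x2) * g3

theorem spinorPairing_raise_raise (hq : 0 < q) (hq1 : q ≠ 1) {x y w : ℕ × ℕ} {a : ℤ}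
    (h1 : (x.1 : ℤ) + y.1 = a + w.1) (h2 : (x.2 : ℤ) + y.2 = a + w.2)
    (h : Triad (dspin x - 1) (dspin y - 1) (dspin w)) :
    Real.sqrt (qnum q 2) * spinorPairing q 1 1 x y w =
      q ^ ((a * (a + w.1 + w.2 + 1) + x.2 * y.1 - x.1 * y.2 : ℝ) / 4) *
      (triCoeff q (dspin x - 1) (dspin y - 1) (dspin w) * Real.sqrt (qnum q (dspin w + 1)) *
      (sqrtFact q x * sqrtFact q y * sqrtFact q w)) *
      (qnum q a * cgSum q a x.2 y.1 (w.1 - y.1) (w.2 - x.2)) := by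
  obtain ⟨x1, x2⟩ := x
  obtain ⟨y1, y2⟩ := y
  obtain ⟨w1, w2⟩ := w
  simp only at h1 h2 ⊢
  have r1 : (x1 : ℝ) = a + w1 - y1 := by
    have : (x1 : ℤ) = a + w1 - y1 := by omega
    exact_mod_cast this
  have r2 : (y2 : ℝ) = a + w2 - x2 := by
    have : (y2 : ℤ) = a + w2 - x2 := by omega
    exact_mod_cast this
  set C := triCoeff q (dspin (x1, x2) - 1) (dspin (y1, y2) - 1) (dspin (w1, w2)) *
    Real.sqrt (qnum q (dspin (w1, w2) + 1)) *
      (sqrtFact q (x1, x2) * sqrtFact q (y1, y2) * sqrtFact q (w1, w2)) with hC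
  have c1 : Real.sqrt (qnum q x2) * Real.sqrt (qnum q y1) * cg q (x1, x2 - 1) (y1 - 1, y2) (w1, w2) =
      q ^ (((a - 1) * (a - 1 + w1 + w2 + 1) + (x2 - 1) * (y1 - 1) - x1 * y2 : ℝ) / 4) * C *
        cgSum q (a - 1) (x2 - 1) (y1 - 1) (w1 - y1 + 1) (w2 - x2 + 1) := by
    -- At `x2 = 0` the truncated subtraction is harmless: the weight `√[0]` kills the left side, and
    -- a sum with argument `-1` vanishes on the right. The other boundary cases are alike.
    rcases x2 with _ | m
    · rw [cgSum_eq_zero (by omega)]; simp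
    rcases y1 with _ | n
    · rw [cgSum_eq_zero (by omega)]; simp
    have := mul_cg_eq hq hq1 (x := (x1, m + 1)) (y := (n + 1, y2)) (w := (w1, w2)) (a' := a - 1)
      (x' := (x1, m)) (y' := (n, y2)) (cx := 1) (cy := 1)
      (sqrtFact_succ_snd hq hq1 _ _) (sqrtFact_succ_fst hq hq1 _ _)
      (by push_cast at h1 ⊢; omega) (by push_cast at h2 ⊢; omega)
      (show dspin (x1, m) = dspin (x1, m + 1) - 1 by simp [dspin]; ring)
      (show dspin (n, y2) = dspin (n + 1, y2) - 1 by simp [dspin]; ring) h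
    push_cast at this ⊢
    simp only [add_tsub_cancel_right]
    rw [this, show (w1 : ℤ) - (n + 1) + 1 = w1 - n by ring,
      show (w2 : ℤ) - (m + 1) + 1 = w2 - m by ring, one_mul, one_mul]
  have c2 : Real.sqrt (qnum q x1) * Real.sqrt (qnum q y2) * cg q (x1 - 1, x2) (y1, y2 - 1) (w1, w2) =
      q ^ (((a - 1) * (a - 1 + w1 + w2 + 1) + x2 * y1 - (x1 - 1) * (y2 - 1) : ℝ) / 4) * C *
        cgSum q (a - 1) x2 y1 (w1 - y1) (w2 - x2) := by
    rcases x1 with _ | m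
    · rw [cgSum_eq_zero (by omega)]; simp
    rcases y2 with _ | n
    · rw [cgSum_eq_zero (by omega)]; simp
    have := mul_cg_eq hq hq1 (x := (m + 1, x2)) (y := (y1, n + 1)) (w := (w1, w2)) (a' := a - 1)
      (x' := (m, x2)) (y' := (y1, n)) (cx := 1) (cy := 1)
      (sqrtFact_succ_fst hq hq1 _ _) (sqrtFact_succ_snd hq hq1 _ _)
      (by push_cast at h1 ⊢; omega) (by push_cast at h2 ⊢; omega)
      (show dspin (m, x2) = dspin (m + 1, x2) - 1 by simp [dspin]; ring)
      (show dspin (y1, n) = dspin (y1, n + 1) - 1 by simp [dspin]; ring) h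
    push_cast at this ⊢
    simp only [add_tsub_cancel_right]
    rw [this, one_mul, one_mul]
  have rel := cgSum_raise_raise hq hq1 a x2 y1 (w1 - y1) (w2 - x2)
  push_cast at rel
  rw [spinorPairing, sum_intUnits, mul_add,
    ← mul_assoc _ (cgSinglet q (halfVec 1)), ← mul_assoc _ (cgSinglet q (halfVec (-1))),
    sqrt_two_mul_cgSinglet_up hq hq1, sqrt_two_mul_cgSinglet_down hq hq1]
  simp only [spinorWt, spinorSrc, qnum_inv hq, inv_rpow_eq hq, neg_neg,
    show ((-1 : ℤˣ) = 1) = False by decide, if_true, if_false]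
  have g1 : q ^ (1 / 4 : ℝ) * q ^ (-((x1 : ℝ) + 1) / 4) * q ^ (-(((y2 : ℝ) + 1) / 4)) *
      q ^ (((a - 1) * (a - 1 + w1 + w2 + 1) + (x2 - 1) * (y1 - 1) - x1 * y2 : ℝ) / 4) =
      q ^ ((a * (a + w1 + w2 + 1) + x2 * y1 - x1 * y2 : ℝ) / 4) *
        q ^ (-(2 * a + (w1 - y1) + (w2 - x2) + x2 + y1 : ℝ) / 2) := by
    simp only [← Real.rpow_add hq]; rw [r1, r2]; ring_nf
  have g2 : q ^ (-1 / 4 : ℝ) * q ^ (((x2 : ℝ) + 1) / 4) * q ^ (-(-((y1 : ℝ) + 1) / 4)) *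
      q ^ (((a - 1) * (a - 1 + w1 + w2 + 1) + x2 * y1 - (x1 - 1) * (y2 - 1) : ℝ) / 4) =
      q ^ ((a * (a + w1 + w2 + 1) + x2 * y1 - x1 * y2 : ℝ) / 4) := by
    simp only [← Real.rpow_add hq]; rw [r1, r2]; ring_nf
  linear_combination -q ^ (1 / 4 : ℝ) * q ^ (-((x1 : ℝ) + 1) / 4) * q ^ (-(((y2 : ℝ) + 1) / 4)) * c1 +
    q ^ (-1 / 4 : ℝ) * q ^ (((x2 : ℝ) + 1) / 4) * q ^ (-(-((y1 : ℝ) + 1) / 4)) * c2 -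
    C * cgSum q (a - 1) (x2 - 1) (y1 - 1) (w1 - y1 + 1) (w2 - x2 + 1) * g1 +
    C * cgSum q (a - 1) x2 y1 (w1 - y1) (w2 - x2) * g2 +
    C * q ^ ((a * (a + w1 + w2 + 1) + x2 * y1 - x1 * y2 : ℝ) / 4) * rel

theorem spinorPairing_raise_lower (hq : 0 < q) (hq1 : q ≠ 1) {x y w : ℕ × ℕ} {a : ℤ}
    (h1 : (x.1 : ℤ) + y.1 = a + w.1) (h2 : (x.2 : ℤ) + y.2 = a + w.2)
    (h : Triad (dspin x - 1) (dspin y + 1) (dspin w)) :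
    Real.sqrt (qnum q 2) * spinorPairing q 1 (-1) x y w =
      -(q ^ ((a * (a + w.1 + w.2 + 1) + x.2 * y.1 - x.1 * y.2 : ℝ) / 4) *
      (triCoeff q (dspin x - 1) (dspin y + 1) (dspin w) * Real.sqrt (qnum q (dspin w + 1)) *
      (sqrtFact q x * sqrtFact q y * sqrtFact q w)) *
      (qnum q (w.1 - y.1 + x.2) * cgSum q a x.2 y.1 (w.1 - y.1) (w.2 - x.2))) := by
  obtain ⟨x1, x2⟩ := x
  obtain ⟨y1, y2⟩ := y
  obtain ⟨w1, w2⟩ := w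
  simp only at h1 h2 ⊢
  have r1 : (x1 : ℝ) = a + w1 - y1 := by
    have : (x1 : ℤ) = a + w1 - y1 := by omega
    exact_mod_cast this
  have r2 : (y2 : ℝ) = a + w2 - x2 := by
    have : (y2 : ℤ) = a + w2 - x2 := by omega
    exact_mod_cast this
  set C := triCoeff q (dspin (x1, x2) - 1) (dspin (y1, y2) + 1) (dspin (w1, w2)) *
    Real.sqrt (qnum q (dspin (w1, w2) + 1)) *
      (sqrtFact q (x1, x2) * sqrtFact q (y1, y2) * sqrtFact q (w1, w2)) with hC
  have c1 : Real.sqrt (qnum q x2) * Real.sqrt (qnum q (y2 + 1)) *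
        cg q (x1, x2 - 1) (y1, y2 + 1) (w1, w2) =
      q ^ ((a * (a + w1 + w2 + 1) + (x2 - 1) * y1 - x1 * (y2 + 1) : ℝ) / 4) * C *
        (qnum q (y2 + 1) * cgSum q a (x2 - 1) y1 (w1 - y1) (w2 - x2 + 1)) := by
    rcases x2 with _ | m
    · rw [cgSum_eq_zero (by omega)]; simp
    have := mul_cg_eq hq hq1 (x := (x1, m + 1)) (y := (y1, y2)) (w := (w1, w2)) (a' := a)
      (x' := (x1, m)) (y' := (y1, y2 + 1)) (cx := 1)
      (sqrtFact_succ_snd hq hq1 _ _) (sqrt_qnum_mul_sqrtFact_snd hq hq1 y1 y2)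
      (by push_cast at h1 ⊢; omega) (by push_cast at h2 ⊢; omega)
      (show dspin (x1, m) = dspin (x1, m + 1) - 1 by simp [dspin]; ring)
      (show dspin (y1, y2 + 1) = dspin (y1, y2) + 1 by simp [dspin]; ring) h
    push_cast at this ⊢
    simp only [add_tsub_cancel_right]
    rw [this, show (w2 : ℤ) - (m + 1) + 1 = w2 - m by ring, one_mul]
  have c2 : Real.sqrt (qnum q x1) * Real.sqrt (qnum q (y1 + 1)) *
        cg q (x1 - 1, x2) (y1 + 1, y2) (w1, w2) =
      q ^ ((a * (a + w1 + w2 + 1) + x2 * (y1 + 1) - (x1 - 1) * y2 : ℝ) / 4) * C *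
        (qnum q (y1 + 1) * cgSum q a x2 (y1 + 1) (w1 - y1 - 1) (w2 - x2)) := by
    rcases x1 with _ | m
    · rw [cgSum_eq_zero (by omega)]; simp
    have := mul_cg_eq hq hq1 (x := (m + 1, x2)) (y := (y1, y2)) (w := (w1, w2)) (a' := a)
      (x' := (m, x2)) (y' := (y1 + 1, y2)) (cx := 1)
      (sqrtFact_succ_fst hq hq1 _ _) (sqrt_qnum_mul_sqrtFact_fst hq hq1 y1 y2)
      (by push_cast at h1 ⊢; omega) (by push_cast at h2 ⊢; omega)
      (show dspin (m, x2) = dspin (m + 1, x2) - 1 by simp [dspin]; ring)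
      (show dspin (y1 + 1, y2) = dspin (y1, y2) + 1 by simp [dspin]; ring) h
    push_cast at this ⊢
    simp only [add_tsub_cancel_right]
    rw [this, show (w1 : ℤ) - (y1 + 1) = w1 - y1 - 1 by ring, one_mul]
  have rel := cgSum_raise_lower hq hq1 a x2 y1 (w1 - y1) (w2 - x2)
  push_cast at rel
  rw [show (a : ℝ) + (w2 - x2) + 1 = y2 + 1 by rw [r2]; ring] at rel
  rw [spinorPairing, sum_intUnits, mul_add,
    ← mul_assoc _ (cgSinglet q (halfVec 1)), ← mul_assoc _ (cgSinglet q (halfVec (-1))),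
    sqrt_two_mul_cgSinglet_up hq hq1, sqrt_two_mul_cgSinglet_down hq hq1]
  simp only [spinorWt, spinorSrc, qnum_inv hq, inv_rpow_eq hq, neg_neg,
    show ((-1 : ℤˣ) = 1) = False by decide, if_true, if_false]
  have g1 : q ^ (1 / 4 : ℝ) * q ^ (-((x1 : ℝ) + 1) / 4) * q ^ (-(-(y1 : ℝ) / 4)) *
      q ^ ((a * (a + w1 + w2 + 1) + (x2 - 1) * y1 - x1 * (y2 + 1) : ℝ) / 4) =
      q ^ ((a * (a + w1 + w2 + 1) + x2 * y1 - x1 * y2 : ℝ) / 4) *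
        q ^ (-((a : ℝ) + (w1 - y1)) / 2) := by
    simp only [← Real.rpow_add hq]; rw [r1, r2]; ring_nf
  have g2 : q ^ (-1 / 4 : ℝ) * q ^ (((x2 : ℝ) + 1) / 4) * q ^ (-((y2 : ℝ) / 4)) *
      q ^ ((a * (a + w1 + w2 + 1) + x2 * (y1 + 1) - (x1 - 1) * y2 : ℝ) / 4) =
      q ^ ((a * (a + w1 + w2 + 1) + x2 * y1 - x1 * y2 : ℝ) / 4) * q ^ ((x2 : ℝ) / 2) := by
    simp only [← Real.rpow_add hq]; rw [r1, r2]; ring_nf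
  linear_combination -q ^ (1 / 4 : ℝ) * q ^ (-((x1 : ℝ) + 1) / 4) * q ^ (-(-(y1 : ℝ) / 4)) * c1 -
    q ^ (-1 / 4 : ℝ) * q ^ (((x2 : ℝ) + 1) / 4) * q ^ (-((y2 : ℝ) / 4)) * c2 -
    C * (qnum q (y2 + 1) * cgSum q a (x2 - 1) y1 (w1 - y1) (w2 - x2 + 1)) * g1 -
    C * (qnum q (y1 + 1) * cgSum q a x2 (y1 + 1) (w1 - y1 - 1) (w2 - x2)) * g2 -
    C * q ^ ((a * (a + w1 + w2 + 1) + x2 * y1 - x1 * y2 : ℝ) / 4) * rel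

theorem spinorPairing_lower_raise (hq : 0 < q) (hq1 : q ≠ 1) {x y w : ℕ × ℕ} {a : ℤ}
    (h1 : (x.1 : ℤ) + y.1 = a + w.1) (h2 : (x.2 : ℤ) + y.2 = a + w.2)
    (h : Triad (dspin x + 1) (dspin y - 1) (dspin w)) :
    Real.sqrt (qnum q 2) * spinorPairing q (-1) 1 x y w =
      q ^ ((a * (a + w.1 + w.2 + 1) + x.2 * y.1 - x.1 * y.2 : ℝ) / 4) *
      (triCoeff q (dspin x + 1) (dspin y - 1) (dspin w) * Real.sqrt (qnum q (dspin w + 1)) *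
      (sqrtFact q x * sqrtFact q y * sqrtFact q w)) *
      (qnum q (w.2 - x.2 + y.1) * cgSum q a x.2 y.1 (w.1 - y.1) (w.2 - x.2)) := by
  obtain ⟨x1, x2⟩ := x
  obtain ⟨y1, y2⟩ := y
  obtain ⟨w1, w2⟩ := w
  simp only at h1 h2 ⊢
  have r1 : (x1 : ℝ) = a + w1 - y1 := by
    have : (x1 : ℤ) = a + w1 - y1 := by omega
    exact_mod_cast this
  have r2 : (y2 : ℝ) = a + w2 - x2 := by
    have : (y2 : ℤ) = a + w2 - x2 := by omega
    exact_mod_cast this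
  set C := triCoeff q (dspin (x1, x2) + 1) (dspin (y1, y2) - 1) (dspin (w1, w2)) *
    Real.sqrt (qnum q (dspin (w1, w2) + 1)) *
      (sqrtFact q (x1, x2) * sqrtFact q (y1, y2) * sqrtFact q (w1, w2)) with hC
  have c1 : Real.sqrt (qnum q (x1 + 1)) * Real.sqrt (qnum q y1) *
        cg q (x1 + 1, x2) (y1 - 1, y2) (w1, w2) =
      q ^ ((a * (a + w1 + w2 + 1) + x2 * (y1 - 1) - (x1 + 1) * y2 : ℝ) / 4) * C *
        (qnum q (x1 + 1) * cgSum q a x2 (y1 - 1) (w1 - y1 + 1) (w2 - x2)) := by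
    rcases y1 with _ | m
    · rw [cgSum_eq_zero (by omega)]; simp
    have := mul_cg_eq hq hq1 (x := (x1, x2)) (y := (m + 1, y2)) (w := (w1, w2)) (a' := a)
      (x' := (x1 + 1, x2)) (y' := (m, y2)) (cy := 1)
      (sqrt_qnum_mul_sqrtFact_fst hq hq1 x1 x2) (sqrtFact_succ_fst hq hq1 _ _)
      (by push_cast at h1 ⊢; omega) (by push_cast at h2 ⊢; omega)
      (show dspin (x1 + 1, x2) = dspin (x1, x2) + 1 by simp [dspin]; ring)
      (show dspin (m, y2) = dspin (m + 1, y2) - 1 by simp [dspin]; ring) h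
    push_cast at this ⊢
    simp only [add_tsub_cancel_right]
    rw [this, show (w1 : ℤ) - (m + 1) + 1 = w1 - m by ring, mul_one]
  have c2 : Real.sqrt (qnum q (x2 + 1)) * Real.sqrt (qnum q y2) *
        cg q (x1, x2 + 1) (y1, y2 - 1) (w1, w2) =
      q ^ ((a * (a + w1 + w2 + 1) + (x2 + 1) * y1 - x1 * (y2 - 1) : ℝ) / 4) * C *
        (qnum q (x2 + 1) * cgSum q a (x2 + 1) y1 (w1 - y1) (w2 - x2 - 1)) := by
    rcases y2 with _ | m
    · rw [cgSum_eq_zero (by omega)]; simp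
    have := mul_cg_eq hq hq1 (x := (x1, x2)) (y := (y1, m + 1)) (w := (w1, w2)) (a' := a)
      (x' := (x1, x2 + 1)) (y' := (y1, m)) (cy := 1)
      (sqrt_qnum_mul_sqrtFact_snd hq hq1 x1 x2) (sqrtFact_succ_snd hq hq1 _ _)
      (by push_cast at h1 ⊢; omega) (by push_cast at h2 ⊢; omega)
      (show dspin (x1, x2 + 1) = dspin (x1, x2) + 1 by simp [dspin]; ring)
      (show dspin (y1, m) = dspin (y1, m + 1) - 1 by simp [dspin]; ring) h
    push_cast at this ⊢
    simp only [add_tsub_cancel_right]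
    rw [this, show (w2 : ℤ) - (x2 + 1) = w2 - x2 - 1 by ring, mul_one]
  -- Raising and lowering are interchanged by exchanging the roles of the two spins, under which the
  -- sum is symmetric.
  have rel := cgSum_raise_lower hq hq1 a y1 x2 (w2 - x2) (w1 - y1)
  rw [cgSum_symm a, cgSum_symm a _ (x2 + 1), cgSum_symm a y1] at rel
  push_cast at rel
  rw [show (a : ℝ) + (w1 - y1) + 1 = x1 + 1 by rw [r1]; ring] at rel
  rw [spinorPairing, sum_intUnits, mul_add,
    ← mul_assoc _ (cgSinglet q (halfVec 1)), ← mul_assoc _ (cgSinglet q (halfVec (-1))),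
    sqrt_two_mul_cgSinglet_up hq hq1, sqrt_two_mul_cgSinglet_down hq hq1]
  simp only [spinorWt, spinorSrc, qnum_inv hq, inv_rpow_eq hq, neg_neg,
    show ((-1 : ℤˣ) = 1) = False by decide, if_true, if_false]
  have g1 : q ^ (1 / 4 : ℝ) * q ^ ((x2 : ℝ) / 4) * q ^ (-(((y2 : ℝ) + 1) / 4)) *
      q ^ ((a * (a + w1 + w2 + 1) + x2 * (y1 - 1) - (x1 + 1) * y2 : ℝ) / 4) =
      q ^ ((a * (a + w1 + w2 + 1) + x2 * y1 - x1 * y2 : ℝ) / 4) *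
        q ^ (-((a : ℝ) + (w2 - x2)) / 2) := by
    simp only [← Real.rpow_add hq]; rw [r1, r2]; ring_nf
  have g2 : q ^ (-1 / 4 : ℝ) * q ^ (-(x1 : ℝ) / 4) * q ^ (-(-((y1 : ℝ) + 1) / 4)) *
      q ^ ((a * (a + w1 + w2 + 1) + (x2 + 1) * y1 - x1 * (y2 - 1) : ℝ) / 4) =
      q ^ ((a * (a + w1 + w2 + 1) + x2 * y1 - x1 * y2 : ℝ) / 4) * q ^ ((y1 : ℝ) / 2) := by
    simp only [← Real.rpow_add hq]; rw [r1, r2]; ring_nf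
  linear_combination q ^ (1 / 4 : ℝ) * q ^ ((x2 : ℝ) / 4) * q ^ (-(((y2 : ℝ) + 1) / 4)) * c1 +
    q ^ (-1 / 4 : ℝ) * q ^ (-(x1 : ℝ) / 4) * q ^ (-(-((y1 : ℝ) + 1) / 4)) * c2 +
    C * (qnum q (x1 + 1) * cgSum q a x2 (y1 - 1) (w1 - y1 + 1) (w2 - x2)) * g1 +
    C * (qnum q (x2 + 1) * cgSum q a (x2 + 1) y1 (w1 - y1) (w2 - x2 - 1)) * g2 +
    C * q ^ ((a * (a + w1 + w2 + 1) + x2 * y1 - x1 * y2 : ℝ) / 4) * rel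

end ScalarAction

/-! ### Identification of the multiple with a 6j-symbol. -/

section ScalarCoefficient

variable {q : ℝ}

/-- The coefficient of the scalar operators on intertwiners, in terms of the (doubled) spins
`k`, `k'`, `l` of the resulting intertwiner. -/
def scalarCoef (q : ℝ) (ε ε' : ℤˣ) (k k' l : ℤ) : ℝ :=
  sgn ((k + k' + l) / 2) * sixj q k (k - (ε : ℤ)) 1 (k' - (ε' : ℤ)) k' l *
    (Real.sqrt (qnum q (k + 1) * qnum q (k - (ε : ℤ) + 1)) *
      Real.sqrt (qnum q (k' + 1) * qnum q (k' - (ε' : ℤ) + 1)))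

theorem sqrt_qnum_mul_pos (hq : 0 < q) (hq1 : q ≠ 1) (n : ℕ) :
    0 < Real.sqrt (qnum q (n + 1) * qnum q (n + 2)) :=
  Real.sqrt_pos.mpr (mul_pos (qnum_pos hq hq1 (by positivity)) (qnum_pos hq hq1 (by positivity)))

theorem neg_one_pow_mul_self (n : ℕ) : (-1 : ℝ) ^ n * (-1) ^ n = 1 := by
  rw [← mul_pow]; simp

/-- The dimension factors in `scalarCoef` cancel the denominators of the 6j-symbol, and the parity
sign cancels its `(-1)^(a+b+c)`. The three other sign choices work in the same way. -/
theorem scalarCoef_lower_lower (hq : 0 < q) (hq1 : q ≠ 1) (a b c : ℕ) :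
    scalarCoef q (-1) (-1) (a + c) (a + b) (b + c) =
      -Real.sqrt (qnum q (a + 1) * qnum q (a + b + c + 2)) := by
  have h1 := (sqrt_qnum_mul_pos hq hq1 (a + c)).ne'
  have h2 := (sqrt_qnum_mul_pos hq hq1 (a + b)).ne'
  have h3 := neg_one_pow_mul_self (a + b + c)
  rw [scalarCoef, show ((a : ℤ) + c + (a + b) + (b + c)) / 2 = (a + b + c : ℕ) by omega,
    sgn_natCast]
  push_cast at h1 h2 ⊢
  simp only [sub_neg_eq_add]
  rw [sixj_lower_lower hq hq1, show (a : ℝ) + c + 1 + 1 = a + c + 2 by ring,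
    show (a : ℝ) + b + 1 + 1 = a + b + 2 by ring]
  field_simp
  linear_combination -Real.sqrt (qnum q (a + 1) * qnum q (a + b + c + 2)) * h3

theorem scalarCoef_raise_raise (hq : 0 < q) (hq1 : q ≠ 1) (a b c : ℕ) :
    scalarCoef q 1 1 (a + c + 1) (a + b + 1) (b + c) =
      Real.sqrt (qnum q (a + 1) * qnum q (a + b + c + 2)) := by
  have h1 := (sqrt_qnum_mul_pos hq hq1 (a + c)).ne'
  have h2 := (sqrt_qnum_mul_pos hq hq1 (a + b)).ne'
  have h3 := neg_one_pow_mul_self (a + b + c)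
  rw [scalarCoef, show ((a : ℤ) + c + 1 + (a + b + 1) + (b + c)) / 2 = (a + b + c + 1 : ℕ) by omega,
    sgn_natCast, pow_succ]
  push_cast at h1 h2 ⊢
  simp only [add_sub_cancel_right]
  rw [sixj_swap, sixj_lower_lower hq hq1, show (a : ℝ) + c + 1 + 1 = a + c + 2 by ring,
    show (a : ℝ) + b + 1 + 1 = a + b + 2 by ring, mul_comm (qnum q (a + c + 2)),
    mul_comm (qnum q (a + b + 2))]
  field_simp
  linear_combination Real.sqrt (qnum q (a + 1) * qnum q (a + b + c + 2)) * h3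

theorem scalarCoef_lower_raise (hq : 0 < q) (hq1 : q ≠ 1) (a b c : ℕ) :
    scalarCoef q (-1) 1 (a + c) (a + b + 1) (b + c + 1) =
      Real.sqrt (qnum q (b + 1) * qnum q (c + 1)) := by
  have h1 := (sqrt_qnum_mul_pos hq hq1 (a + c)).ne'
  have h2 := (sqrt_qnum_mul_pos hq hq1 (a + b)).ne'
  have h3 := neg_one_pow_mul_self (a + b + c)
  rw [scalarCoef, show ((a : ℤ) + c + (a + b + 1) + (b + c + 1)) / 2 = (a + b + c + 1 : ℕ) by omega,
    sgn_natCast, pow_succ]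
  push_cast at h1 h2 ⊢
  simp only [add_sub_cancel_right, sub_neg_eq_add]
  rw [sixj_raise_lower hq hq1, show (a : ℝ) + c + 1 + 1 = a + c + 2 by ring,
    show (a : ℝ) + b + 1 + 1 = a + b + 2 by ring, mul_comm (qnum q (a + b + 2))]
  field_simp
  linear_combination Real.sqrt (qnum q (b + 1) * qnum q (c + 1)) * h3

theorem scalarCoef_raise_lower (hq : 0 < q) (hq1 : q ≠ 1) (a b c : ℕ) :
    scalarCoef q 1 (-1) (a + c + 1) (a + b) (b + c + 1) =
      Real.sqrt (qnum q (b + 1) * qnum q (c + 1)) := by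
  have h1 := (sqrt_qnum_mul_pos hq hq1 (a + c)).ne'
  have h2 := (sqrt_qnum_mul_pos hq hq1 (a + b)).ne'
  have h3 := neg_one_pow_mul_self (a + b + c)
  rw [scalarCoef, show ((a : ℤ) + c + 1 + (a + b) + (b + c + 1)) / 2 = (a + b + c + 1 : ℕ) by omega,
    sgn_natCast, pow_succ]
  push_cast at h1 h2 ⊢
  simp only [add_sub_cancel_right, sub_neg_eq_add]
  rw [sixj_swap, sixj_raise_lower hq hq1, show (a : ℝ) + c + 1 + 1 = a + c + 2 by ring,
    show (a : ℝ) + b + 1 + 1 = a + b + 2 by ring, mul_comm (qnum q (a + c + 2))]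
  field_simp
  linear_combination Real.sqrt (qnum q (b + 1) * qnum q (c + 1)) * h3

/-- With `triCoeff_exchange`, this relates the triangle coefficients at the spins before and after a
scalar operator: here a line is added between the first two spins, there a line is moved from one of
them to the other. -/
theorem triCoeff_succ_succ (hq : 0 < q) (hq1 : q ≠ 1) (a b c : ℕ) :
    triCoeff q (a + b + 1) (a + c + 1) (b + c) * Real.sqrt (qnum q (a + b + c + 2)) =
      Real.sqrt (qnum q (a + 1)) * triCoeff q (a + b) (a + c) (b + c) := by
  have hf := qfact_pos hq hq1
  have h1 := triCoeff_lines q (a + 1) b c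
  have h2 : 0 < qnum q (a + b + c + 2) := qnum_pos hq hq1 (by positivity)
  push_cast at h1
  rw [add_right_comm (a : ℤ) 1, add_right_comm (a : ℤ) 1] at h1
  rw [h1, triCoeff_lines, ← Real.sqrt_mul' _ h2.le,
    ← Real.sqrt_mul (qnum_nonneg hq hq1 (by positivity))]
  congr 1
  rw [show a + 1 + b + c + 1 = a + b + c + 1 + 1 by ring, qfact_succ q (a + b + c + 1),
    qfact_succ q a]
  have h3 := (hf (a + b + c + 1)).ne'
  push_cast
  rw [show (a : ℝ) + b + c + 1 + 1 = a + b + c + 2 by ring]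
  field_simp

theorem triCoeff_exchange (hq : 0 < q) (hq1 : q ≠ 1) (a b c : ℕ) :
    triCoeff q (a + b) (a + c + 1) (b + c + 1) * Real.sqrt (qnum q (b + 1)) =
      Real.sqrt (qnum q (c + 1)) * triCoeff q (a + b + 1) (a + c) (b + c + 1) := by
  have hf := qfact_pos hq hq1
  have h1 := triCoeff_lines q a (b + 1) c
  have h2 := triCoeff_lines q a b (c + 1)
  have h3 : 0 < qnum q (b + 1) := qnum_pos hq hq1 (by positivity)
  push_cast at h1 h2
  rw [← add_assoc, add_right_comm (b : ℤ) 1 (c : ℤ)] at h1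
  rw [← add_assoc, ← add_assoc] at h2
  rw [h1, h2, ← Real.sqrt_mul' _ h3.le, ← Real.sqrt_mul (qnum_nonneg hq hq1 (by positivity))]
  congr 1
  rw [show a + (b + 1) + c + 1 = a + b + c + 2 by ring,
    show a + b + (c + 1) + 1 = a + b + c + 2 by ring, qfact_succ q b, qfact_succ q c]
  ring

/-- The first alternative covers the empty occupation numbers, where truncated subtraction would
spoil the conservation laws. -/
theorem spinorWt_eq_zero_or (q : ℝ) (ε A : ℤˣ) (m : ℕ × ℕ) :
    spinorWt q ε A m = 0 ∨ (dspin (spinorSrc ε A m) = dspin m - (ε : ℤ) ∧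
      dmag (spinorSrc ε A m) = dmag m + (A : ℤ)) := by
  obtain ⟨m1, m2⟩ := m
  rcases Int.units_eq_one_or ε with rfl | rfl <;> rcases Int.units_eq_one_or A with rfl | rfl
  · rcases m2 with _ | n
    · left; simp [spinorWt]
    · right; simp [spinorSrc, dspin, dmag]; constructor <;> ring
  · rcases m1 with _ | n
    · left; simp [spinorWt]
    · right; simp [spinorSrc, dspin, dmag]; constructor <;> ring
  · right; simp [spinorSrc, dspin, dmag]; constructor <;> ring
  · right; simp [spinorSrc, dspin, dmag]; constructor <;> ring

theorem spinorPairing_eq_zero {ε ε' : ℤˣ} {x y w : ℕ × ℕ}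
    (h : ¬(Triad (dspin x - (ε : ℤ)) (dspin y - (ε' : ℤ)) (dspin w) ∧
      dmag x + dmag y = dmag w)) : spinorPairing q ε ε' x y w = 0 := by
  apply Finset.sum_eq_zero
  intro A _
  rcases spinorWt_eq_zero_or q ε A x with h1 | ⟨h1, h2⟩
  · simp [h1]
  rcases spinorWt_eq_zero_or q⁻¹ ε' (-A) y with h3 | ⟨h3, h4⟩
  · simp [h3]
  rw [cg_eq_zero]
  · ring
  · rw [h1, h2, h3, h4]
    push_cast
    rwa [show dmag x + (A : ℤ) + (dmag y + -(A : ℤ)) = dmag x + dmag y by ring]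

theorem scalarCoef_eq_zero {ε ε' : ℤˣ} {k k' l : ℤ}
    (h : ¬(Triad k k' l ∧ Triad (k' - (ε' : ℤ)) (k - (ε : ℤ)) l)) :
    scalarCoef q ε ε' k k' l = 0 := by
  rw [scalarCoef, sixj, if_neg (by tauto)]
  ring

/-- The explicit Wigner-Eckart statement: a singlet contraction of spinors multiplies Clebsch-Gordan
coefficients by a number independent of the magnetic indices. The q-number from the contiguous
relation and the ratio of triangle coefficients multiply to the closed form of `scalarCoef`. It also
covers the degenerate triads, where both sides vanish. -/
theorem mul_spinorPairing (hq : 0 < q) (hq1 : q ≠ 1) (ε ε' : ℤˣ) (x y w : ℕ × ℕ) :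
    ((ε' : ℤ) : ℝ) * Real.sqrt (qnum q 2) * spinorPairing q ε ε' x y w =
      scalarCoef q ε' ε (dspin y) (dspin x) (dspin w) * cg q x y w := by
  by_cases hs : Triad (dspin x - (ε : ℤ)) (dspin y - (ε' : ℤ)) (dspin w) ∧
      dmag x + dmag y = dmag w
  swap
  · rw [spinorPairing_eq_zero hs, mul_zero]
    by_cases hm : dmag x + dmag y = dmag w
    · rw [scalarCoef_eq_zero (by tauto), zero_mul]
    · rw [cg_eq_zero (by tauto), mul_zero]
  obtain ⟨hs, hm⟩ := hs
  obtain ⟨a0, b0, c0, e1, e2, e3⟩ := hs.exists_lines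
  -- When the resulting spins do not form a triad, the Clebsch-Gordan sum is already zero, so no
  -- relation between triangle coefficients is needed.
  have hzero : ∀ a : ℤ, (x.1 : ℤ) + y.1 = a + w.1 → (x.2 : ℤ) + y.2 = a + w.2 →
      ¬ Triad (dspin x) (dspin y) (dspin w) →
      cgSum q a x.2 y.1 (w.1 - y.1) (w.2 - x.2) = 0 := by
    intro a h1 h2 ht
    apply cgSum_eq_zero
    by_contra hcon
    push Not at hcon
    apply ht
    unfold dspin at *
    exact ⟨by omega, by omega, by omega, ⟨a + w.1 + w.2, by omega⟩, by omega, by omega, by omega⟩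
  obtain ⟨a, h1, h2⟩ : ∃ a : ℤ, (x.1 : ℤ) + y.1 = a + w.1 ∧ (x.2 : ℤ) + y.2 = a + w.2 :=
    ⟨x.1 + y.1 - w.1, by ring, by unfold dmag at hm; omega⟩
  have hw : dspin w = w.1 + w.2 := rfl
  have hx : dspin x = x.1 + x.2 := rfl
  have hy : dspin y = y.1 + y.2 := rfl
  by_cases ht : Triad (dspin x) (dspin y) (dspin w)
  swap
  · rw [cg_eq_zero (by tauto), mul_zero]
    rcases Int.units_eq_one_or ε with rfl | rfl <;> rcases Int.units_eq_one_or ε' with rfl | rfl <;>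
      push_cast at hs <;> try simp only [sub_neg_eq_add] at hs
    · rw [mul_assoc, spinorPairing_raise_raise hq hq1 h1 h2 hs, hzero a h1 h2 ht]; ring
    · rw [mul_assoc, spinorPairing_raise_lower hq hq1 h1 h2 hs, hzero a h1 h2 ht]; ring
    · rw [mul_assoc, spinorPairing_lower_raise hq hq1 h1 h2 hs, hzero a h1 h2 ht]; ring
    · rw [mul_assoc, spinorPairing_lower_lower hq hq1 h1 h2 hs, hzero a h1 h2 ht]; ring
  obtain ⟨-, -, -, -, t1, t2, t3⟩ := id ht
  have hcg := cg_eq_of_balance hq hq1 h1 h2 ht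
  rw [hcg]
  rcases Int.units_eq_one_or ε with rfl | rfl <;> rcases Int.units_eq_one_or ε' with rfl | rfl <;>
    push_cast at hs e1 e2 ⊢ <;> try simp only [sub_neg_eq_add] at hs e1 e2
  · rw [one_mul, spinorPairing_raise_raise hq hq1 h1 h2 hs]
    have ha : (a : ℝ) = a0 + 1 := by
      have : a = a0 + 1 := by omega
      rw [this]; push_cast; ring
    rw [e1, e2, e3, show dspin x = a0 + b0 + 1 by omega, show dspin y = a0 + c0 + 1 by omega,
      scalarCoef_raise_raise hq hq1, ha]
    have hA : 0 ≤ qnum q (a0 + 1) := qnum_nonneg hq hq1 (by positivity)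
    have hs1 := Real.mul_self_sqrt hA
    have hstep := triCoeff_succ_succ hq hq1 a0 b0 c0
    rw [Real.sqrt_mul hA]
    have key : triCoeff q (a0 + b0) (a0 + c0) (b0 + c0) * qnum q (a0 + 1) =
        Real.sqrt (qnum q (a0 + 1)) * Real.sqrt (qnum q (a0 + b0 + c0 + 2)) *
          triCoeff q (a0 + b0 + 1) (a0 + c0 + 1) (b0 + c0) := by
      linear_combination -triCoeff q (a0 + b0) (a0 + c0) (b0 + c0) * hs1 -
        Real.sqrt (qnum q (a0 + 1)) * hstep
    linear_combination q ^ (((a0 + 1) * (a0 + 1 + w.1 + w.2 + 1) + x.2 * y.1 - x.1 * y.2 : ℝ) / 4) *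
      Real.sqrt (qnum q ((b0 + c0 : ℤ) + 1)) * (sqrtFact q x * sqrtFact q y * sqrtFact q w) *
      cgSum q a x.2 y.1 (w.1 - y.1) (w.2 - x.2) * key
  · rw [mul_assoc, spinorPairing_raise_lower hq hq1 h1 h2 hs]
    -- A line is available to be moved because the resulting spins satisfy the triangle inequalities
    -- too.
    obtain ⟨c, rfl⟩ : ∃ c : ℕ, c0 = c + 1 := ⟨c0 - 1, by omega⟩
    push_cast at e1 e2 e3
    have hb : (w.1 : ℝ) - y.1 + x.2 = b0 + 1 := by
      have : (w.1 : ℤ) - y.1 + x.2 = b0 + 1 := by omega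
      exact_mod_cast this
    rw [e1, show dspin y + 1 = a0 + c + 1 by omega, show dspin w = b0 + c + 1 by omega,
      show dspin x = a0 + b0 + 1 by omega, show dspin y = a0 + c by omega,
      scalarCoef_lower_raise hq hq1, hb]
    have hA : 0 ≤ qnum q (b0 + 1) := qnum_nonneg hq hq1 (by positivity)
    have hs1 := Real.mul_self_sqrt hA
    have hstep := triCoeff_exchange hq hq1 a0 b0 c
    rw [Real.sqrt_mul hA]
    have key : triCoeff q (a0 + b0) (a0 + c + 1) (b0 + c + 1) * qnum q (b0 + 1) =
        Real.sqrt (qnum q (b0 + 1)) * Real.sqrt (qnum q (c + 1)) *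
          triCoeff q (a0 + b0 + 1) (a0 + c) (b0 + c + 1) := by
      linear_combination -triCoeff q (a0 + b0) (a0 + c + 1) (b0 + c + 1) * hs1 +
        Real.sqrt (qnum q (b0 + 1)) * hstep
    linear_combination q ^ ((a * (a + w.1 + w.2 + 1) + x.2 * y.1 - x.1 * y.2 : ℝ) / 4) *
      Real.sqrt (qnum q ((b0 + c + 1 : ℤ) + 1)) * (sqrtFact q x * sqrtFact q y * sqrtFact q w) *
      cgSum q a x.2 y.1 (w.1 - y.1) (w.2 - x.2) * key
  · rw [one_mul, spinorPairing_lower_raise hq hq1 h1 h2 hs]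
    obtain ⟨b, rfl⟩ : ∃ b : ℕ, b0 = b + 1 := ⟨b0 - 1, by omega⟩
    push_cast at e1 e2 e3
    have hb : (w.2 : ℝ) - x.2 + y.1 = c0 + 1 := by
      have : (w.2 : ℤ) - x.2 + y.1 = c0 + 1 := by omega
      exact_mod_cast this
    rw [e2, show dspin x + 1 = a0 + b + 1 by omega, show dspin w = b + c0 + 1 by omega,
      show dspin x = a0 + b by omega, show dspin y = a0 + c0 + 1 by omega,
      scalarCoef_raise_lower hq hq1, hb]
    have hA : 0 ≤ qnum q (b + 1) := qnum_nonneg hq hq1 (by positivity)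
    have hB : 0 ≤ qnum q (c0 + 1) := qnum_nonneg hq hq1 (by positivity)
    have hs1 := Real.mul_self_sqrt hB
    have hstep := triCoeff_exchange hq hq1 a0 b c0
    rw [Real.sqrt_mul hA]
    have key : triCoeff q (a0 + b + 1) (a0 + c0) (b + c0 + 1) * qnum q (c0 + 1) =
        Real.sqrt (qnum q (b + 1)) * Real.sqrt (qnum q (c0 + 1)) *
          triCoeff q (a0 + b) (a0 + c0 + 1) (b + c0 + 1) := by
      linear_combination -triCoeff q (a0 + b + 1) (a0 + c0) (b + c0 + 1) * hs1 -
        Real.sqrt (qnum q (c0 + 1)) * hstep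
    linear_combination q ^ ((a * (a + w.1 + w.2 + 1) + x.2 * y.1 - x.1 * y.2 : ℝ) / 4) *
      Real.sqrt (qnum q ((b + c0 + 1 : ℤ) + 1)) * (sqrtFact q x * sqrtFact q y * sqrtFact q w) *
      cgSum q a x.2 y.1 (w.1 - y.1) (w.2 - x.2) * key
  · rw [mul_assoc, spinorPairing_lower_lower hq hq1 h1 h2 hs]
    obtain ⟨a1, rfl⟩ : ∃ c : ℕ, a0 = c + 1 := ⟨a0 - 1, by omega⟩
    push_cast at e1 e2 e3
    have hb : (a : ℝ) + w.1 + w.2 + 2 = a1 + b0 + c0 + 2 := by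
      have : (a : ℤ) + w.1 + w.2 + 2 = a1 + b0 + c0 + 2 := by omega
      exact_mod_cast this
    rw [show dspin x + 1 = a1 + b0 + 1 by omega, show dspin y + 1 = a1 + c0 + 1 by omega, e3,
      show dspin x = a1 + b0 by omega, show dspin y = a1 + c0 by omega,
      scalarCoef_lower_lower hq hq1, hb]
    have hA : 0 ≤ qnum q (a1 + 1) := qnum_nonneg hq hq1 (by positivity)
    have hB : 0 ≤ qnum q (a1 + b0 + c0 + 2) := qnum_nonneg hq hq1 (by positivity)
    have hs1 := Real.mul_self_sqrt hB
    have hstep := triCoeff_succ_succ hq hq1 a1 b0 c0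
    rw [Real.sqrt_mul hA]
    have key : triCoeff q (a1 + b0 + 1) (a1 + c0 + 1) (b0 + c0) * qnum q (a1 + b0 + c0 + 2) =
        Real.sqrt (qnum q (a1 + 1)) * Real.sqrt (qnum q (a1 + b0 + c0 + 2)) *
          triCoeff q (a1 + b0) (a1 + c0) (b0 + c0) := by
      linear_combination -triCoeff q (a1 + b0 + 1) (a1 + c0 + 1) (b0 + c0) * hs1 +
        Real.sqrt (qnum q (a1 + b0 + c0 + 2)) * hstep
    linear_combination -q ^ ((a * (a + w.1 + w.2 + 1) + x.2 * y.1 - x.1 * y.2 : ℝ) / 4) *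
      Real.sqrt (qnum q ((b0 + c0 : ℤ) + 1)) * (sqrtFact q x * sqrtFact q y * sqrtFact q w) *
      cgSum q a x.2 y.1 (w.1 - y.1) (w.2 - x.2) * key

end ScalarCoefficient

/-! ### Spinors on a single half-edge, direct or transposed. -/

section LegOperators

variable {q : ℝ} {E : Type*}

/-- The occupation numbers that a spinor component sends to `m`, on a target end (`t = true`) or,
by transposition, on a source end. -/
def legSrc (t : Bool) (ε A : ℤˣ) (m : ℕ × ℕ) : ℕ × ℕ :=
  if t then spinorSrc ε A m else spinorSrc (-ε) (-A) m

/-- The matrix element of a spinor component from `legSrc t ε A m` to `m`. -/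
def legWt (q : ℝ) (t : Bool) (ε A : ℤˣ) (m : ℕ × ℕ) : ℝ :=
  if t then spinorWt q ε A m
  else -((ε * A : ℤˣ) : ℤ) * q ^ (-((A : ℤ) : ℝ) / 4) * spinorWt q (-ε) (-A) m

/-- Needed because `actAt` is a `finsum`, which would be zero on an infinite support. -/
theorem spinorSrc_preimage_finite (ε A : ℤˣ) (n : ℕ × ℕ) : {s | spinorSrc ε A s = n}.Finite := by
  apply Set.Finite.subset (Set.finite_Iic (n.1 + 1, n.2 + 1))
  rintro ⟨s1, s2⟩ h
  subst h
  rw [Set.mem_Iic, Prod.mk_le_mk]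
  unfold spinorSrc
  split_ifs <;> constructor <;> dsimp only <;> omega

theorem legSrc_preimage_finite (t : Bool) (ε A : ℤˣ) (n : ℕ × ℕ) :
    {s | legSrc t ε A s = n}.Finite := by
  cases t
  · exact spinorSrc_preimage_finite (-ε) (-A) n
  · exact spinorSrc_preimage_finite ε A n

-- Every row of the matrix of the operator has at most one non-zero entry, so each component of the
-- image is one weight times one component of the argument. Spinors, their transposes and diagonal
-- operators are all of this kind.
open Classical in
theorem actAt_apply_of_shift (x : E × Bool) (T : Module.End ℂ Fock) (src : ℕ × ℕ → ℕ × ℕ)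
    (wt : ℕ × ℕ → ℂ) (hfin : ∀ n, {s | src s = n}.Finite)
    (h : ∀ n s : ℕ × ℕ, (if x.2 then T (Finsupp.single n 1) s else T (Finsupp.single s 1) n) =
      if src s = n then wt s else 0) (φ : BigFock E) (m : E × Bool → ℕ × ℕ) :
    actAt x T φ m = wt (m x) * φ (Function.update m x (src (m x))) := by
  induction φ using Finsupp.induction_linear with
  | zero => simp
  | add f g hf hg => rw [map_add, Finsupp.add_apply, hf, hg, Finsupp.add_apply, mul_add]
  | single n c =>
    rw [actAt, Finsupp.linearCombination_single, Finsupp.smul_apply, smul_eq_mul]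
    rw [finsum_eq_sum_of_support_subset (s := (hfin (n x)).toFinset)]
    · rw [Finsupp.finsetSum_apply]
      simp only [h, Finsupp.single_apply]
      have hiff : (n = Function.update m x (src (m x))) ↔
          (Function.update n x (m x) = m ∧ src (m x) = n x) := by
        constructor
        · intro hn
          rw [hn]
          simp
        · rintro ⟨h1, h2⟩
          rw [h2, ← h1]
          simp
      rw [Finset.sum_eq_single (m x)]
      · by_cases hn : n = Function.update m x (src (m x))
        · obtain ⟨h1, h2⟩ := hiff.mp hn
          rw [if_pos h1, if_pos h2, if_pos hn, mul_comm]
        · rw [if_neg hn, mul_zero]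
          by_cases h1 : Function.update n x (m x) = m
          · rw [if_pos h1, if_neg (fun h2 => hn (hiff.mpr ⟨h1, h2⟩)), mul_zero]
          · rw [if_neg h1, mul_zero]
      · intro s _ hs
        rw [if_neg]
        intro he
        apply hs
        rw [← he, Function.update_self]
      · intro hm
        rw [Set.Finite.mem_toFinset, Set.mem_ofPred_eq] at hm
        rw [if_neg hm, ite_self]
    · intro s hs
      rw [Set.Finite.coe_toFinset, Set.mem_ofPred_eq]
      by_contra hc
      apply hs
      simp only [h, if_neg hc, Finsupp.single_zero]

theorem diagOp_single (g : ℕ × ℕ → ℝ) (n : ℕ × ℕ) (c : ℂ) :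
    diagOp g (Finsupp.single n c) = Finsupp.single n (c * g n) := by
  rw [diagOp, Finsupp.linearCombination_single, Finsupp.smul_single, smul_eq_mul]

theorem annA_single (q : ℝ) (n : ℕ × ℕ) (c : ℂ) : annA q (Finsupp.single n c) =
    Finsupp.single (n.1 - 1, n.2) (c * (Real.sqrt (qnum q n.1) : ℝ)) := by
  rw [annA, Finsupp.linearCombination_single, Finsupp.smul_single, smul_eq_mul]

theorem creA_single (q : ℝ) (n : ℕ × ℕ) (c : ℂ) : creA q (Finsupp.single n c) =
    Finsupp.single (n.1 + 1, n.2) (c * (Real.sqrt (qnum q (n.1 + 1)) : ℝ)) := by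
  rw [creA, Finsupp.linearCombination_single, Finsupp.smul_single, smul_eq_mul]

theorem annB_single (q : ℝ) (n : ℕ × ℕ) (c : ℂ) : annB q (Finsupp.single n c) =
    Finsupp.single (n.1, n.2 - 1) (c * (Real.sqrt (qnum q n.2) : ℝ)) := by
  rw [annB, Finsupp.linearCombination_single, Finsupp.smul_single, smul_eq_mul]

theorem creB_single (q : ℝ) (n : ℕ × ℕ) (c : ℂ) : creB q (Finsupp.single n c) =
    Finsupp.single (n.1, n.2 + 1) (c * (Real.sqrt (qnum q (n.2 + 1)) : ℝ)) := by
  rw [creB, Finsupp.linearCombination_single, Finsupp.smul_single, smul_eq_mul]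

theorem spinor_single_apply (q : ℝ) (ε A : ℤˣ) (n s : ℕ × ℕ) :
    spinor q ε A (Finsupp.single n 1) s =
      if spinorSrc ε A s = n then ((spinorWt q ε A s : ℝ) : ℂ) else 0 := by
  obtain ⟨n1, n2⟩ := n
  obtain ⟨s1, s2⟩ := s
  rcases Int.units_eq_one_or ε with rfl | rfl <;> rcases Int.units_eq_one_or A with rfl | rfl <;>
    simp only [spinor, spinorSrc, spinorWt, show ((-1 : ℤˣ) = 1) = False by decide, if_true,
      if_false, LinearMap.neg_apply, Module.End.mul_apply, diagOp_single, annA_single, annB_single,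
      creA_single, creB_single, Finsupp.neg_apply, Finsupp.single_apply, Prod.mk.injEq]
  · rcases s2 with _ | s2
    · simp
    · simp only [Nat.add_sub_cancel, add_left_inj]
      by_cases h : s1 = n1 ∧ s2 = n2
      · obtain ⟨rfl, rfl⟩ := h
        simp; ring
      · rw [if_neg h, if_neg (by tauto), neg_zero]
  · rcases s1 with _ | s1
    · simp
    · simp only [Nat.add_sub_cancel, add_left_inj]
      by_cases h : s1 = n1 ∧ s2 = n2
      · obtain ⟨rfl, rfl⟩ := h
        simp; ring
      · rw [if_neg h, if_neg (by tauto)]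
  · rcases n1 with _ | n1
    · simp
    · simp only [Nat.add_sub_cancel, add_left_inj]
      by_cases h : s1 = n1 ∧ s2 = n2
      · obtain ⟨rfl, rfl⟩ := h
        simp; ring
      · rw [if_neg h, if_neg (by tauto)]
  · rcases n2 with _ | n2
    · simp
    · simp only [Nat.add_sub_cancel, add_left_inj]
      by_cases h : s1 = n1 ∧ s2 = n2
      · obtain ⟨rfl, rfl⟩ := h
        simp; ring
      · rw [if_neg h, if_neg (by tauto)]

/-- Transposition exchanges creation and annihilation operators, so the transpose of `t^ε_A` is `-εA
q^{-A/4} t^{-ε}_{-A}` (with `A = ±1`); the power of `q` comes from the `+1` in the exponents of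
`t^+`. -/
theorem spinor_single_apply_transpose (hq : 0 < q) (ε A : ℤˣ) (n s : ℕ × ℕ) :
    spinor q ε A (Finsupp.single s 1) n =
      if legSrc false ε A s = n then ((legWt q false ε A s : ℝ) : ℂ) else 0 := by
  obtain ⟨n1, n2⟩ := n
  obtain ⟨s1, s2⟩ := s
  have e1 : q ^ (-((s1 : ℝ) + 1) / 4) = q ^ (-1 / 4 : ℝ) * q ^ (-(s1 : ℝ) / 4) := by
    rw [← Real.rpow_add hq]; ring_nf
  have e2 : q ^ (((s2 : ℝ) + 1) / 4) = q ^ (1 / 4 : ℝ) * q ^ ((s2 : ℝ) / 4) := by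
    rw [← Real.rpow_add hq]; ring_nf
  have e3 : q ^ (1 / 4 : ℝ) * q ^ (-1 / 4 : ℝ) = 1 := by
    rw [← Real.rpow_add hq, ← Real.rpow_zero q]; ring_nf
  have e4 : ((q ^ (1 / 4 : ℝ) : ℝ) : ℂ) * ((q ^ (-1 / 4 : ℝ) : ℝ) : ℂ) = 1 := by
    exact_mod_cast e3
  rcases Int.units_eq_one_or ε with rfl | rfl <;> rcases Int.units_eq_one_or A with rfl | rfl <;>
    simp only [spinor, legSrc, legWt, spinorSrc, spinorWt, neg_neg,
      show ((-1 : ℤˣ) = 1) = False by decide, if_true, Bool.false_eq_true,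
      if_false, LinearMap.neg_apply, Module.End.mul_apply, diagOp_single, annA_single, annB_single,
      creA_single, creB_single, Finsupp.neg_apply, Finsupp.single_apply, Prod.mk.injEq]
  · split_ifs
    · rw [e1]; push_cast; ring
    · simp
  · split_ifs
    · rw [e2]; push_cast; ring_nf
    · simp
  · split_ifs
    · rw [e2]; push_cast
      linear_combination (-((q ^ ((s2 : ℝ) / 4) : ℝ) : ℂ) * (Real.sqrt (qnum q s1) : ℝ)) *
        e4
    · simp
  · split_ifs
    · rw [e1]; push_cast
      rw [show (- -1 / 4 : ℝ) = 1 / 4 by norm_num]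
      linear_combination (-((q ^ (-(s1 : ℝ) / 4) : ℝ) : ℂ) * (Real.sqrt (qnum q s2) : ℝ)) *
        e4
    · simp

open Classical in
theorem actAt_spinor_apply (hq : 0 < q) (x : E × Bool) (ε A : ℤˣ) (φ : BigFock E)
    (m : E × Bool → ℕ × ℕ) :
    actAt x (spinor q ε A) φ m =
      ((legWt q x.2 ε A (m x) : ℝ) : ℂ) * φ (Function.update m x (legSrc x.2 ε A (m x))) := by
  apply actAt_apply_of_shift x _ (legSrc x.2 ε A) (fun s => ((legWt q x.2 ε A s : ℝ) : ℂ))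
    (legSrc_preimage_finite x.2 ε A)
  intro n s
  cases x.2
  · rw [if_neg (by decide), spinor_single_apply_transpose hq]
  · rw [if_pos rfl, spinor_single_apply]
    rfl

theorem actAt_diagOp_apply (x : E × Bool) (g : ℕ × ℕ → ℝ) (φ : BigFock E)
    (m : E × Bool → ℕ × ℕ) : actAt x (diagOp g) φ m = (g (m x) : ℂ) * φ m := by
  classical
  rw [actAt_apply_of_shift x (diagOp g) id (fun s => (g s : ℂ)) (fun n => by simp)]
  · simp
  · intro n s
    rw [diagOp_single, diagOp_single, Finsupp.single_apply, Finsupp.single_apply, id]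
    by_cases h : s = n
    · subst h; simp
    · rw [if_neg h, if_neg h, if_neg (Ne.symm h)]; simp

theorem legWt_eq_zero_or (q : ℝ) (t : Bool) (ε A : ℤˣ) (m : ℕ × ℕ) :
    legWt q t ε A m = 0 ∨
      dspin (legSrc t ε A m) = dspin m - (if t then (ε : ℤ) else -(ε : ℤ)) := by
  cases t
  · rcases spinorWt_eq_zero_or q (-ε) (-A) m with h | ⟨h, -⟩
    · left; simp [legWt, h]
    · right; simpa [legSrc] using h
  · rcases spinorWt_eq_zero_or q ε A m with h | ⟨h, -⟩
    · left; simp [legWt, h]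
    · right; simpa [legSrc] using h

end LegOperators

/-! ### Scalar operators on an intertwiner with arbitrary orientations. -/

section VertexAction

variable {q : ℝ}

/-- The occupation numbers of the incoming leg dual to an outgoing one. -/
def legOcc (t : Bool) (m : ℕ × ℕ) : ℕ × ℕ := if t then m else m.swap

/-- The factor by which the slot `s` of an intertwiner is dualized. -/
def legDual (q : ℝ) (s : Fin 3) (t : Bool) (m : ℕ × ℕ) : ℝ := if t then 1 else dualCoeff q s m

@[simp] theorem dspin_swap (m : ℕ × ℕ) : dspin m.swap = dspin m := by
  simp [dspin, add_comm]

@[simp] theorem dspin_legOcc (t : Bool) (m : ℕ × ℕ) : dspin (legOcc t m) = dspin m := by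
  cases t <;> simp [legOcc]

theorem intertwiner_eq (q : ℝ) (inc : Fin 3 → Bool) (n : Fin 3 → ℕ × ℕ) :
    intertwiner q inc n = legDual q 0 (inc 0) (n 0) * legDual q 1 (inc 1) (n 1) *
      cg q (legOcc (inc 0) (n 0)) (legOcc (inc 1) (n 1)) (legOcc (inc 2) (n 2)).swap *
      (legDual q 2 (inc 2) (n 2) * cgSinglet q (legOcc (inc 2) (n 2)).swap) := by
  rw [intertwiner, Fin.prod_univ_three]
  simp only [legDual, legOcc]
  ring

theorem spinorSrc_swap (ε A : ℤˣ) (m : ℕ × ℕ) :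
    (spinorSrc ε (-A) m).swap = spinorSrc ε A m.swap := by
  rcases Int.units_eq_one_or ε with rfl | rfl <;> rcases Int.units_eq_one_or A with rfl | rfl <;>
    simp [spinorSrc, show ((-1 : ℤˣ) = 1) = False by decide]

/-- The reflection `m ↦ -m` exchanges the two bosons, hence `A` with `-A` and `q` with `q⁻¹`. This
is how the `τ` spinors on dual spaces become `t` spinors on the undualized leg. -/
theorem spinorWt_swap (hq : 0 < q) (ε A : ℤˣ) (m : ℕ × ℕ) :
    spinorWt q⁻¹ ε (-A) m = -((ε : ℤ) : ℝ) * spinorWt q ε A m.swap := by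
  have h : ∀ n : ℕ, -(((n : ℝ) + 1) / 4) = -((n : ℝ) + 1) / 4 := fun n => by ring
  have h' : ∀ n : ℕ, -((-1 + -(n : ℝ)) / 4) = ((n : ℝ) + 1) / 4 := fun n => by ring
  have h2 : ∀ n : ℕ, -((n : ℝ) / 4) = -(n : ℝ) / 4 := fun n => by ring
  have h2' : ∀ n : ℕ, -(-(n : ℝ) / 4) = (n : ℝ) / 4 := fun n => by ring
  rcases Int.units_eq_one_or ε with rfl | rfl <;> rcases Int.units_eq_one_or A with rfl | rfl <;>
    simp [spinorWt, show ((-1 : ℤˣ) = 1) = False by decide, inv_rpow_eq hq, qnum_inv hq, h, h', h2,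
      h2']

/-- The weight is kept on both sides because the shift rule for the dualizing factor fails when
subtraction truncates, which is where the weight vanishes. Only this vanishing matters, so the base
`r` is free. -/
theorem dualCoeff_spinorSrc_zero (hq : 0 < q) (ε A : ℤˣ) (m : ℕ × ℕ) (r : ℝ) :
    spinorWt r ε A m.swap * dualCoeff q 0 (spinorSrc ε (-A) m) =
      -((ε * A : ℤˣ) : ℤ) * q ^ (((A : ℤ) : ℝ) / 4) *
        (spinorWt r ε A m.swap * dualCoeff q 0 m) := by
  obtain ⟨m1, m2⟩ := m
  have e1 : ∀ a b : ℝ, q ^ (-(a - (b + 1)) / 4) = q ^ (1 / 4 : ℝ) * q ^ (-(a - b) / 4) :=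
    fun a b => by rw [← Real.rpow_add hq]; ring_nf
  have e2 : ∀ a b : ℝ, q ^ (-(a + 1 - b) / 4) = q ^ (-1 / 4 : ℝ) * q ^ (-(a - b) / 4) :=
    fun a b => by rw [← Real.rpow_add hq]; ring_nf
  have e3 : q ^ (1 / 4 : ℝ) * q ^ (-1 / 4 : ℝ) = 1 := by
    rw [← Real.rpow_add hq, ← Real.rpow_zero q]; ring_nf
  rcases Int.units_eq_one_or ε with rfl | rfl <;> rcases Int.units_eq_one_or A with rfl | rfl
  · rcases m1 with _ | n
    · simp [spinorWt]
    · simp only [dualCoeff, spinorSrc, dmag, show ((-1 : ℤˣ) = 1) = False by decide, if_true,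
        if_false, Nat.add_sub_cancel, show ((0 : Fin 3) = 1) = False by decide]
      push_cast
      rw [e2, pow_succ]
      linear_combination (-spinorWt r 1 1 (n + 1, m2).swap * (-1) ^ n *
        q ^ (-((n : ℝ) - m2) / 4)) * e3
  · rcases m2 with _ | n
    · simp [spinorWt, show ((-1 : ℤˣ) = 1) = False by decide]
    · simp only [dualCoeff, spinorSrc, dmag, neg_neg, if_true, Nat.add_sub_cancel,
        show ((0 : Fin 3) = 1) = False by decide, if_false]
      push_cast
      rw [e1]
      linear_combination (-spinorWt r 1 (-1) (m1, n + 1).swap * (-1) ^ m1 *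
        q ^ (-((m1 : ℝ) - n) / 4)) * e3
  · simp only [dualCoeff, spinorSrc, dmag, show ((-1 : ℤˣ) = 1) = False by decide, if_false,
        show ((0 : Fin 3) = 1) = False by decide]
    push_cast
    rw [e1]
    ring
  · simp only [dualCoeff, spinorSrc, dmag, neg_neg, if_true,
        show ((-1 : ℤˣ) = 1) = False by decide, if_false,
        show ((0 : Fin 3) = 1) = False by decide]
    push_cast
    rw [e2, pow_succ]
    ring

/-- The conventions of the slots `0` and `1` differ by `(-1)^{2j}`; as the spinor changes `2j` by
one, the sign is opposite to that in slot `0`. -/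
theorem dualCoeff_spinorSrc_one (hq : 0 < q) (ε A : ℤˣ) (m : ℕ × ℕ) (r : ℝ) :
    spinorWt r ε A m.swap * dualCoeff q 1 (spinorSrc ε (-A) m) =
      ((ε * A : ℤˣ) : ℤ) * q ^ (((A : ℤ) : ℝ) / 4) *
        (spinorWt r ε A m.swap * dualCoeff q 1 m) := by
  have h0 := dualCoeff_spinorSrc_zero hq ε A m r
  have hd : ∀ x : ℕ × ℕ, dualCoeff q 1 x = (-1 : ℝ) ^ (dspin x).toNat * dualCoeff q 0 x := by
    rintro ⟨x1, x2⟩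
    have : (dspin (x1, x2)).toNat = x1 + x2 := by simp [dspin]; omega
    rw [this]
    simp only [dualCoeff, if_true, show ((0 : Fin 3) = 1) = False by decide, if_false, pow_add]
    have := neg_one_pow_mul_self x1
    linear_combination (-(-1) ^ x2 * q ^ (-(dmag (x1, x2) : ℝ) / 4)) * this
  rw [hd, hd]
  rcases spinorWt_eq_zero_or r ε A m.swap with h | ⟨h, -⟩
  · rw [h]; ring
  · rw [← spinorSrc_swap, dspin_swap, dspin_swap] at h
    have hn : (-1 : ℝ) ^ (dspin (spinorSrc ε (-A) m)).toNat = -(-1) ^ (dspin m).toNat := by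
      have h1 : 0 ≤ dspin m := by unfold dspin; positivity
      have h2 : 0 ≤ dspin (spinorSrc ε (-A) m) := by unfold dspin; positivity
      rcases Int.units_eq_one_or ε with rfl | rfl
      · push_cast at h
        rw [show (dspin m).toNat = (dspin (spinorSrc 1 (-A) m)).toNat + 1 by omega, pow_succ]
        ring
      · push_cast at h
        rw [show (dspin (spinorSrc (-1) (-A) m)).toNat = (dspin m).toNat + 1 by omega, pow_succ]
        ring
    rw [hn]
    linear_combination (-(-1) ^ (dspin m).toNat) * h0

theorem intUnits_mul_self_cast (ε : ℤˣ) : ((ε : ℤ) : ℝ) * ((ε : ℤ) : ℝ) = 1 := by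
  rcases Int.units_eq_one_or ε with rfl | rfl <;> norm_num

theorem cgSinglet_inv_half (hq : 0 < q) (A : ℤˣ) :
    cgSinglet q⁻¹ (halfVec A) * q ^ (((A : ℤ) : ℝ) / 2) = cgSinglet q (halfVec A) := by
  rcases Int.units_eq_one_or A with rfl | rfl
  · simp only [cgSinglet, halfVec, dmag, dspin, inv_rpow_eq hq, qnum_inv hq, if_true]
    rw [div_mul_eq_mul_div, mul_assoc, ← Real.rpow_add hq]
    norm_num
  · simp only [cgSinglet, halfVec, dmag, dspin, inv_rpow_eq hq, qnum_inv hq,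
      show ((-1 : ℤˣ) = 1) = False by decide, if_false]
    rw [div_mul_eq_mul_div, mul_assoc, ← Real.rpow_add hq]
    norm_num

theorem legOcc_legSrc_in (o ε A : ℤˣ) (m : ℕ × ℕ) :
    legOcc (decide (o = 1)) (legSrc (decide (o = 1)) (o * ε) A m) =
      spinorSrc ε A (legOcc (decide (o = 1)) m) := by
  rcases Int.units_eq_one_or o with rfl | rfl
  · simp [legOcc, legSrc]
  · simp [legOcc, legSrc, show ((-1 : ℤˣ) = 1) = False by decide, spinorSrc_swap]

theorem legOcc_legSrc_out (o ε A : ℤˣ) (m : ℕ × ℕ) :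
    legOcc (decide (o = -1)) (legSrc (decide (o = -1)) (-(o * ε)) A m) =
      spinorSrc ε A (legOcc (decide (o = -1)) m) := by
  rcases Int.units_eq_one_or o with rfl | rfl
  · simp [legOcc, legSrc, show ((1 : ℤˣ) = -1) = False by decide, spinorSrc_swap]
  · simp [legOcc, legSrc]

/-- On an outgoing leg, transposition and dualization contribute `q^{A/4}` each (with `A = ±1`),
exactly the discrepancy between the singlet coefficients at `q⁻¹` and at `q`. Only the sign `ε` is
left. -/
theorem legWt_mul_legDual_in (hq : 0 < q) (o ε A : ℤˣ) (m : ℕ × ℕ) :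
    cgSinglet (q ^ (o : ℤ)) (halfVec A) *
      (legWt (q ^ (o : ℤ)) (decide (o = 1)) (o * ε) A m *
        legDual q 0 (decide (o = 1)) (legSrc (decide (o = 1)) (o * ε) A m)) =
    (if o = 1 then 1 else ((ε : ℤ) : ℝ)) * (cgSinglet q (halfVec A) *
      (spinorWt q ε A (legOcc (decide (o = 1)) m) * legDual q 0 (decide (o = 1)) m)) := by
  rcases Int.units_eq_one_or o with rfl | rfl
  · simp [legWt, legDual, legOcc]
  · have h1 := dualCoeff_spinorSrc_zero hq ε A m q
    have h2 := spinorWt_swap hq ε A m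
    have h3 := cgSinglet_inv_half hq A
    have h4 := intUnits_mul_self_cast ε
    have h5 := intUnits_mul_self_cast A
    have h6 : q ^ (((A : ℤ) : ℝ) / 2) = q ^ (((A : ℤ) : ℝ) / 4) * q ^ (((A : ℤ) : ℝ) / 4) := by
      rw [← Real.rpow_add hq]; ring_nf
    have h7 : q⁻¹ ^ (-((A : ℤ) : ℝ) / 4) = q ^ (((A : ℤ) : ℝ) / 4) := by
      rw [inv_rpow_eq hq]; ring_nf
    simp only [legWt, legSrc, legDual, legOcc, show ((-1 : ℤˣ) = 1) = False by decide,
      decide_false, Bool.false_eq_true, if_false, Units.val_neg, Units.val_one, zpow_neg, zpow_one,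
      neg_mul, one_mul, neg_neg, h7, h2]
    push_cast at h1 ⊢
    rw [← h3, h6]
    linear_combination (-(cgSinglet q⁻¹ (halfVec A)) * q ^ (((A : ℤ) : ℝ) / 4) * (ε : ℤ) *
      (ε : ℤ) * (A : ℤ)) * h1 + cgSinglet q⁻¹ (halfVec A) * q ^ (((A : ℤ) : ℝ) / 4) *
      q ^ (((A : ℤ) : ℝ) / 4) * spinorWt q ε A m.swap * dualCoeff q 0 m * (ε : ℤ) *
      ((A : ℤ) * (A : ℤ) * h4 + h5)

/-- Here the powers of `q` from transposition and dualization cancel each other, leaving the sign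
`-ε`. -/
theorem legWt_mul_legDual_out (hq : 0 < q) (o ε A : ℤˣ) (m : ℕ × ℕ) :
    legWt (q ^ (o : ℤ)) (decide (o = -1)) (-(o * ε)) A m *
        legDual q 1 (decide (o = -1)) (legSrc (decide (o = -1)) (-(o * ε)) A m) =
    (if o = -1 then 1 else -((ε : ℤ) : ℝ)) *
      (spinorWt q⁻¹ ε A (legOcc (decide (o = -1)) m) * legDual q 1 (decide (o = -1)) m) := by
  rcases Int.units_eq_one_or o with rfl | rfl
  · have h1 := dualCoeff_spinorSrc_one hq ε A m q⁻¹
    have h2 := spinorWt_swap (inv_pos.mpr hq) ε A m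
    rw [inv_inv] at h2
    have h4 := intUnits_mul_self_cast ε
    have h5 := intUnits_mul_self_cast A
    have h6 : q ^ (-((A : ℤ) : ℝ) / 4) * q ^ (((A : ℤ) : ℝ) / 4) = 1 := by
      rw [← Real.rpow_add hq, ← Real.rpow_zero q]; ring_nf
    simp only [legWt, legSrc, legDual, legOcc, show ((1 : ℤˣ) = -1) = False by decide,
      decide_false, Bool.false_eq_true, if_false, Units.val_one, zpow_one, one_mul,
      neg_neg, h2]
    push_cast at h1 ⊢
    simp only [neg_mul, neg_neg]
    linear_combination (-q ^ (-((A : ℤ) : ℝ) / 4) * (ε : ℤ) * (ε : ℤ) * (A : ℤ)) * h1 -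
      (ε : ℤ) * (ε : ℤ) * (ε : ℤ) * (A : ℤ) * (A : ℤ) *
      spinorWt q⁻¹ ε A m.swap * dualCoeff q 1 m * h6 -
      (ε : ℤ) * spinorWt q⁻¹ ε A m.swap * dualCoeff q 1 m * ((A : ℤ) * (A : ℤ) * h4 + h5)
  · simp [legWt, legDual, legOcc]

/-- The sign `orientSign`, as a real number. -/
def orientSignReal (o ε : ℤˣ) : ℝ := if o = -1 ∧ ε = 1 then -1 else 1

theorem orientSign_eq_ofReal (o ε : ℤˣ) : orientSign o ε = ((orientSignReal o ε : ℝ) : ℂ) := by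
  unfold orientSign orientSignReal
  split_ifs <;> simp

/-- The orientation signs in the scalar operators are such that, together with those of the dualized
legs, they reduce to the `ε'` of `mul_spinorPairing` for all orientations. -/
theorem orientSign_prod (o o' ε ε' : ℤˣ) :
    -((o : ℤ) : ℝ) * orientSignReal o ε * orientSignReal o' ε' *
      ((if o = 1 then 1 else ((ε : ℤ) : ℝ)) * (if o' = -1 then 1 else -((ε' : ℤ) : ℝ))) =
    ((ε' : ℤ) : ℝ) := by
  rcases Int.units_eq_one_or o with rfl | rfl <;> rcases Int.units_eq_one_or o' with rfl | rfl <;>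
  rcases Int.units_eq_one_or ε with rfl | rfl <;> rcases Int.units_eq_one_or ε' with rfl | rfl <;>
    simp [orientSignReal, show ((-1 : ℤˣ) = 1) = False by decide,
      show ((1 : ℤˣ) = -1) = False by decide]

/-- The action of the scalar operators on the components of an intertwiner. -/
theorem scalar_intertwiner (hq : 0 < q) (hq1 : q ≠ 1) (o o' ε ε' : ℤˣ) (inc : Fin 3 → Bool)
    (h0 : inc 0 = decide (o = 1)) (h1 : inc 1 = decide (o' = -1)) (n : Fin 3 → ℕ × ℕ) :
    -((o : ℤ) : ℝ) * Real.sqrt (qnum q 2) * orientSignReal o ε * orientSignReal o' ε' *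
      ∑ A : ℤˣ, cgSinglet (q ^ (o : ℤ)) (halfVec A) *
        (legWt (q ^ (o : ℤ)) (inc 0) (o * ε) A (n 0) *
          (legWt (q ^ (o' : ℤ)) (inc 1) (-(o' * ε')) (-A) (n 1) *
          intertwiner q inc ![legSrc (inc 0) (o * ε) A (n 0),
            legSrc (inc 1) (-(o' * ε')) (-A) (n 1), n 2])) =
      scalarCoef q ε' ε (dspin (n 1)) (dspin (n 0)) (dspin (n 2)) * intertwiner q inc n := by
  have hp := mul_spinorPairing hq hq1 ε ε' (legOcc (inc 0) (n 0)) (legOcc (inc 1) (n 1))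
    (legOcc (inc 2) (n 2)).swap
  simp only [dspin_swap, dspin_legOcc] at hp
  have hs := orientSign_prod o o' ε ε'
  -- Undoing the dualization on each leg turns the sum over `A` into the contraction for all legs
  -- incoming; the third leg is a spectator.
  have hsum : ∑ A : ℤˣ, cgSinglet (q ^ (o : ℤ)) (halfVec A) *
        (legWt (q ^ (o : ℤ)) (inc 0) (o * ε) A (n 0) *
          (legWt (q ^ (o' : ℤ)) (inc 1) (-(o' * ε')) (-A) (n 1) *
          intertwiner q inc ![legSrc (inc 0) (o * ε) A (n 0),
            legSrc (inc 1) (-(o' * ε')) (-A) (n 1), n 2])) =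
      (if o = 1 then 1 else ((ε : ℤ) : ℝ)) * (if o' = -1 then 1 else -((ε' : ℤ) : ℝ)) *
      (legDual q 0 (inc 0) (n 0) * legDual q 1 (inc 1) (n 1) *
      (legDual q 2 (inc 2) (n 2) * cgSinglet q (legOcc (inc 2) (n 2)).swap)) *
      spinorPairing q ε ε' (legOcc (inc 0) (n 0)) (legOcc (inc 1) (n 1))
        (legOcc (inc 2) (n 2)).swap := by
    rw [spinorPairing, Finset.mul_sum]
    apply Finset.sum_congr rfl
    intro A _
    have a1 := legWt_mul_legDual_in hq o ε A (n 0)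
    have a2 := legWt_mul_legDual_out hq o' ε' (-A) (n 1)
    have a3 := legOcc_legSrc_in o ε A (n 0)
    have a4 := legOcc_legSrc_out o' ε' (-A) (n 1)
    rw [← h0] at a1 a3
    rw [← h1] at a2 a4
    rw [intertwiner_eq]
    simp only [Matrix.cons_val_zero, Matrix.cons_val_one, Matrix.cons_val]
    rw [a3, a4]
    generalize legDual q 2 (inc 2) (n 2) * cgSinglet q (legOcc (inc 2) (n 2)).swap = R
    generalize cg q _ _ _ = C
    linear_combination (C * R * legWt (q ^ (o' : ℤ)) (inc 1) (-(o' * ε')) (-A) (n 1) *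
      legDual q 1 (inc 1) (legSrc (inc 1) (-(o' * ε')) (-A) (n 1))) * a1 +
      (C * R * (if o = 1 then 1 else ((ε : ℤ) : ℝ)) * (cgSinglet q (halfVec A) *
      (spinorWt q ε A (legOcc (inc 0) (n 0)) * legDual q 0 (inc 0) (n 0)))) * a2
  rw [hsum, intertwiner_eq]
  generalize spinorPairing q ε ε' _ _ _ = P at *
  linear_combination (legDual q 0 (inc 0) (n 0) * legDual q 1 (inc 1) (n 1) *
      (legDual q 2 (inc 2) (n 2) * cgSinglet q (legOcc (inc 2) (n 2)).swap)) *
    (hp + Real.sqrt (qnum q 2) * P * hs)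

end VertexAction

/-! ### Networks with independent labels on the half-edges. -/

section HalfEdgeNetworks

variable {V E : Type*}

/-- The component of the intertwiner at `v` when the half-edge `x` carries the (doubled) spin
`K x`. -/
def vertexAmp (Γ : RibbonGraph V E) (q : ℝ) (K : E × Bool → ℤ) (v : V)
    (m : E × Bool → ℕ × ℕ) : ℝ :=
  if ∀ s, dspin (m (Γ.dart (v, s))) = K (Γ.dart (v, s)) then
    intertwiner q (fun s => (Γ.dart (v, s)).2) (fun s => m (Γ.dart (v, s))) else 0

theorem RibbonGraph.Admissible.nonneg {Γ : RibbonGraph V E} {k : E → ℤ} (h : Γ.Admissible k)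
    (e : E) : 0 ≤ k e := by
  obtain ⟨⟨v, s⟩, hs⟩ := Γ.dart.surjective (e, true)
  obtain ⟨h0, h1, h2, -⟩ := h v
  have he : e = (Γ.dart (v, s)).1 := by rw [hs]
  rw [he]
  fin_cases s
  exacts [h0, h1, h2]

theorem dart_ne {Γ : RibbonGraph V E} {v w : V} {s t : Fin 3} (h : (v, s) ≠ (w, t)) : Γ.dart (v, s) ≠ Γ.dart (w, t) :=
  fun h' => h (Γ.dart.injective h')

variable {d : ℕ}

theorem Face.dartIn_eq {Γ : RibbonGraph V E} (F : Face Γ d) (i : ZMod d) :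
    F.dartIn i = (F.edge (i - 1), decide (F.o (i - 1) = 1)) := F.dart_zero i

theorem Face.dartOut_eq {Γ : RibbonGraph V E} (F : Face Γ d) (i : ZMod d) : F.dartOut i = (F.edge i, decide (F.o i = -1)) :=
  F.dart_one i

/-- The third half-edge at `v_i`. -/
def Face.dartLeg {Γ : RibbonGraph V E} (F : Face Γ d) (i : ZMod d) : E × Bool := Γ.dart (F.vert i, 2)

open Classical in
/-- The half-edge labels `K` with `s'` and `s` added on the ends of `e_{i-1}` and `e_i` at `v_i`. -/
def Face.bump {Γ : RibbonGraph V E} (F : Face Γ d) (i : ZMod d) (s' s : ℤ) (K : E × Bool → ℤ) : E × Bool → ℤ :=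
  fun x => K x + (if x = F.dartIn i then s' else 0) + if x = F.dartOut i then s else 0

variable [Fintype V]

theorem dspin_eq_of_prod_vertexAmp_ne_zero {Γ : RibbonGraph V E} {K : E × Bool → ℤ}
    {m : E × Bool → ℕ × ℕ} (h : ∏ v, vertexAmp Γ q K v m ≠ 0) (x : E × Bool) :
    dspin (m x) = K x := by
  obtain ⟨⟨v, s⟩, rfl⟩ := Γ.dart.surjective x
  have hv := Finset.prod_ne_zero_iff.mp h v (Finset.mem_univ v)
  by_contra hc
  exact hv (if_neg fun h' => hc (h' s))

variable [Fintype E] {q : ℝ}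

open Classical in
/-- The tensor product of intertwiners in which the two ends of an edge may carry different
spins. -/
def RibbonGraph.splitNet (Γ : RibbonGraph V E) (q : ℝ) (K : E × Bool → ℤ) : BigFock E :=
  Finsupp.onFinset
    (Fintype.piFinset fun x : E × Bool => Finset.HasAntidiagonal.antidiagonal (K x).toNat)
    (fun m => ((∏ v, vertexAmp Γ q K v m : ℝ) : ℂ)) fun m hm => by
      rw [Fintype.mem_piFinset]
      intro x
      have h := dspin_eq_of_prod_vertexAmp_ne_zero (Complex.ofReal_ne_zero.mp hm) x
      rw [Finset.HasAntidiagonal.mem_antidiagonal]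
      unfold dspin at h
      omega

theorem RibbonGraph.splitNet_apply (Γ : RibbonGraph V E) (q : ℝ) (K : E × Bool → ℤ)
    (m : E × Bool → ℕ × ℕ) :
    Γ.splitNet q K m = ((∏ v, vertexAmp Γ q K v m : ℝ) : ℂ) := rfl

/-- Admissibility enters only through `k ≥ 0`: the support of `net` is defined with truncated
labels, that of `splitNet` with the integers themselves. -/
theorem RibbonGraph.net_eq_splitNet (Γ : RibbonGraph V E) (q : ℝ) {k : E → ℤ}
    (h : Γ.Admissible k) : Γ.net q k = Γ.splitNet q fun x => k x.1 := by
  classical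
  ext m
  rw [RibbonGraph.net, Finsupp.finsetSum_apply, RibbonGraph.splitNet_apply]
  simp only [Finsupp.single_apply]
  rw [Finset.sum_ite_eq']
  by_cases hm : ∀ x, dspin (m x) = k x.1
  · rw [if_pos]
    · congr 1
      apply Finset.prod_congr rfl
      intro v _
      rw [vertexAmp, if_pos fun s => hm _]
    · rw [Fintype.mem_piFinset]
      intro x
      rw [Finset.HasAntidiagonal.mem_antidiagonal]
      have h1 := hm x
      unfold dspin at h1
      omega
  · rw [if_neg]
    · by_contra hc
      exact hm (dspin_eq_of_prod_vertexAmp_ne_zero (Complex.ofReal_ne_zero.mp (Ne.symm hc)))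
    · intro hc
      apply hm
      intro x
      have h1 := Fintype.mem_piFinset.mp hc x
      rw [Finset.HasAntidiagonal.mem_antidiagonal] at h1
      have h2 := h.nonneg x.1
      unfold dspin
      omega

variable {Γ : RibbonGraph V E} (F : Face Γ d)

theorem invN_splitNet (q : ℝ) (x : E × Bool) (K : E × Bool → ℤ) :
    invN q x (Γ.splitNet q K) = (((qnum q (K x + 1))⁻¹ : ℝ) : ℂ) • Γ.splitNet q K := by
  ext m
  rw [invN, actAt_diagOp_apply, Finsupp.smul_apply, smul_eq_mul, Γ.splitNet_apply]
  by_cases h : ∏ v, vertexAmp Γ q K v m = 0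
  · rw [h]; simp
  · rw [dspin_eq_of_prod_vertexAmp_ne_zero h x]

/-- The scalar operators map a tensor product of intertwiners to another one. -/
theorem Face.scalarOp_splitNet (hq : 0 < q) (hq1 : q ≠ 1) (i : ZMod d) (ε' ε : ℤˣ)
    (K : E × Bool → ℤ) :
    F.scalarOp q i ε' ε (Γ.splitNet q K) =
      ((scalarCoef q ε' ε (K (F.dartOut i) + (ε' : ℤ)) (K (F.dartIn i) + (ε : ℤ))
        (K (F.dartLeg i)) : ℝ) : ℂ) • Γ.splitNet q (F.bump i ε ε' K) := by
  classical
  ext m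
  set v := F.vert i with hv
  set x0 := F.dartIn i with hx0
  set x1 := F.dartOut i with hx1
  set K' := F.bump i ε ε' K with hK'
  have h01 : x1 ≠ x0 := dart_ne (by simp)
  have h20 : F.dartLeg i ≠ x0 := dart_ne (by simp)
  have h21 : F.dartLeg i ≠ x1 := dart_ne (by simp)
  have hK0 : K' x0 = K x0 + (ε : ℤ) := by
    simp only [hK', Face.bump, ← hx0, ← hx1, if_true, if_neg h01.symm, add_zero]
  have hK1 : K' x1 = K x1 + (ε' : ℤ) := by
    simp only [hK', Face.bump, ← hx0, ← hx1, if_true, if_neg h01, add_zero]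
  have hK2 : K' (F.dartLeg i) = K (F.dartLeg i) := by
    simp only [hK', Face.bump, ← hx0, ← hx1, if_neg h20, if_neg h21, add_zero]
  set rest := ∏ w ∈ Finset.univ.erase v, vertexAmp Γ q K' w m with hrest
  have hsplit : ∀ (L : E × Bool → ℤ) (n : E × Bool → ℕ × ℕ), ∏ w, vertexAmp Γ q L w n =
      vertexAmp Γ q L v n * ∏ w ∈ Finset.univ.erase v, vertexAmp Γ q L w n := fun L n =>
    (Finset.mul_prod_erase _ _ (Finset.mem_univ v)).symm
  -- Each half-edge belongs to one vertex, so the amplitudes away from `v` notice neither the new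
  -- occupation numbers nor the new labels.
  have hoff : ∀ y0 y1 : ℕ × ℕ, ∏ w ∈ Finset.univ.erase v,
      vertexAmp Γ q K w (Function.update (Function.update m x0 y0) x1 y1) = rest := by
    intro y0 y1
    apply Finset.prod_congr rfl
    intro w hw
    have hne : w ≠ v := Finset.ne_of_mem_erase hw
    have hd0 : ∀ s, Γ.dart (w, s) ≠ x0 := fun s => dart_ne fun h => hne (congrArg Prod.fst h)
    have hd1 : ∀ s, Γ.dart (w, s) ≠ x1 := fun s => dart_ne fun h => hne (congrArg Prod.fst h)
    simp only [vertexAmp, Function.update_of_ne (hd0 _), Function.update_of_ne (hd1 _), hK',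
      Face.bump, ← hx0, ← hx1, if_neg (hd0 _), if_neg (hd1 _), add_zero]
  set inc : Fin 3 → Bool := fun s => (Γ.dart (v, s)).2 with hinc
  set n : Fin 3 → ℕ × ℕ := fun s => m (Γ.dart (v, s)) with hn
  have hi0 : inc 0 = decide (F.o (i - 1) = 1) := by
    simp only [hinc]; rw [F.dart_zero]
  have hi1 : inc 1 = decide (F.o i = -1) := by
    simp only [hinc]; rw [F.dart_one]
  have hx0' : x0.2 = inc 0 := rfl
  have hx1' : x1.2 = inc 1 := rfl
  set T : ℤˣ → ℝ := fun A => cgSinglet (q ^ (F.o (i - 1) : ℤ)) (halfVec A) *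
    (legWt (q ^ (F.o (i - 1) : ℤ)) (inc 0) (F.o (i - 1) * ε) A (n 0) *
      (legWt (q ^ (F.o i : ℤ)) (inc 1) (-(F.o i * ε')) (-A) (n 1) *
        vertexAmp Γ q K v (Function.update (Function.update m x0
          (legSrc (inc 0) (F.o (i - 1) * ε) A (n 0))) x1
          (legSrc (inc 1) (-(F.o i * ε')) (-A) (n 1))))) with hT
  -- The claim at the single vertex `v`, which is `scalar_intertwiner` once the spins are seen to
  -- match.
  have hlocal : -((F.o (i - 1) : ℤ) : ℝ) * Real.sqrt (qnum q 2) * orientSignReal (F.o (i - 1)) ε *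
      orientSignReal (F.o i) ε' * ∑ A : ℤˣ, T A =
      scalarCoef q ε' ε (K x1 + (ε' : ℤ)) (K x0 + (ε : ℤ)) (K (F.dartLeg i)) *
        vertexAmp Γ q K' v m := by
    have hu0 : ∀ y0 y1, Function.update (Function.update m x0 y0) x1 y1 (Γ.dart (v, 0)) = y0 := by
      intro y0 y1
      change Function.update (Function.update m x0 y0) x1 y1 x0 = y0
      rw [Function.update_of_ne h01.symm, Function.update_self]
    have hu1 : ∀ y0 y1, Function.update (Function.update m x0 y0) x1 y1 (Γ.dart (v, 1)) = y1 := by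
      intro y0 y1
      change Function.update (Function.update m x0 y0) x1 y1 x1 = y1
      rw [Function.update_self]
    have hu2 : ∀ y0 y1, Function.update (Function.update m x0 y0) x1 y1 (Γ.dart (v, 2)) = n 2 := by
      intro y0 y1
      change Function.update (Function.update m x0 y0) x1 y1 (F.dartLeg i) = m (F.dartLeg i)
      rw [Function.update_of_ne h21, Function.update_of_ne h20]
    have hs0 : ∀ A, legWt (q ^ (F.o (i - 1) : ℤ)) (inc 0) (F.o (i - 1) * ε) A (n 0) = 0 ∨
        dspin (legSrc (inc 0) (F.o (i - 1) * ε) A (n 0)) = dspin (n 0) - (ε : ℤ) := by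
      intro A
      rcases legWt_eq_zero_or (q ^ (F.o (i - 1) : ℤ)) (inc 0) (F.o (i - 1) * ε) A (n 0) with h | h
      · exact Or.inl h
      · right
        rw [h, hi0]
        rcases Int.units_eq_one_or (F.o (i - 1)) with ho | ho <;> rw [ho] <;>
          simp [show ((-1 : ℤˣ) = 1) = False by decide]
    have hs1 : ∀ A, legWt (q ^ (F.o i : ℤ)) (inc 1) (-(F.o i * ε')) A (n 1) = 0 ∨
        dspin (legSrc (inc 1) (-(F.o i * ε')) A (n 1)) = dspin (n 1) - (ε' : ℤ) := by
      intro A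
      rcases legWt_eq_zero_or (q ^ (F.o i : ℤ)) (inc 1) (-(F.o i * ε')) A (n 1) with h | h
      · exact Or.inl h
      · right
        rw [h, hi1]
        rcases Int.units_eq_one_or (F.o i) with ho | ho <;> rw [ho] <;>
          simp [show ((1 : ℤˣ) = -1) = False by decide]
    by_cases hm : ∀ s, dspin (m (Γ.dart (v, s))) = K' (Γ.dart (v, s))
    · have e0 : dspin (n 0) = K x0 + (ε : ℤ) := (hm 0).trans hK0
      have e1 : dspin (n 1) = K x1 + (ε' : ℤ) := (hm 1).trans hK1
      have e2 : dspin (n 2) = K (F.dartLeg i) := (hm 2).trans hK2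
      have hsc := scalar_intertwiner hq hq1 (F.o (i - 1)) (F.o i) ε ε' inc hi0 hi1 n
      rw [e0, e1, e2] at hsc
      rw [vertexAmp, if_pos hm]
      change _ = _ * intertwiner q inc n
      rw [← hsc]
      congr 1
      apply Finset.sum_congr rfl
      intro A _
      simp only [hT]
      congr 1
      rcases hs0 A with h0 | h0
      · rw [h0]; ring
      rcases hs1 (-A) with h1 | h1
      · rw [h1]; ring
      congr 2
      rw [vertexAmp, if_pos]
      · congr 1
        funext s
        fin_cases s
        · exact hu0 _ _
        · exact hu1 _ _
        · exact hu2 _ _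
      · intro s
        fin_cases s
        · exact (congrArg dspin (hu0 _ _)).trans (h0.trans (by rw [e0]; exact add_sub_cancel_right _ _))
        · exact (congrArg dspin (hu1 _ _)).trans (h1.trans (by rw [e1]; exact add_sub_cancel_right _ _))
        · exact (congrArg dspin (hu2 _ _)).trans e2
    -- A non-zero weight changes the two spins by exactly `ε` and `ε'`, so if `m` does not carry the
    -- new labels, no source carries the old ones.
    · rw [vertexAmp, if_neg hm, mul_zero]
      apply mul_eq_zero_of_right
      apply Finset.sum_eq_zero
      intro A _
      simp only [hT]
      rcases hs0 A with h0 | h0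
      · rw [h0]; ring
      rcases hs1 (-A) with h1 | h1
      · rw [h1]; ring
      rw [vertexAmp, if_neg]
      · ring
      · intro hall
        apply hm
        have a0 := hall 0
        have a1 := hall 1
        have a2 := hall 2
        rw [hu0, h0] at a0
        rw [hu1, h1] at a1
        rw [hu2] at a2
        intro s
        fin_cases s
        · change dspin (n 0) = K' x0
          rw [hK0]
          change _ = K x0 at a0
          omega
        · change dspin (n 1) = K' x1
          rw [hK1]
          change _ = K x1 at a1
          omega
        · change dspin (n 2) = K' (F.dartLeg i)
          rw [hK2]
          exact a2
  rw [Finsupp.smul_apply, smul_eq_mul, Γ.splitNet_apply, hsplit K', ← hrest, Face.scalarOp,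
    LinearMap.smul_apply, Finsupp.smul_apply, smul_eq_mul, LinearMap.sum_apply,
    Finsupp.finsetSum_apply]
  have hterm : ∀ A : ℤˣ, ((cgSinglet (q ^ (F.o (i - 1) : ℤ)) (halfVec A) : ℂ) •
      (actAt (F.dartIn i) (spinor (q ^ (F.o (i - 1) : ℤ)) (F.o (i - 1) * ε) A) *
        actAt (F.dartOut i) (spinor (q ^ (F.o i : ℤ)) (-(F.o i * ε')) (-A)))) (Γ.splitNet q K) m =
      ((T A * rest : ℝ) : ℂ) := by
    intro A
    rw [LinearMap.smul_apply, Finsupp.smul_apply, smul_eq_mul, Module.End.mul_apply,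
      actAt_spinor_apply (zpow_pos hq _), actAt_spinor_apply (zpow_pos hq _), Γ.splitNet_apply,
      ← hx0, ← hx1, Function.update_of_ne h01, hsplit K, hoff, hx0', hx1',
      show m x0 = n 0 from rfl, show m x1 = n 1 from rfl]
    simp only [hT]
    push_cast
    ring
  rw [Finset.sum_congr rfl fun A _ => hterm A, orientSign_eq_ofReal, orientSign_eq_ofReal]
  rw [← Complex.ofReal_sum, ← Finset.sum_mul]
  have hfin := congrArg (fun r : ℝ => ((r * rest : ℝ) : ℂ)) hlocal
  push_cast at hfin ⊢
  linear_combination hfin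

end HalfEdgeNetworks

/-! ### Accumulated shifts of the labels around the face. -/

section Bumps

variable {V E : Type*} {Γ : RibbonGraph V E} {d : ℕ} (F : Face Γ d)

open Classical in
/-- The change of the half-edge labels at `v_i` when the label of `e_i` changes by `s i`. -/
def Face.bumpAt (s : ZMod d → ℤ) (i : ZMod d) (x : E × Bool) : ℤ :=
  (if x = F.dartIn i then s (i - 1) else 0) + if x = F.dartOut i then s i else 0

theorem Face.bump_eq_add_bumpAt (s : ZMod d → ℤ) (i : ZMod d) (K : E × Bool → ℤ) :
    F.bump i (s (i - 1)) (s i) K = fun x => K x + F.bumpAt s i x := by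
  funext x
  rw [Face.bump, Face.bumpAt, add_assoc]

theorem Face.bumpAt_of_ne (s : ZMod d → ℤ) {i j : ZMod d} (h : i ≠ j) (t : Fin 3) :
    F.bumpAt s i (Γ.dart (F.vert j, t)) = 0 := by
  have hv : F.vert j ≠ F.vert i := fun h' => h (F.vert_injective h').symm
  have h0 : Γ.dart (F.vert j, t) ≠ F.dartIn i := dart_ne fun h' => hv (congrArg Prod.fst h')
  have h1 : Γ.dart (F.vert j, t) ≠ F.dartOut i := dart_ne fun h' => hv (congrArg Prod.fst h')
  rw [Face.bumpAt, if_neg h0, if_neg h1, add_zero]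

theorem Face.bumpAt_dartIn_self (s : ZMod d → ℤ) (i : ZMod d) :
    F.bumpAt s i (F.dartIn i) = s (i - 1) := by
  have h : F.dartIn i ≠ F.dartOut i := dart_ne (by simp)
  rw [Face.bumpAt, if_pos rfl, if_neg h, add_zero]

theorem Face.sum_bumpAt_of_notMem (s : ZMod d → ℤ) (L : List ℕ) (j : ZMod d)
    (h : j ∉ L.map (Nat.cast : ℕ → ZMod d)) (t : Fin 3) :
    (L.map fun i : ℕ => F.bumpAt s i (Γ.dart (F.vert j, t))).sum = 0 := by
  induction L with
  | nil => simp
  | cons a L ih =>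
    rw [List.map_cons, List.mem_cons, not_or] at h
    rw [List.map_cons, List.sum_cons, ih h.2, F.bumpAt_of_ne s (Ne.symm h.1), add_zero]

/-- The coefficient at a vertex depends only on the three labels there, which operators at other
vertices do not change. All coefficients may therefore be evaluated at the initial labels, provided
no vertex is repeated. -/
theorem Face.list_prod_splitNet [Fintype V] [Fintype E] {q : ℝ} (s : ZMod d → ℤ)
    (O : ℕ → Module.End ℂ (BigFock E)) (c : ℕ → ℤ → ℤ → ℤ → ℂ)
    (hO : ∀ (i : ℕ) (K : E × Bool → ℤ), O i (Γ.splitNet q K) =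
      c i (K (F.dartOut i)) (K (F.dartIn i)) (K (F.dartLeg i)) •
        Γ.splitNet q fun x => K x + F.bumpAt s i x)
    (L : List ℕ) (hL : (L.map (Nat.cast : ℕ → ZMod d)).Nodup) (K : E × Bool → ℤ) :
    (L.map O).prod (Γ.splitNet q K) =
      (L.map fun i : ℕ => c i (K (F.dartOut i)) (K (F.dartIn i)) (K (F.dartLeg i))).prod •
        Γ.splitNet q fun x => K x + (L.map fun i : ℕ => F.bumpAt s i x).sum := by
  induction L with
  | nil => simp
  | cons a L ih =>
    rw [List.map_cons, List.nodup_cons] at hL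
    have h1 := F.sum_bumpAt_of_notMem s L a hL.1
    rw [List.map_cons, List.prod_cons, Module.End.mul_apply, ih hL.2, map_smul, hO, smul_smul,
      List.map_cons, List.prod_cons]
    have e1 : (L.map fun i : ℕ => F.bumpAt s i (F.dartOut a)).sum = 0 := h1 1
    have e0 : (L.map fun i : ℕ => F.bumpAt s i (F.dartIn a)).sum = 0 := h1 0
    have e2 : (L.map fun i : ℕ => F.bumpAt s i (F.dartLeg a)).sum = 0 := h1 2
    rw [e0, e1, e2, add_zero, add_zero, add_zero, mul_comm]
    congr 2
    funext x
    rw [List.map_cons, List.sum_cons]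
    ring

theorem natCast_zmod_inj {a i j : ℕ} (hi : a ≤ i) (hi' : i < a + d) (hj : a ≤ j)
    (hj' : j < a + d) (h : (i : ZMod d) = j) : i = j := by
  rw [ZMod.natCast_eq_natCast_iff] at h
  have h1 : (d : ℤ) ∣ (j : ℤ) - i := (Nat.modEq_iff_dvd).mp h
  obtain ⟨t, ht⟩ := h1
  have : t = 0 := by
    by_contra hne
    rcases lt_or_gt_of_ne hne with h2 | h2
    · have : (d : ℤ) * t ≤ d * (-1) := mul_le_mul_of_nonneg_left (by omega) (by positivity)
      omega
    · have : (d : ℤ) * 1 ≤ d * t := mul_le_mul_of_nonneg_left (by omega) (by positivity)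
      omega
  subst this
  omega

theorem nodup_map_cast_range' {a n : ℕ} (h : n ≤ d) :
    ((List.range' a n).map (Nat.cast : ℕ → ZMod d)).Nodup := by
  apply List.Nodup.map_on _ List.nodup_range'
  intro i hi j hj hij
  rw [List.mem_range'_1] at hi hj
  exact natCast_zmod_inj hi.1 (by omega) hj.1 (by omega) hij

theorem sum_map_range'_eq_sum [NeZero d] (f : ZMod d → ℤ) (a : ℕ) :
    ((List.range' a d).map fun i : ℕ => f i).sum = ∑ i, f i := by
  have hn := nodup_map_cast_range' (d := d) (a := a) le_rfl
  have hu : ((List.range' a d).map (Nat.cast : ℕ → ZMod d)).toFinset = Finset.univ := by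
    apply Finset.eq_univ_of_card
    rw [List.toFinset_card_of_nodup hn, List.length_map, List.length_range', ZMod.card]
  rw [← hu, List.sum_toFinset f hn, List.map_map]
  rfl

/-- The two ends of `e_i` sit at `v_i` and `v_{i+1}` and both move by `s i`, so a full turn leads
back to labels of edges. -/
theorem Face.sum_bumpAt [NeZero d] (s : ZMod d → ℤ) (x : E × Bool) (k : E → ℤ) :
    k x.1 + ∑ i, F.bumpAt s i x = F.shift k s x.1 := by
  classical
  rw [Face.shift]
  congr 1
  simp only [Face.bumpAt, Finset.sum_add_distrib]
  -- Reindexed so that both ends of the same edge `e_i` appear in the same summand.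
  have h1 : (∑ i : ZMod d, if x = F.dartIn i then s (i - 1) else 0) =
      ∑ i : ZMod d, if x = F.dartIn (i + 1) then s i else 0 := by
    rw [← Equiv.sum_comp (Equiv.addRight (1 : ZMod d))]
    apply Finset.sum_congr rfl
    intro i _
    rw [Equiv.coe_addRight, add_sub_cancel_right]
  rw [h1, ← Finset.sum_add_distrib]
  apply Finset.sum_congr rfl
  intro i _
  rw [F.dartIn_eq, F.dartOut_eq, add_sub_cancel_right]
  obtain ⟨e, b⟩ := x
  simp only [Prod.mk.injEq]
  by_cases he : e = F.edge i
  · subst he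
    rcases Int.units_eq_one_or (F.o i) with ho | ho <;> rw [ho] <;> cases b <;>
      simp [show ((-1 : ℤˣ) = 1) = False by decide, show ((1 : ℤˣ) = -1) = False by decide]
  · rw [if_neg (by tauto), if_neg (by tauto), if_neg (Ne.symm he), add_zero]

theorem Face.shift_edge [NeZero d] (k : E → ℤ) (s : ZMod d → ℤ) (i : ZMod d) :
    F.shift k s (F.edge i) = k (F.edge i) + s i := by
  classical
  rw [Face.shift]
  congr 1
  rw [Finset.sum_eq_single i]
  · rw [if_pos rfl]
  · intro j _ hj
    rw [if_neg fun h => hj (F.edge_injective h)]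
  · simp

/-- Both half-edges of `e_j` are already in use, in slot `1` at `v_j` and slot `0` at `v_{j+1}`.
Hence the spins `l_i` are never shifted. -/
theorem Face.edge_ne_legEdge (i j : ZMod d) : F.edge j ≠ F.legEdge i := by
  intro h
  have hj1 : F.dartOut j = (F.edge j, decide (F.o j = -1)) := F.dartOut_eq j
  have hj2 : F.dartIn (j + 1) = (F.edge j, decide (F.o j = 1)) := by
    rw [F.dartIn_eq, add_sub_cancel_right]
  have hl : F.dartLeg i = (F.edge j, (F.dartLeg i).2) := by
    rw [h]; rfl
  have n1 : F.dartLeg i ≠ F.dartOut j := dart_ne (by simp)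
  have n2 : F.dartLeg i ≠ F.dartIn (j + 1) := dart_ne (by simp)
  rw [hl, hj1] at n1
  rw [hl, hj2] at n2
  rcases Int.units_eq_one_or (F.o j) with ho | ho <;> rw [ho] at n1 n2 <;>
    cases hb : (F.dartLeg i).2 <;> rw [hb] at n1 n2 <;>
    simp [show ((-1 : ℤˣ) = 1) = False by decide, show ((1 : ℤˣ) = -1) = False by decide] at n1 n2

theorem Face.shift_legEdge [NeZero d] (k : E → ℤ) (s : ZMod d → ℤ) (i : ZMod d) :
    F.shift k s (F.legEdge i) = k (F.legEdge i) := by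
  classical
  rw [Face.shift, Finset.sum_eq_zero, add_zero]
  intro j _
  rw [if_neg (F.edge_ne_legEdge i j)]

theorem Face.shift_shift [NeZero d] (k : E → ℤ) (s t : ZMod d → ℤ) :
    F.shift (F.shift k s) t = F.shift k fun i => s i + t i := by
  classical
  funext e
  simp only [Face.shift]
  rw [add_assoc, ← Finset.sum_add_distrib]
  congr 1
  apply Finset.sum_congr rfl
  intro i _
  split_ifs <;> simp

theorem Face.shift_zero [NeZero d] (k : E → ℤ) : F.shift k (fun _ => 0) = k := by
  classical
  funext e
  simp [Face.shift]

end Bumps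

theorem list_prod_map_range' {M : Type*} [CommMonoid M] (f : ℕ → M) {a n b : ℕ}
    (h : a + n = b + 1) : ((List.range' a n).map f).prod = ∏ i ∈ Finset.Icc a b, f i := by
  rw [← List.prod_toFinset f List.nodup_range']
  congr 1
  ext i
  rw [List.mem_toFinset, List.mem_range'_1, Finset.mem_Icc]
  omega

/-! ### The Hamiltonian on networks. -/

section Action

variable {V E : Type*} {Γ : RibbonGraph V E} {d : ℕ} (F : Face Γ d)

/-- The factor by which the scalar operator at `v_i` multiplies a network that it maps to the
labels `k`. -/
def Face.stepCoef (q : ℝ) (σ : ZMod d → ℤˣ) (k : E → ℤ) (i : ZMod d) : ℝ :=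
  scalarCoef q (σ i) (σ (i - 1)) (k (F.edge i)) (k (F.edge (i - 1))) (k (F.legEdge i))

theorem Face.bumpAt_congr {s t : ZMod d → ℤ} {i : ZMod d} (h : s i = t i)
    (h' : s (i - 1) = t (i - 1)) (x : E × Bool) : F.bumpAt s i x = F.bumpAt t i x := by
  rw [Face.bumpAt, Face.bumpAt, h, h']

theorem Face.bumpAt_add (s t : ZMod d → ℤ) (i : ZMod d) (x : E × Bool) :
    F.bumpAt s i x + F.bumpAt t i x = F.bumpAt (fun i => s i + t i) i x := by
  simp only [Face.bumpAt]
  split_ifs <;> ring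

theorem Face.bumpAt_dartOut_self (s : ZMod d → ℤ) (i : ZMod d) :
    F.bumpAt s i (F.dartOut i) = s i := by
  have h : F.dartOut i ≠ F.dartIn i := dart_ne (by simp)
  rw [Face.bumpAt, if_pos rfl, if_neg h, zero_add]

theorem Face.bumpAt_dartLeg (s : ZMod d → ℤ) (i : ZMod d) : F.bumpAt s i (F.dartLeg i) = 0 := by
  have h : F.dartLeg i ≠ F.dartIn i := dart_ne (by simp)
  have h' : F.dartLeg i ≠ F.dartOut i := dart_ne (by simp)
  rw [Face.bumpAt, if_neg h, if_neg h', zero_add]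

theorem Face.sum_bumpAt_of_mem (s : ZMod d → ℤ) (L : List ℕ)
    (hL : (L.map (Nat.cast : ℕ → ZMod d)).Nodup) {j : ℕ} (h : j ∈ L) (t : Fin 3) :
    (L.map fun i : ℕ => F.bumpAt s i (Γ.dart (F.vert j, t))).sum =
      F.bumpAt s j (Γ.dart (F.vert j, t)) := by
  induction L with
  | nil => simp at h
  | cons a L ih =>
    rw [List.map_cons, List.nodup_cons] at hL
    rw [List.map_cons, List.sum_cons]
    rcases List.mem_cons.mp h with rfl | h
    · rw [F.sum_bumpAt_of_notMem s L j hL.1, add_zero]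
    · rw [ih hL.2 h, F.bumpAt_of_ne s, zero_add]
      rintro hc
      exact hL.1 (hc ▸ List.mem_map_of_mem h)

theorem Face.dartOut_fst (i : ZMod d) : (F.dartOut i).1 = F.edge i := by rw [F.dartOut_eq]

theorem Face.dartIn_fst (i : ZMod d) : (F.dartIn i).1 = F.edge (i - 1) := by rw [F.dartIn_eq]

theorem Face.dartLeg_fst (i : ZMod d) : (F.dartLeg i).1 = F.legEdge i := rfl

/-- The free positions are recorded modulo `d`; representatives in the window `1, …, d` make
membership a question about natural numbers. -/
theorem eq_of_mem_freeSigns [NeZero d] {s : Finset ℕ} {ε η : ZMod d → ℤˣ} (hη : η ∈ freeSigns s ε)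
    (hs : ∀ i ∈ s, 1 ≤ i ∧ i < 1 + d) {i : ℕ} (hi : 1 ≤ i ∧ i < 1 + d) (h : i ∉ s) :
    η i = ε i := by
  classical
  rw [freeSigns, Finset.mem_filter] at hη
  apply hη.2
  rw [Finset.mem_image]
  rintro ⟨j, hj, hji⟩
  have := natCast_zmod_inj (hs j hj).1 (hs j hj).2 hi.1 hi.2 hji
  exact h (this ▸ hj)

theorem eq_of_mem_freeSigns_Ioo [NeZero d] {p : ℕ} {ε η : ZMod d → ℤˣ} (hpd : p ≤ d)
    (hη : η ∈ freeSigns (Finset.Ioo 1 p) ε) {i : ℕ} (h1 : p ≤ i) (h2 : i ≤ d + 1) :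
    η i = ε i := by
  have hs : ∀ i ∈ Finset.Ioo 1 p, 1 ≤ i ∧ i < 1 + d := fun i hi => by
    rw [Finset.mem_Ioo] at hi; omega
  have hd : 0 < d := Nat.pos_of_ne_zero (NeZero.ne d)
  -- Modulo `d`, the position `0` stands for `d` and `d + 1` for `1`, both of which are fixed.
  rcases Nat.eq_zero_or_pos i with rfl | hi
  · have := eq_of_mem_freeSigns (i := d) hη hs (by omega) (by rw [Finset.mem_Ioo]; omega)
    rwa [ZMod.natCast_self, ← Nat.cast_zero] at this
  rcases Nat.lt_or_ge d i with h3 | h3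
  · obtain rfl : i = d + 1 := by omega
    have := eq_of_mem_freeSigns (i := 1) hη hs (by omega) (by simp)
    push_cast at this ⊢
    rwa [ZMod.natCast_self, zero_add]
  · exact eq_of_mem_freeSigns hη hs (by omega) (by rw [Finset.mem_Ioo]; omega)

theorem eq_of_mem_freeSigns_Ioc [NeZero d] {p : ℕ} {ε η : ZMod d → ℤˣ} (hpd : p ≤ d)
    (hη : η ∈ freeSigns (Finset.Ioc p d) ε) {i : ℕ} (h1 : 1 ≤ i) (h2 : i ≤ p) : η i = ε i :=
  eq_of_mem_freeSigns hη (fun i hi => by rw [Finset.mem_Ioc] at hi; omega) (by omega)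
    (by rw [Finset.mem_Ioc]; omega)

variable [Fintype V] [Fintype E] {q : ℝ}

theorem Face.list_prod_scalarOp_splitNet (hq : 0 < q) (hq1 : q ≠ 1) (σ : ZMod d → ℤˣ)
    (L : List ℕ) (hL : (L.map (Nat.cast : ℕ → ZMod d)).Nodup) (K : E × Bool → ℤ) :
    (L.map fun i : ℕ => F.scalarOp q i (σ i) (σ (i - 1))).prod (Γ.splitNet q K) =
      (L.map fun i : ℕ => ((scalarCoef q (σ i) (σ (i - 1)) (K (F.dartOut i) + (σ i : ℤ))
        (K (F.dartIn i) + (σ (i - 1) : ℤ)) (K (F.dartLeg i)) : ℝ) : ℂ)).prod •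
        Γ.splitNet q fun x => K x + (L.map fun i : ℕ => F.bumpAt (fun i => (σ i : ℤ)) i x).sum := by
  refine F.list_prod_splitNet (fun i => (σ i : ℤ)) _ (fun i a b l =>
    ((scalarCoef q (σ i) (σ (i - 1)) (a + (σ i : ℤ)) (b + (σ (i - 1) : ℤ)) l : ℝ) : ℂ)) ?_ L hL K
  intro i K
  rw [F.scalarOp_splitNet hq hq1]
  congr 2
  exact F.bump_eq_add_bumpAt (fun i => (σ i : ℤ)) i K

theorem Face.list_prod_scalarOp_mul_splitNet (hq : 0 < q) (hq1 : q ≠ 1) (σ : ZMod d → ℤˣ)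
    (u : ZMod d → ℤˣ)
    (L : List ℕ) (hL : (L.map (Nat.cast : ℕ → ZMod d)).Nodup) (K : E × Bool → ℤ) :
    (L.map fun i : ℕ => F.scalarOp q i (σ i) (σ (i - 1)) *
        (((u i : ℤ) : ℂ) • invN q (F.dartOut i))).prod (Γ.splitNet q K) =
      (L.map fun i : ℕ => ((((u i : ℤ) : ℝ) * (qnum q (K (F.dartOut i) + 1))⁻¹ *
        scalarCoef q (σ i) (σ (i - 1)) (K (F.dartOut i) + (σ i : ℤ))
        (K (F.dartIn i) + (σ (i - 1) : ℤ)) (K (F.dartLeg i)) : ℝ) : ℂ)).prod •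
        Γ.splitNet q fun x => K x + (L.map fun i : ℕ => F.bumpAt (fun i => (σ i : ℤ)) i x).sum := by
  refine F.list_prod_splitNet (fun i => (σ i : ℤ)) _ (fun i a b l =>
    ((((u i : ℤ) : ℝ) * (qnum q (a + 1))⁻¹ *
      scalarCoef q (σ i) (σ (i - 1)) (a + (σ i : ℤ)) (b + (σ (i - 1) : ℤ)) l : ℝ) : ℂ)) ?_ L hL K
  intro i K
  rw [Module.End.mul_apply, LinearMap.smul_apply, invN_splitNet, map_smul, map_smul,
    F.scalarOp_splitNet hq hq1, smul_smul, smul_smul]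
  congr 1
  · push_cast; ring
  · congr 1
    exact F.bump_eq_add_bumpAt (fun i => (σ i : ℤ)) i K

variable [NeZero d] {p : ℕ} (ε : ZMod d → ℤˣ)

/-- The matrix element between networks of the first part of the Hamiltonian. -/
def Face.leftCoef (q : ℝ) (p : ℕ) (ε η : ZMod d → ℤˣ) (k : E → ℤ) : ℝ :=
  (∏ i ∈ Finset.Icc (p + 1) (d + 1), F.stepCoef q ε k i) * ((qnum q (k (F.edge 1) + 1))⁻¹ *
    ∏ i ∈ Finset.Icc 2 p, (((F.o i * η i : ℤˣ) : ℤ) : ℝ) *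
      (qnum q (k (F.edge i) - ((η i : ℤ) : ℝ) + 1))⁻¹ * F.stepCoef q η k i)

/-- The matrix element between networks of the second part of the Hamiltonian. -/
def Face.rightCoef (q : ℝ) (p : ℕ) (ε η : ZMod d → ℤˣ) (k : E → ℤ) : ℝ :=
  (∏ i ∈ Finset.Icc (p + 1) (d + 1), F.stepCoef q ε k i) *
    ((qnum q (k (F.edge p) - ((ε p : ℤ) : ℝ) + 1))⁻¹ *
    ∏ i ∈ Finset.Icc (p + 1) (d + 1), (((F.o i * η i : ℤˣ) : ℤ) : ℝ) *
      (qnum q (k (F.edge i) - ((ε i : ℤ) : ℝ) + ((η i : ℤ) : ℝ) + 1))⁻¹ *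
        F.stepCoef q (fun i => -η i) (F.shift k fun i => -(ε i : ℤ)) i)

/-- The two products together visit `v_2, …, v_{d+1}` once each. Since `η` agrees with `ε` on `e_p,
…, e_{d+1}`, the second product continues the shift by `η` begun by the first. -/
theorem Face.left_splitNet (hq : 0 < q) (hq1 : q ≠ 1) (hp : 2 ≤ p) (hpd : p ≤ d)
    {η : ZMod d → ℤˣ} (hη : η ∈ freeSigns (Finset.Ioo 1 p) ε) (j : E → ℤ) :
    ((List.range' (p + 1) (d + 1 - p)).map fun i : ℕ => F.scalarOp q i (ε i) (ε (i - 1))).prod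
      (invN q (F.dartIn 2) (((List.range' 2 (p - 1)).map fun i : ℕ =>
          F.scalarOp q i (η i) (η (i - 1)) *
            ((((F.o i * η i : ℤˣ) : ℤ) : ℂ) • invN q (F.dartOut i))).prod
        (Γ.splitNet q fun x => j x.1))) =
      ((F.leftCoef q p ε η (F.shift j fun i => (η i : ℤ)) : ℝ) : ℂ) •
        Γ.splitNet q fun x => F.shift j (fun i => (η i : ℤ)) x.1 := by
  have hηp : ∀ i : ℕ, p ≤ i → i ≤ d + 1 → η i = ε i := fun i h1 h2 =>
    eq_of_mem_freeSigns_Ioo hpd hη h1 h2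
  have hn1 : ((List.range' 2 (p - 1)).map (Nat.cast : ℕ → ZMod d)).Nodup :=
    nodup_map_cast_range' (by omega)
  have hn2 : ((List.range' (p + 1) (d + 1 - p)).map (Nat.cast : ℕ → ZMod d)).Nodup :=
    nodup_map_cast_range' (by omega)
  have happ : List.range' 2 (p - 1) ++ List.range' (p + 1) (d + 1 - p) = List.range' 2 d := by
    rw [show p + 1 = 2 + (p - 1) by omega, List.range'_append_1]
    congr 1
    omega
  rw [F.list_prod_scalarOp_mul_splitNet hq hq1 η (fun i => F.o i * η i) _ hn1, map_smul,
    invN_splitNet, map_smul, map_smul, F.list_prod_scalarOp_splitNet hq hq1 ε _ hn2, smul_smul,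
    smul_smul]
  congr 1
  · rw [list_prod_map_range' _ (show 2 + (p - 1) = p + 1 by omega),
      list_prod_map_range' _ (show p + 1 + (d + 1 - p) = d + 1 + 1 by omega)]
    have h1 : ∀ i ∈ Finset.Icc 2 p, (((((F.o i * η i : ℤˣ) : ℤ) : ℝ) *
        (qnum q (j (F.dartOut i).1 + 1))⁻¹ * scalarCoef q (η i) (η (i - 1))
          (j (F.dartOut i).1 + (η i : ℤ)) (j (F.dartIn i).1 + (η (i - 1) : ℤ))
          (j (F.dartLeg i).1) : ℝ) : ℂ) =
        (((((F.o i * η i : ℤˣ) : ℤ) : ℝ) *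
          (qnum q (F.shift j (fun i => (η i : ℤ)) (F.edge i) - ((η i : ℤ) : ℝ) + 1))⁻¹ *
          F.stepCoef q η (F.shift j fun i => (η i : ℤ)) i : ℝ) : ℂ) := by
      intro i _
      rw [Face.stepCoef, F.shift_edge, F.shift_edge, F.shift_legEdge, F.dartOut_fst, F.dartIn_fst,
        F.dartLeg_fst, Int.cast_add, add_sub_cancel_right]
    have h2 : ∀ i ∈ Finset.Icc (p + 1) (d + 1), ((scalarCoef q (ε i) (ε (i - 1))
        (j (F.dartOut i).1 + ((List.range' 2 (p - 1)).map fun l : ℕ =>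
          F.bumpAt (fun i => (η i : ℤ)) l (F.dartOut i)).sum + (ε i : ℤ))
        (j (F.dartIn i).1 + ((List.range' 2 (p - 1)).map fun l : ℕ =>
          F.bumpAt (fun i => (η i : ℤ)) l (F.dartIn i)).sum + (ε (i - 1) : ℤ))
        (j (F.dartLeg i).1 + ((List.range' 2 (p - 1)).map fun l : ℕ =>
          F.bumpAt (fun i => (η i : ℤ)) l (F.dartLeg i)).sum) : ℝ) : ℂ) =
        ((F.stepCoef q ε (F.shift j fun i => (η i : ℤ)) i : ℝ) : ℂ) := by
      intro i hi
      rw [Finset.mem_Icc] at hi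
      -- The first product has not touched the vertices `v_{p+1}, …, v_{d+1}`, so the second still
      -- sees the initial labels there.
      have hnot : (i : ZMod d) ∉ (List.range' 2 (p - 1)).map (Nat.cast : ℕ → ZMod d) := by
        rw [List.mem_map]
        rintro ⟨l, hl, hli⟩
        rw [List.mem_range'_1] at hl
        have := natCast_zmod_inj (a := 2) hl.1 (by omega) (by omega) (by omega) hli
        omega
      have e := F.sum_bumpAt_of_notMem (fun i => (η i : ℤ)) _ (i : ZMod d) hnot
      have e0 := e 0
      have e1 := e 1
      have e2 := e 2
      change List.sum (List.map (fun l : ℕ => F.bumpAt _ l (F.dartIn i)) _) = 0 at e0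
      change List.sum (List.map (fun l : ℕ => F.bumpAt _ l (F.dartOut i)) _) = 0 at e1
      change List.sum (List.map (fun l : ℕ => F.bumpAt _ l (F.dartLeg i)) _) = 0 at e2
      have hi' := hηp (i - 1) (by omega) (by omega)
      rw [Nat.cast_sub (by omega), Nat.cast_one] at hi'
      rw [e0, e1, e2, add_zero, add_zero, add_zero, Face.stepCoef, F.shift_edge, F.shift_edge,
        F.shift_legEdge, F.dartOut_fst, F.dartIn_fst, F.dartLeg_fst, hηp i (by omega) (by omega), hi']
    -- The end of `e_1` at `v_2` has been shifted by the time the outer `invN` is applied, which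
    -- therefore reads the final label.
    have h3 : j (F.dartIn 2).1 + ((List.range' 2 (p - 1)).map fun l : ℕ =>
        F.bumpAt (fun i => (η i : ℤ)) l (F.dartIn 2)).sum =
        F.shift j (fun i => (η i : ℤ)) (F.edge 1) := by
      have e : List.sum (List.map (fun l : ℕ => F.bumpAt _ l (F.dartIn (2 : ℕ))) _) = _ :=
        F.sum_bumpAt_of_mem (fun i => (η i : ℤ)) _ hn1
        (show 2 ∈ List.range' 2 (p - 1) by rw [List.mem_range'_1]; omega) 0
      change _ = F.bumpAt _ _ (F.dartIn (2 : ℕ)) at e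
      rw [F.bumpAt_dartIn_self, Nat.cast_ofNat] at e
      rw [e, F.shift_edge, F.dartIn_fst, show (2 : ZMod d) - 1 = 1 by ring]
    rw [Finset.prod_congr rfl h1, Finset.prod_congr rfl h2, h3, Face.leftCoef]
    push_cast
    ring
  · congr 1
    funext x
    rw [← F.sum_bumpAt, ← sum_map_range'_eq_sum (fun i => F.bumpAt (fun i => (η i : ℤ)) i x) 2,
      ← happ, List.map_append, List.sum_append, add_assoc]
    congr 2
    apply congrArg
    apply List.map_congr_left
    intro i hi
    rw [List.mem_range'_1] at hi
    apply F.bumpAt_congr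
    · rw [hηp i (by omega) (by omega)]
    · have := hηp (i - 1) (by omega) (by omega)
      rw [Nat.cast_sub (by omega), Nat.cast_one] at this
      rw [this]

/-- Both products act at the same vertices `v_{p+1}, …, v_{d+1}`, first with `-η`, then with `ε`.
The net shift `ε - η` vanishes on `e_1, …, e_p`, and the intermediate labels at these vertices are
the final ones lowered by `ε`. -/
theorem Face.right_splitNet (hq : 0 < q) (hq1 : q ≠ 1) (hp : 2 ≤ p) (hpd : p ≤ d)
    {η : ZMod d → ℤˣ} (hη : η ∈ freeSigns (Finset.Ioc p d) ε) (j : E → ℤ) :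
    ((List.range' (p + 1) (d + 1 - p)).map fun i : ℕ => F.scalarOp q i (ε i) (ε (i - 1))).prod
      (invN q (F.dartIn (p + 1)) (((List.range' (p + 1) (d + 1 - p)).map fun i : ℕ =>
          F.scalarOp q i (-(η i)) (-(η (i - 1))) *
            ((((F.o i * η i : ℤˣ) : ℤ) : ℂ) • invN q (F.dartOut i))).prod
        (Γ.splitNet q fun x => j x.1))) =
      ((F.rightCoef q p ε η (F.shift j fun i => (ε i : ℤ) - (η i : ℤ)) : ℝ) : ℂ) •
        Γ.splitNet q fun x => F.shift j (fun i => (ε i : ℤ) - (η i : ℤ)) x.1 := by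
  have hηp : ∀ i : ℕ, 1 ≤ i → i ≤ p → η i = ε i := fun i h1 h2 =>
    eq_of_mem_freeSigns_Ioc hpd hη h1 h2
  have hn2 : ((List.range' (p + 1) (d + 1 - p)).map (Nat.cast : ℕ → ZMod d)).Nodup :=
    nodup_map_cast_range' (by omega)
  have happ : List.range' 2 (p - 1) ++ List.range' (p + 1) (d + 1 - p) = List.range' 2 d := by
    rw [show p + 1 = 2 + (p - 1) by omega, List.range'_append_1]
    congr 1
    omega
  rw [F.list_prod_scalarOp_mul_splitNet hq hq1 (fun i => -η i) (fun i => F.o i * η i) _ hn2,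
    map_smul, invN_splitNet, map_smul, map_smul, F.list_prod_scalarOp_splitNet hq hq1 ε _ hn2,
    smul_smul, smul_smul]
  congr 1
  · rw [list_prod_map_range' _ (show p + 1 + (d + 1 - p) = d + 1 + 1 by omega),
      list_prod_map_range' _ (show p + 1 + (d + 1 - p) = d + 1 + 1 by omega)]
    have h1 : ∀ i ∈ Finset.Icc (p + 1) (d + 1), (((((F.o i * η i : ℤˣ) : ℤ) : ℝ) *
        (qnum q (j (F.dartOut i).1 + 1))⁻¹ * scalarCoef q (-η i) (-η (i - 1))
          (j (F.dartOut i).1 + ((-η i : ℤˣ) : ℤ)) (j (F.dartIn i).1 + ((-η (i - 1) : ℤˣ) : ℤ))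
          (j (F.dartLeg i).1) : ℝ) : ℂ) =
        (((((F.o i * η i : ℤˣ) : ℤ) : ℝ) *
          (qnum q (F.shift j (fun i => (ε i : ℤ) - (η i : ℤ)) (F.edge i) - ((ε i : ℤ) : ℝ) +
            ((η i : ℤ) : ℝ) + 1))⁻¹ *
          F.stepCoef q (fun i => -η i) (F.shift (F.shift j fun i => (ε i : ℤ) - (η i : ℤ))
            fun i => -(ε i : ℤ)) i : ℝ) : ℂ) := by
      intro i _
      rw [Face.stepCoef, F.shift_shift, F.shift_edge, F.shift_edge, F.shift_edge, F.shift_legEdge,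
        F.dartOut_fst, F.dartIn_fst, F.dartLeg_fst]
      congr 3
      · congr 2
        push_cast
        ring
      · rw [Units.val_neg]; ring
      · rw [Units.val_neg]; ring
    have h2 : ∀ i ∈ Finset.Icc (p + 1) (d + 1), ((scalarCoef q (ε i) (ε (i - 1))
        (j (F.dartOut i).1 + ((List.range' (p + 1) (d + 1 - p)).map fun l : ℕ =>
          F.bumpAt (fun i => ((-η i : ℤˣ) : ℤ)) l (F.dartOut i)).sum + (ε i : ℤ))
        (j (F.dartIn i).1 + ((List.range' (p + 1) (d + 1 - p)).map fun l : ℕ =>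
          F.bumpAt (fun i => ((-η i : ℤˣ) : ℤ)) l (F.dartIn i)).sum + (ε (i - 1) : ℤ))
        (j (F.dartLeg i).1 + ((List.range' (p + 1) (d + 1 - p)).map fun l : ℕ =>
          F.bumpAt (fun i => ((-η i : ℤˣ) : ℤ)) l (F.dartLeg i)).sum) : ℝ) : ℂ) =
        ((F.stepCoef q ε (F.shift j fun i => (ε i : ℤ) - (η i : ℤ)) i : ℝ) : ℂ) := by
      intro i hi
      rw [Finset.mem_Icc] at hi
      have e := F.sum_bumpAt_of_mem (fun i => ((-η i : ℤˣ) : ℤ)) _ hn2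
        (show i ∈ List.range' (p + 1) (d + 1 - p) by rw [List.mem_range'_1]; omega)
      have e0 := e 0
      have e1 := e 1
      have e2 := e 2
      change List.sum (List.map (fun l : ℕ => F.bumpAt _ l (F.dartIn i)) _) =
        F.bumpAt _ i (F.dartIn i) at e0
      change List.sum (List.map (fun l : ℕ => F.bumpAt _ l (F.dartOut i)) _) =
        F.bumpAt _ i (F.dartOut i) at e1
      change List.sum (List.map (fun l : ℕ => F.bumpAt _ l (F.dartLeg i)) _) =
        F.bumpAt _ i (F.dartLeg i) at e2
      rw [e0, e1, e2, F.bumpAt_dartIn_self, F.bumpAt_dartOut_self, F.bumpAt_dartLeg, add_zero,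
        Face.stepCoef, F.shift_edge, F.shift_edge, F.shift_legEdge, F.dartOut_fst, F.dartIn_fst,
        F.dartLeg_fst]
      congr 2 <;> rw [Units.val_neg] <;> ring
    have h3 : ((j (F.dartIn (p + 1)).1 + ((List.range' (p + 1) (d + 1 - p)).map fun l : ℕ =>
        F.bumpAt (fun i => ((-η i : ℤˣ) : ℤ)) l (F.dartIn (p + 1))).sum : ℤ) : ℝ) =
        F.shift j (fun i => (ε i : ℤ) - (η i : ℤ)) (F.edge p) - ((ε p : ℤ) : ℝ) := by
      have e : List.sum (List.map (fun l : ℕ => F.bumpAt _ l (F.dartIn (p + 1 : ℕ))) _) = _ :=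
        F.sum_bumpAt_of_mem (fun i => ((-η i : ℤˣ) : ℤ)) _ hn2
        (show p + 1 ∈ List.range' (p + 1) (d + 1 - p) by rw [List.mem_range'_1]; omega) 0
      change _ = F.bumpAt _ _ (F.dartIn (p + 1 : ℕ)) at e
      rw [F.bumpAt_dartIn_self, Nat.cast_add_one, add_sub_cancel_right] at e
      rw [e, F.shift_edge, F.dartIn_fst, add_sub_cancel_right, Units.val_neg]
      push_cast
      ring
    rw [Finset.prod_congr rfl h1, Finset.prod_congr rfl h2, h3, Face.rightCoef]
    push_cast
    ring
  · congr 1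
    funext x
    rw [← F.sum_bumpAt,
      ← sum_map_range'_eq_sum (fun i => F.bumpAt (fun i => (ε i : ℤ) - (η i : ℤ)) i x) 2,
      ← happ, List.map_append, List.sum_append, add_assoc, ← List.sum_map_add]
    congr 1
    have hz : ((List.range' 2 (p - 1)).map fun i : ℕ =>
        F.bumpAt (fun i => (ε i : ℤ) - (η i : ℤ)) i x).sum = 0 := by
      apply List.sum_eq_zero
      intro y hy
      rw [List.mem_map] at hy
      obtain ⟨i, hi, rfl⟩ := hy
      rw [List.mem_range'_1] at hi
      have e1 := hηp i (by omega) (by omega)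
      have e2 := hηp (i - 1) (by omega) (by omega)
      rw [Nat.cast_sub (by omega), Nat.cast_one] at e2
      rw [Face.bumpAt, e1, e2, sub_self, sub_self, ite_self, ite_self, add_zero]
    rw [hz, zero_add]
    apply congrArg
    apply List.map_congr_left
    intro i _
    rw [F.bumpAt_add]
    apply F.bumpAt_congr <;> rw [Units.val_neg] <;> ring

/-- The Hamiltonian maps a network to a combination of networks. -/
theorem Face.hamiltonian_splitNet (hq : 0 < q) (hq1 : q ≠ 1) (hp : 2 ≤ p) (hpd : p ≤ d)
    (j : E → ℤ) :
    F.hamiltonian q p ε (Γ.splitNet q fun x => j x.1) =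
      ∑ η ∈ freeSigns (Finset.Ioo 1 p) ε,
        ((F.leftCoef q p ε η (F.shift j fun i => (η i : ℤ)) : ℝ) : ℂ) •
          Γ.splitNet q (fun x => F.shift j (fun i => (η i : ℤ)) x.1) +
      ((-1 : ℂ) ^ (d - p) * (((ε 1 * ε p : ℤˣ) : ℤ) : ℂ)) •
        ∑ η ∈ freeSigns (Finset.Ioc p d) ε,
          ((F.rightCoef q p ε η (F.shift j fun i => (ε i : ℤ) - (η i : ℤ)) : ℝ) : ℂ) •
            Γ.splitNet q fun x => F.shift j (fun i => (ε i : ℤ) - (η i : ℤ)) x.1 := by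
  rw [Face.hamiltonian, Face.preHamiltonian, Module.End.mul_apply, LinearMap.add_apply, map_add,
    LinearMap.smul_apply, map_smul, Module.End.mul_apply, Module.End.mul_apply,
    LinearMap.sum_apply, LinearMap.sum_apply, map_sum, map_sum, map_sum, map_sum]
  congr 1
  · exact Finset.sum_congr rfl fun η hη => F.left_splitNet ε hq hq1 hp hpd hη j
  · congr 1
    exact Finset.sum_congr rfl fun η hη => F.right_splitNet ε hq hq1 hp hpd hη j

end Action

/-! ### Non-vanishing of the intertwiners. -/

theorem qfactInv_natCast_ne_zero {q : ℝ} (hq : 0 < q) (hq1 : q ≠ 1) {n : ℤ} (h : 0 ≤ n) :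
    qfactInv q n ≠ 0 := by
  rw [qfactInv, if_pos h]
  exact inv_ne_zero (qfact_pos hq hq1 _).ne'

theorem triCoeff_pos {q : ℝ} (hq : 0 < q) (hq1 : q ≠ 1) (a b c : ℤ) : 0 < triCoeff q a b c := by
  have h := qfact_pos hq hq1
  exact Real.sqrt_pos.mpr (div_pos (mul_pos (mul_pos (h _) (h _)) (h _)) (h _))

/-- At `m₁ = j₁` and `m₃ = j₃` the factor `1/[j₁-m₁-z]!` leaves only the term `z = 0`, whose
factorial arguments are non-negative by the triangle inequalities. -/
theorem cg_highest_ne_zero {q : ℝ} (hq : 0 < q) (hq1 : q ≠ 1) {a b c : ℤ} (h : Triad a b c) :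
    cg q (a.toNat, 0) (((c - a + b) / 2).toNat, ((a + b - c) / 2).toNat) (c.toNat, 0) ≠ 0 := by
  obtain ⟨ha, hb, hc, ⟨t, ht⟩, h1, h2, h3⟩ := id h
  have da : dspin (a.toNat, 0) = a := by simp [dspin]; omega
  have db : dspin (((c - a + b) / 2).toNat, ((a + b - c) / 2).toNat) = b := by
    simp only [dspin]; omega
  have dc : dspin (c.toNat, 0) = c := by simp [dspin]; omega
  rw [cg, if_pos ⟨by rw [da, db, dc]; exact h, by simp only [dmag]; omega⟩, da, db, dc]
  have hf := qfact_pos hq hq1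
  apply mul_ne_zero
  · apply mul_ne_zero
    · exact mul_ne_zero (Real.rpow_pos_of_pos hq _).ne' (triCoeff_pos hq hq1 _ _ _).ne'
    · have hn : 0 < qnum q ((c : ℝ) + 1) := qnum_pos hq hq1 (by positivity)
      have := hf a.toNat
      have := hf 0
      have := hf ((c - a + b) / 2).toNat
      have := hf ((a + b - c) / 2).toNat
      have := hf c.toNat
      apply (Real.sqrt_pos.mpr _).ne'
      positivity
  · rw [Finset.sum_eq_single 0]
    · have hi := @qfactInv_natCast_ne_zero q hq hq1
      refine mul_ne_zero (mul_ne_zero (by simp) (Real.rpow_pos_of_pos hq _).ne') ?_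
      refine mul_ne_zero (mul_ne_zero (mul_ne_zero (mul_ne_zero (mul_ne_zero ?_ ?_) ?_) ?_) ?_) ?_
      all_goals apply hi
      all_goals omega
    · intro z _ hz
      rw [qfactInv_of_neg q (n := ((0 : ℕ) : ℤ) - z) (by omega)]
      ring
    · simp

theorem dualCoeff_ne_zero {q : ℝ} (hq : 0 < q) (s : Fin 3) (x : ℕ × ℕ) : dualCoeff q s x ≠ 0 :=
  mul_ne_zero (pow_ne_zero _ (by norm_num)) (Real.rpow_pos_of_pos hq _).ne'

theorem cgSinglet_ne_zero {q : ℝ} (hq : 0 < q) (hq1 : q ≠ 1) (x : ℕ × ℕ) :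
    cgSinglet q x ≠ 0 := by
  have h : 0 < qnum q ((dspin x : ℝ) + 1) := by
    apply qnum_pos hq hq1
    unfold dspin
    push_cast
    positivity
  exact div_ne_zero (mul_ne_zero (pow_ne_zero _ (by norm_num)) (Real.rpow_pos_of_pos hq _).ne')
    (Real.sqrt_pos.mpr h).ne'

theorem exists_intertwiner_ne_zero {q : ℝ} (hq : 0 < q) (hq1 : q ≠ 1) {k : Fin 3 → ℤ}
    (h : Triad (k 0) (k 1) (k 2)) (inc : Fin 3 → Bool) :
    ∃ n : Fin 3 → ℕ × ℕ, (∀ s, dspin (n s) = k s) ∧ intertwiner q inc n ≠ 0 := by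
  -- Occupation numbers for all legs incoming; the third pair is reversed because the intertwiner
  -- evaluates its Clebsch-Gordan coefficient at `-m₃`. Outgoing legs are reversed once more in the
  -- witness.
  set Y : Fin 3 → ℕ × ℕ := ![((k 0).toNat, 0),
    (((k 2 - k 0 + k 1) / 2).toNat, ((k 0 + k 1 - k 2) / 2).toNat), (0, (k 2).toNat)] with hY
  obtain ⟨ha, hb, hc, ⟨t, ht⟩, h1, h2, h3⟩ := id h
  have hd : ∀ s, dspin (Y s) = k s := by
    intro s
    fin_cases s <;> simp [hY, dspin] <;> omega
  have hy : (fun s => if inc s then (if inc s then Y s else (Y s).swap) else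
      (if inc s then Y s else (Y s).swap).swap) = Y := by
    funext s
    split_ifs <;> simp
  refine ⟨fun s => if inc s then Y s else (Y s).swap, fun s => ?_, ?_⟩
  · dsimp only
    split_ifs
    · exact hd s
    · rw [dspin_swap, hd]
  · rw [intertwiner]
    change _ * (cg q ((fun s => if inc s then (if inc s then Y s else (Y s).swap) else
      (if inc s then Y s else (Y s).swap).swap) 0) ((fun s => if inc s then (if inc s then Y s else
      (Y s).swap) else (if inc s then Y s else (Y s).swap).swap) 1) ((fun s => if inc s then
      (if inc s then Y s else (Y s).swap) else
      (if inc s then Y s else (Y s).swap).swap) 2).swap * _) ≠ 0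
    rw [hy]
    refine mul_ne_zero (Finset.prod_ne_zero_iff.mpr fun s _ => ?_) (mul_ne_zero ?_ ?_)
    · split_ifs
      · exact one_ne_zero
      · exact dualCoeff_ne_zero hq _ _
    · exact cg_highest_ne_zero hq hq1 h
    · exact cgSinglet_ne_zero hq hq1 _

/-! ### Orthogonality of networks and matrix elements. -/

section Pairing

variable {V E : Type*}

theorem braket_add (φ χ χ' : BigFock E) : braket φ (χ + χ') = braket φ χ + braket φ χ' := by
  simp only [braket, Finsupp.sum, Finsupp.add_apply, mul_add, Finset.sum_add_distrib]

theorem braket_smul (φ χ : BigFock E) (c : ℂ) : braket φ (c • χ) = c * braket φ χ := by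
  simp only [braket, Finsupp.sum, Finsupp.smul_apply, smul_eq_mul, Finset.mul_sum]
  exact Finset.sum_congr rfl fun _ _ => by ring

theorem braket_sum {ι : Type*} (s : Finset ι) (φ : BigFock E) (χ : ι → BigFock E) :
    braket φ (∑ i ∈ s, χ i) = ∑ i ∈ s, braket φ (χ i) := by
  simp only [braket, Finsupp.sum, Finsupp.finsetSum_apply, Finset.mul_sum]
  exact Finset.sum_comm

variable {Γ : RibbonGraph V E} {q : ℝ}
variable {d : ℕ} [NeZero d] (F : Face Γ d)

theorem Face.eq_shift_neg_of_shift_eq {j k : E → ℤ} {s : ZMod d → ℤ} (h : F.shift j s = k) :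
    j = F.shift k fun i => -s i := by
  rw [← h, F.shift_shift]
  simp only [add_neg_cancel]
  exact (F.shift_zero j).symm

theorem Face.shift_shift_neg (k : E → ℤ) (s : ZMod d → ℤ) :
    F.shift (F.shift k fun i => -s i) s = k := by
  rw [F.shift_shift]
  simp only [neg_add_cancel]
  exact F.shift_zero k

variable [Fintype V] [Fintype E]

/-- The supports are disjoint, since a basis vector determines the spin on every half-edge. -/
theorem braket_splitNet_of_ne {K K' : E × Bool → ℤ} (h : K ≠ K') :
    braket (Γ.splitNet q K) (Γ.splitNet q K') = 0 := by
  apply Finset.sum_eq_zero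
  intro m _
  by_contra hc
  dsimp only at hc
  rw [← ne_eq, mul_ne_zero_iff, Γ.splitNet_apply, Γ.splitNet_apply, Complex.conj_ofReal,
    Complex.ofReal_ne_zero, Complex.ofReal_ne_zero] at hc
  apply h
  funext x
  rw [← dspin_eq_of_prod_vertexAmp_ne_zero hc.1 x, dspin_eq_of_prod_vertexAmp_ne_zero hc.2 x]

/-- The components are real, so the norm is a sum of squares. One component is non-zero: the two
ends of an edge carry separate basis vectors, so good vectors can be chosen vertex by vertex. -/
theorem braket_splitNet_self_ne_zero (hq : 0 < q) (hq1 : q ≠ 1) {k : E → ℤ}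
    (h : Γ.Admissible k) :
    braket (Γ.splitNet q fun x => k x.1) (Γ.splitNet q fun x => k x.1) ≠ 0 := by
  choose n hn hn' using fun v => exists_intertwiner_ne_zero hq hq1
    (k := fun s => k (Γ.dart (v, s)).1) (h v) (fun s => (Γ.dart (v, s)).2)
  set m : E × Bool → ℕ × ℕ := fun x => n (Γ.dart.symm x).1 (Γ.dart.symm x).2 with hm
  have hmd : ∀ v s, m (Γ.dart (v, s)) = n v s := fun v s => by
    simp only [hm, Equiv.symm_apply_apply]
  have hne : ∏ v, vertexAmp Γ q (fun x => k x.1) v m ≠ 0 := by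
    refine Finset.prod_ne_zero_iff.mpr fun v _ => ?_
    rw [vertexAmp, if_pos fun s => by rw [hmd]; exact hn v s]
    simp only [hmd]
    exact hn' v
  have hre : braket (Γ.splitNet q fun x => k x.1) (Γ.splitNet q fun x => k x.1) =
      ((∑ n ∈ (Γ.splitNet q fun x => k x.1).support,
        (∏ v, vertexAmp Γ q (fun x => k x.1) v n) ^ 2 : ℝ) : ℂ) := by
    rw [braket, Finsupp.sum, Complex.ofReal_sum]
    refine Finset.sum_congr rfl fun n _ => ?_
    rw [Γ.splitNet_apply, Complex.conj_ofReal, ← Complex.ofReal_mul, sq]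
  rw [hre, Complex.ofReal_ne_zero]
  apply ne_of_gt
  apply Finset.sum_pos' (fun n _ => sq_nonneg _)
  refine ⟨m, ?_, by positivity⟩
  rw [Finsupp.mem_support_iff, Γ.splitNet_apply, Complex.ofReal_ne_zero]
  exact hne

theorem Face.braket_splitNet_shift_eq_zero {j k : E → ℤ} {s : ZMod d → ℤ}
    (h : j ≠ F.shift k fun i => -s i) :
    braket (Γ.splitNet q fun x => k x.1) (Γ.splitNet q fun x => F.shift j s x.1) = 0 := by
  apply braket_splitNet_of_ne
  intro h'
  apply h
  apply F.eq_shift_neg_of_shift_eq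
  funext e
  exact (congrFun h' (e, true)).symm

/-- Shifts are invertible, so by orthogonality at most one label contributes. This makes the
`finsum` over labels additive, without any condition on `ψ`. -/
theorem Face.hasFiniteSupport_braket_shift (ψ : Γ.Label → ℂ) (C : (E → ℤ) → ℂ) (k : E → ℤ)
    (s : ZMod d → ℤ) :
    (Function.support fun j : Γ.Label => ψ j * (C (F.shift j.1 s) *
      braket (Γ.splitNet q fun x => k x.1) (Γ.splitNet q fun x => F.shift j.1 s x.1))).Finite := by
  apply Set.Subsingleton.finite
  intro j hj j' hj'
  have key : ∀ i : Γ.Label, i ∈ (Function.support fun j : Γ.Label => ψ j * (C (F.shift j.1 s) *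
      braket (Γ.splitNet q fun x => k x.1) (Γ.splitNet q fun x => F.shift j.1 s x.1))) →
      i.1 = F.shift k fun i => -s i := by
    intro i hi
    by_contra hc
    apply hi
    dsimp only
    rw [F.braket_splitNet_shift_eq_zero hc, mul_zero, mul_zero]
  exact Subtype.ext ((key j hj).trans (key j' hj').symm)

/-- The contributing label is `k` shifted back by `s`; if it is not admissible, the sum is empty and
the convention for `coeff` agrees. -/
theorem Face.finsum_braket_shift (ψ : Γ.Label → ℂ) (C : (E → ℤ) → ℂ) (k : E → ℤ)
    (s : ZMod d → ℤ) :
    ∑ᶠ j : Γ.Label, ψ j * (C (F.shift j.1 s) *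
      braket (Γ.splitNet q fun x => k x.1) (Γ.splitNet q fun x => F.shift j.1 s x.1)) =
    C k * Γ.coeff ψ (F.shift k fun i => -s i) *
      braket (Γ.splitNet q fun x => k x.1) (Γ.splitNet q fun x => k x.1) := by
  by_cases h : Γ.Admissible (F.shift k fun i => -s i)
  · rw [finsum_eq_single _ ⟨_, h⟩, RibbonGraph.coeff, dif_pos h]
    · simp only [F.shift_shift_neg]
      ring
    · intro j hj
      rw [F.braket_splitNet_shift_eq_zero fun hc => hj (Subtype.ext hc), mul_zero, mul_zero]
  · rw [RibbonGraph.coeff, dif_neg h, mul_zero, zero_mul]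
    apply finsum_eq_zero_of_forall_eq_zero
    intro j
    rw [F.braket_splitNet_shift_eq_zero fun hc => h (hc ▸ j.2), mul_zero, mul_zero]

/-- The matrix elements of the Hamiltonian in the spin network basis. -/
theorem Face.matrixElement_hamiltonian (hq : 0 < q) (hq1 : q ≠ 1) {p : ℕ} (hp : 2 ≤ p)
    (hpd : p ≤ d) (ε : ZMod d → ℤˣ) (k : Γ.Label) (ψ : Γ.Label → ℂ) :
    Γ.matrixElement q (F.hamiltonian q p ε) k ψ =
      (∑ η ∈ freeSigns (Finset.Ioo 1 p) ε, ((F.leftCoef q p ε η k.1 : ℝ) : ℂ) *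
          Γ.coeff ψ (F.shift k.1 fun i => -(η i : ℤ)) +
        (-1 : ℂ) ^ (d - p) * (((ε 1 * ε p : ℤˣ) : ℤ) : ℂ) *
          ∑ η ∈ freeSigns (Finset.Ioc p d) ε, ((F.rightCoef q p ε η k.1 : ℝ) : ℂ) *
            Γ.coeff ψ (F.shift k.1 fun i => -(ε i : ℤ) + (η i : ℤ))) *
        braket (Γ.splitNet q fun x => k.1 x.1) (Γ.splitNet q fun x => k.1 x.1) := by
  set N := braket (Γ.splitNet q fun x => k.1 x.1) (Γ.splitNet q fun x => k.1 x.1) with hN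
  set c : ℂ := (-1 : ℂ) ^ (d - p) * (((ε 1 * ε p : ℤˣ) : ℤ) : ℂ) with hc
  have hj : ∀ j : Γ.Label, ψ j * braket (Γ.net q k.1) (F.hamiltonian q p ε (Γ.net q j.1)) =
      ∑ η ∈ freeSigns (Finset.Ioo 1 p) ε, ψ j *
        (((F.leftCoef q p ε η (F.shift j.1 fun i => (η i : ℤ)) : ℝ) : ℂ) *
          braket (Γ.splitNet q fun x => k.1 x.1)
            (Γ.splitNet q fun x => F.shift j.1 (fun i => (η i : ℤ)) x.1)) +
      ∑ η ∈ freeSigns (Finset.Ioc p d) ε, ψ j *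
        ((c * ((F.rightCoef q p ε η (F.shift j.1 fun i => (ε i : ℤ) - (η i : ℤ)) : ℝ) : ℂ)) *
          braket (Γ.splitNet q fun x => k.1 x.1)
            (Γ.splitNet q fun x => F.shift j.1 (fun i => (ε i : ℤ) - (η i : ℤ)) x.1)) := by
    intro j
    rw [Γ.net_eq_splitNet q k.2, Γ.net_eq_splitNet q j.2, F.hamiltonian_splitNet ε hq hq1 hp hpd,
      braket_add, braket_smul, braket_sum, braket_sum, ← hc, mul_add, Finset.mul_sum,
      Finset.mul_sum, Finset.mul_sum]
    simp only [braket_smul]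
    congr 1
    exact Finset.sum_congr rfl fun _ _ => by ring
  have hfin : ∀ (C : (ZMod d → ℤˣ) → (E → ℤ) → ℂ) (s : (ZMod d → ℤˣ) → ZMod d → ℤ)
      (S : Finset (ZMod d → ℤˣ)), Function.HasFiniteSupport fun j : Γ.Label => ∑ η ∈ S, ψ j *
        (C η (F.shift j.1 (s η)) * braket (Γ.splitNet q fun x => k.1 x.1)
          (Γ.splitNet q fun x => F.shift j.1 (s η) x.1)) := by
    classical
    intro C s S
    refine (S.finite_toSet.biUnion fun η _ =>
      F.hasFiniteSupport_braket_shift (q := q) ψ (C η) k.1 (s η)).subset ?_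
    intro j hj
    obtain ⟨η, hη, h⟩ := Finset.exists_ne_zero_of_sum_ne_zero hj
    exact Set.mem_biUnion (Finset.mem_coe.mpr hη) h
  have hL := hfin (fun η k' => ((F.leftCoef q p ε η k' : ℝ) : ℂ)) (fun η i => (η i : ℤ))
    (freeSigns (Finset.Ioo 1 p) ε)
  have hR := hfin (fun η k' => c * ((F.rightCoef q p ε η k' : ℝ) : ℂ))
    (fun η i => (ε i : ℤ) - (η i : ℤ)) (freeSigns (Finset.Ioc p d) ε)
  rw [RibbonGraph.matrixElement, finsum_congr hj, finsum_add_distrib hL hR, finsum_sum_comm,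
    finsum_sum_comm, add_mul, Finset.sum_mul, mul_assoc c, Finset.sum_mul, Finset.mul_sum]
  · congr 1
    · refine Finset.sum_congr rfl fun η _ => ?_
      exact F.finsum_braket_shift ψ (fun k' => ((F.leftCoef q p ε η k' : ℝ) : ℂ)) k.1 _
    · refine Finset.sum_congr rfl fun η _ => ?_
      rw [F.finsum_braket_shift ψ (fun k' => c * ((F.rightCoef q p ε η k' : ℝ) : ℂ)) k.1
        fun i => (ε i : ℤ) - (η i : ℤ)]
      have e : (fun i => -((ε i : ℤ) - (η i : ℤ))) = fun i => -(ε i : ℤ) + (η i : ℤ) := by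
        funext i
        ring
      rw [e]
      ring
  · intro η _
    exact F.hasFiniteSupport_braket_shift ψ (fun k' => c * ((F.rightCoef q p ε η k' : ℝ) : ℂ)) k.1 _
  · intro η _
    exact F.hasFiniteSupport_braket_shift ψ (fun k' => ((F.leftCoef q p ε η k' : ℝ) : ℂ)) k.1 _

end Pairing

/-! ### Non-vanishing of the scalar coefficients, and telescoping of the normalizations. -/

theorem scalarCoef_ne_zero {q : ℝ} (hq : 0 < q) (hq1 : q ≠ 1) {ε ε' : ℤˣ} {k k' l : ℤ}
    (h : Triad k k' l) (h' : Triad (k' - (ε' : ℤ)) (k - (ε : ℤ)) l) :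
    scalarCoef q ε ε' k k' l ≠ 0 := by
  have hs : ∀ x y : ℕ, Real.sqrt (qnum q (x + 1) * qnum q (y + 1)) ≠ 0 := fun x y =>
    (Real.sqrt_pos.mpr (mul_pos (qnum_pos hq hq1 (by positivity))
      (qnum_pos hq hq1 (by positivity)))).ne'
  have hs' : ∀ x y : ℕ, Real.sqrt (qnum q (x + 1) * qnum q (y + 2)) ≠ 0 := fun x y =>
    (Real.sqrt_pos.mpr (mul_pos (qnum_pos hq hq1 (by positivity))
      (qnum_pos hq hq1 (by positivity)))).ne'
  rcases Int.units_eq_one_or ε with rfl | rfl <;> rcases Int.units_eq_one_or ε' with rfl | rfl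
  · obtain ⟨a, b, c, h1, h2, h3⟩ := h'.exists_lines
    simp only [Units.val_one] at h1 h2
    obtain rfl : k = a + c + 1 := by omega
    obtain rfl : k' = a + b + 1 := by omega
    subst h3
    rw [scalarCoef_raise_raise hq hq1]
    exact_mod_cast hs' a (a + b + c)
  · obtain ⟨a, b, c, h1, h2, h3⟩ := h'.exists_lines
    simp only [Units.val_one, Units.val_neg] at h1 h2
    -- The line comes from a triangle inequality for the shifted spins: `k ≤ k' + l` would fail at
    -- `b = 0`.
    obtain ⟨b, rfl⟩ : ∃ b0, b = b0 + 1 := ⟨b - 1, by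
      have := h.2.2.2.2.1
      omega⟩
    obtain rfl : k = a + c + 1 := by omega
    obtain rfl : k' = a + b := by omega
    obtain rfl : l = b + c + 1 := by omega
    rw [scalarCoef_raise_lower hq hq1]
    exact hs b c
  · obtain ⟨a, b, c, h1, h2, h3⟩ := h'.exists_lines
    simp only [Units.val_one, Units.val_neg] at h1 h2
    obtain ⟨c, rfl⟩ : ∃ c0, c = c0 + 1 := ⟨c - 1, by
      have := h.2.2.2.2.2.1
      omega⟩
    obtain rfl : k = a + c := by omega
    obtain rfl : k' = a + b + 1 := by omega
    obtain rfl : l = b + c + 1 := by omega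
    rw [scalarCoef_lower_raise hq hq1]
    exact hs b c
  · obtain ⟨a, b, c, rfl, rfl, rfl⟩ := h.swap.exists_lines
    rw [scalarCoef_lower_lower hq hq1]
    exact neg_ne_zero.mpr (by exact_mod_cast hs' a (a + b + c))

theorem prod_Icc_mul_div (f g r : ℕ → ℝ) {a b : ℕ} (h : a ≤ b) (hr : ∀ i ∈ Finset.Icc a b, r i ≠ 0)
    (hf : ∀ i ∈ Finset.Icc (a + 1) b, f i = g i * (r (i - 1) / r i)) :
    ∏ i ∈ Finset.Icc (a + 1) b, f i = (∏ i ∈ Finset.Icc (a + 1) b, g i) * (r a / r b) := by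
  induction b, h using Nat.le_induction with
  | base => simp [hr a (by simp)]
  | succ b hab ih =>
    have hb := hr b (by rw [Finset.mem_Icc]; omega)
    rw [Finset.prod_Icc_succ_top (by omega), Finset.prod_Icc_succ_top (by omega),
      ih (fun i hi => hr i (Finset.Icc_subset_Icc_right (by omega) hi))
        (fun i hi => hf i (Finset.Icc_subset_Icc_right (by omega) hi)),
      hf (b + 1) (by rw [Finset.mem_Icc]; omega), Nat.add_sub_cancel]
    field_simp

section Rescaling

variable {V E : Type*} {Γ : RibbonGraph V E} {d : ℕ} (F : Face Γ d)

/-- The normalization of the spin network states attached to the edge `e_i`. -/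
def Face.edgeNorm (q : ℝ) (σ : ZMod d → ℤˣ) (k : E → ℤ) (i : ZMod d) : ℝ :=
  Real.sqrt (qnum q (k (F.edge i) + 1) * qnum q (k (F.edge i) - ((σ i : ℤ) : ℝ) + 1))

variable {q : ℝ}

theorem Face.edgeNorm_pos (hq : 0 < q) (hq1 : q ≠ 1) {σ : ZMod d → ℤˣ} {k : E → ℤ} {i : ZMod d}
    (h : 0 ≤ k (F.edge i)) (h' : 0 ≤ k (F.edge i) - (σ i : ℤ)) : 0 < F.edgeNorm q σ k i := by
  have h1 : (0 : ℝ) ≤ k (F.edge i) := by exact_mod_cast h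
  have h2 : (0 : ℝ) ≤ k (F.edge i) - ((σ i : ℤ) : ℝ) := by exact_mod_cast h'
  exact Real.sqrt_pos.mpr
    (mul_pos (qnum_pos hq hq1 (by linarith)) (qnum_pos hq hq1 (by linarith)))

theorem Face.edgeNorm_sq (hq : 0 < q) (hq1 : q ≠ 1) {σ : ZMod d → ℤˣ} {k : E → ℤ} {i : ZMod d}
    (h : 0 ≤ k (F.edge i)) (h' : 0 ≤ k (F.edge i) - (σ i : ℤ)) :
    F.edgeNorm q σ k i * F.edgeNorm q σ k i =
      qnum q (k (F.edge i) + 1) * qnum q (k (F.edge i) - ((σ i : ℤ) : ℝ) + 1) := by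
  have h1 : (0 : ℝ) ≤ k (F.edge i) := by exact_mod_cast h
  have h2 : (0 : ℝ) ≤ k (F.edge i) - ((σ i : ℤ) : ℝ) := by exact_mod_cast h'
  exact Real.mul_self_sqrt
    (mul_nonneg (qnum_nonneg hq hq1 (by linarith)) (qnum_nonneg hq hq1 (by linarith)))

/-- The square of `edgeNorm` at `e_i` is the product of the dimensions before and after the shift,
so dividing by the former turns that norm into the latter divided by the norm. -/
theorem Face.inv_qnum_mul_stepCoef (hq : 0 < q) (hq1 : q ≠ 1) {σ : ZMod d → ℤˣ} {k : E → ℤ}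
    {i : ZMod d} (h : 0 ≤ k (F.edge i)) (h' : 0 ≤ k (F.edge i) - (σ i : ℤ)) :
    (qnum q (k (F.edge i) - ((σ i : ℤ) : ℝ) + 1))⁻¹ * F.stepCoef q σ k i =
      qnum q (k (F.edge i) + 1) *
        sgn ((k (F.edge i) + k (F.edge (i - 1)) + k (F.legEdge i)) / 2) *
        sixj q (k (F.edge i)) (k (F.edge i) - (σ i : ℤ)) 1 (k (F.edge (i - 1)) - (σ (i - 1) : ℤ))
          (k (F.edge (i - 1))) (k (F.legEdge i)) *
        (F.edgeNorm q σ k (i - 1) / F.edgeNorm q σ k i) := by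
  have hsq := F.edgeNorm_sq hq hq1 h h'
  have hpos := F.edgeNorm_pos hq hq1 h h'
  have h2 : (0 : ℝ) ≤ k (F.edge i) - ((σ i : ℤ) : ℝ) := by exact_mod_cast h'
  have hx : 0 < qnum q (k (F.edge i) - ((σ i : ℤ) : ℝ) + 1) := qnum_pos hq hq1 (by linarith)
  rw [Face.stepCoef, scalarCoef]
  change _ * (_ * (F.edgeNorm q σ k i * F.edgeNorm q σ k (i - 1))) = _
  field_simp
  linear_combination (sgn ((k (F.edge i) + k (F.edge (i - 1)) + k (F.legEdge i)) / 2) *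
    F.edgeNorm q σ k (i - 1) *
    sixj q (k (F.edge i)) (k (F.edge i) - (σ i : ℤ)) 1 (k (F.edge (i - 1)) - (σ (i - 1) : ℤ))
      (k (F.edge (i - 1))) (k (F.legEdge i))) * hsq

theorem Face.triad_of_admissible {k : E → ℤ} (h : Γ.Admissible k) (i : ZMod d) :
    Triad (k (F.edge (i - 1))) (k (F.edge i)) (k (F.legEdge i)) := by
  have := h (F.vert i)
  rwa [F.dart_zero, F.dart_one] at this

theorem cast_pred {i : ℕ} (h : 1 ≤ i) : ((i - 1 : ℕ) : ZMod d) = (i : ZMod d) - 1 := by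
  rw [Nat.cast_sub h, Nat.cast_one]

variable [NeZero d] {p : ℕ} {ε η : ZMod d → ℤˣ}

/-- The coefficients are compared only after multiplication by `coeff`: where it does not vanish,
the lowered labels are non-negative, all norms are positive and their ratios telescope. The
extracted factor depends on `ε` only, since `η` is fixed on `e_1` and `e_p`. -/
theorem Face.leftCoef_mul_coeff (hq : 0 < q) (hq1 : q ≠ 1) (hp : 2 ≤ p) (hpd : p ≤ d)
    {k : E → ℤ} (hk : Γ.Admissible k) (hη : η ∈ freeSigns (Finset.Ioo 1 p) ε)
    (ψ : Γ.Label → ℂ) :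
    ((F.leftCoef q p ε η k : ℝ) : ℂ) * Γ.coeff ψ (F.shift k fun i => -(η i : ℤ)) =
      (((∏ i ∈ Finset.Icc (p + 1) (d + 1), F.stepCoef q ε k i) *
        ((qnum q (k (F.edge 1) + 1))⁻¹ * (F.edgeNorm q ε k 1 / F.edgeNorm q ε k p)) : ℝ) : ℂ) *
        (((∏ i ∈ Finset.Icc 2 p, coeffA q (F.o i) (η i) (η (i - 1))
          (k (F.edge i)) (k (F.edge (i - 1))) (k (F.legEdge i)) : ℝ) : ℂ) *
        Γ.coeff ψ (F.shift k fun i => -(η i : ℤ))) := by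
  by_cases h : Γ.Admissible (F.shift k fun i => -(η i : ℤ))
  swap
  · rw [RibbonGraph.coeff, dif_neg h, mul_zero, mul_zero, mul_zero]
  have hpos : ∀ i, 0 ≤ k (F.edge i) - (η i : ℤ) := fun i => by
    have := h.nonneg (F.edge i)
    rwa [F.shift_edge] at this
  have hprod := prod_Icc_mul_div (a := 1) (b := p) (fun i : ℕ => (((F.o i * η i : ℤˣ) : ℤ) : ℝ) *
      (qnum q (k (F.edge i) - ((η i : ℤ) : ℝ) + 1))⁻¹ * F.stepCoef q η k i)
    (fun i : ℕ => coeffA q (F.o i) (η i) (η (i - 1))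
          (k (F.edge i)) (k (F.edge (i - 1))) (k (F.legEdge i)))
    (fun i : ℕ => F.edgeNorm q η k i) (by omega)
    (fun i _ => (F.edgeNorm_pos hq hq1 (hk.nonneg _) (hpos i)).ne') (fun i hi => by
      rw [Finset.mem_Icc] at hi
      rw [mul_assoc, F.inv_qnum_mul_stepCoef hq hq1 (hk.nonneg _) (hpos i), coeffA,
        cast_pred (by omega)]
      ring)
  have e1 : η 1 = ε 1 := by
    have := eq_of_mem_freeSigns_Ioo (i := d + 1) hpd hη (by omega) le_rfl
    push_cast at this
    rwa [ZMod.natCast_self, zero_add] at this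
  have ep : η p = ε p := eq_of_mem_freeSigns_Ioo hpd hη le_rfl (by omega)
  have n1 : F.edgeNorm q η k (1 : ℕ) = F.edgeNorm q ε k 1 := by
    rw [Nat.cast_one, Face.edgeNorm, Face.edgeNorm, e1]
  have np : F.edgeNorm q η k p = F.edgeNorm q ε k p := by
    rw [Face.edgeNorm, Face.edgeNorm, ep]
  rw [n1, np] at hprod
  refine Eq.trans ?_ (mul_assoc _ _ _)
  rw [Face.leftCoef, ← Complex.ofReal_mul]
  congr 2
  -- Turns the lower bound `1 + 1` of the products into `2`.
  norm_num only [] at hprod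
  rw [hprod]
  ring

/-- The telescoping is applied to the labels `κ`, which are `k` lowered by `ε`, with signs `-η`; the
step from `κ` back is a raising, which is why `B` replaces `A`. The extracted factor is the same as
for the first sum, the difference going into `α`. -/
theorem Face.rightCoef_mul_coeff (hq : 0 < q) (hq1 : q ≠ 1) (hp : 2 ≤ p) (hpd : p ≤ d)
    {k : E → ℤ} (hk : Γ.Admissible k) (hκ : ∀ i ∈ Finset.Icc p (d + 1), 0 ≤ k (F.edge i) - (ε i : ℤ))
    (hη : η ∈ freeSigns (Finset.Ioc p d) ε) (ψ : Γ.Label → ℂ) :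
    ((((ε 1 * ε p : ℤˣ) : ℤ) : ℝ) * F.rightCoef q p ε η k : ℝ) *
        Γ.coeff ψ (F.shift k fun i => -(ε i : ℤ) + (η i : ℤ)) =
      (((∏ i ∈ Finset.Icc (p + 1) (d + 1), F.stepCoef q ε k i) *
        ((qnum q (k (F.edge 1) + 1))⁻¹ * (F.edgeNorm q ε k 1 / F.edgeNorm q ε k p)) : ℝ) : ℂ) *
        (((coeffAlpha q (ε 1) (ε p) (k (F.edge 1)) (k (F.edge p)) *
          ∏ i ∈ Finset.Icc (p + 1) (d + 1), coeffB q (F.o i) (η i) (η (i - 1))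
            (k (F.edge i) - (ε i : ℤ)) (k (F.edge (i - 1)) - (ε (i - 1) : ℤ))
            (k (F.legEdge i)) : ℝ) : ℂ) *
          Γ.coeff ψ (F.shift k fun i => -(ε i : ℤ) + (η i : ℤ))) := by
  by_cases h : Γ.Admissible (F.shift k fun i => -(ε i : ℤ) + (η i : ℤ))
  swap
  · rw [RibbonGraph.coeff, dif_neg h, mul_zero, mul_zero, mul_zero]
  set κ : E → ℤ := F.shift k fun i => -(ε i : ℤ) with hκd
  have hκe : ∀ i, κ (F.edge i) = k (F.edge i) - (ε i : ℤ) := fun i => by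
    rw [hκd, F.shift_edge]; ring
  have hκl : ∀ i, κ (F.legEdge i) = k (F.legEdge i) := fun i => F.shift_legEdge _ _ _
  have hκ0 : ∀ i ∈ Finset.Icc p (d + 1), 0 ≤ κ (F.edge i) := fun i hi => by
    rw [hκe]; exact hκ i hi
  have hpos : ∀ i, 0 ≤ κ (F.edge i) - ((-η i : ℤˣ) : ℤ) := fun i => by
    have := h.nonneg (F.edge i)
    rw [F.shift_edge] at this
    rw [hκe, Units.val_neg]
    linarith
  have hprod := prod_Icc_mul_div (a := p) (b := d + 1)
    (fun i : ℕ => (((F.o i * η i : ℤˣ) : ℤ) : ℝ) *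
      (qnum q (k (F.edge i) - ((ε i : ℤ) : ℝ) + ((η i : ℤ) : ℝ) + 1))⁻¹ *
        F.stepCoef q (fun i => -η i) κ i)
    (fun i : ℕ => coeffB q (F.o i) (η i) (η (i - 1))
            (k (F.edge i) - (ε i : ℤ)) (k (F.edge (i - 1)) - (ε (i - 1) : ℤ))
            (k (F.legEdge i)))
    (fun i : ℕ => F.edgeNorm q (fun i => -η i) κ i) (by omega)
    (fun i hi => (F.edgeNorm_pos hq hq1 (hκ0 i hi) (hpos i)).ne') (fun i hi => by
      rw [Finset.mem_Icc] at hi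
      have hst := F.inv_qnum_mul_stepCoef (σ := fun i => -η i) (k := κ) (i := i) hq hq1
        (hκ0 i (by rw [Finset.mem_Icc]; omega)) (hpos i)
      rw [hκe, hκe, hκl] at hst
      simp only [Units.val_neg, Int.cast_sub, Int.cast_neg, sub_neg_eq_add] at hst
      rw [mul_assoc, hst, coeffB, cast_pred (by omega)]
      push_cast
      ring)
  have e1 : η 1 = ε 1 := by
    have := eq_of_mem_freeSigns_Ioc (i := 1) hpd hη le_rfl (by omega)
    rwa [Nat.cast_one] at this
  have ep : η p = ε p := eq_of_mem_freeSigns_Ioc hpd hη (by omega) le_rfl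
  -- The norm is symmetric in the two dimensions, so raising `κ` gives the same norm as lowering
  -- `k`.
  have hN : ∀ i, η i = ε i → F.edgeNorm q (fun i => -η i) κ i = F.edgeNorm q ε k i := by
    intro i hi
    rw [Face.edgeNorm, Face.edgeNorm, hκe, hi, mul_comm, Units.val_neg]
    push_cast
    rw [sub_neg_eq_add, sub_add_cancel]
  have hd1 : ((d + 1 : ℕ) : ZMod d) = 1 := by
    push_cast
    rw [ZMod.natCast_self, zero_add]
  have k1 : 0 ≤ k (F.edge 1) - (ε 1 : ℤ) := by
    have := hκ (d + 1) (by rw [Finset.mem_Icc]; omega)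
    rwa [hd1] at this
  have kp := hκ p (by rw [Finset.mem_Icc]; omega)
  have s1 := F.edgeNorm_sq hq hq1 (hk.nonneg _) k1
  have sp := F.edgeNorm_sq hq hq1 (hk.nonneg _) kp
  have p1 := F.edgeNorm_pos hq hq1 (hk.nonneg _) k1
  have pp := F.edgeNorm_pos hq hq1 (hk.nonneg _) kp
  rw [hd1, hN 1 e1, hN p ep] at hprod
  rw [Face.rightCoef, ← hκd, hprod, coeffAlpha]
  refine Eq.trans ?_ (mul_assoc _ _ _)
  rw [← Complex.ofReal_mul]
  congr 2
  have x1 : 0 < qnum q (k (F.edge 1) + 1) := by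
    have : (0 : ℝ) ≤ k (F.edge 1) := by exact_mod_cast hk.nonneg _
    exact qnum_pos hq hq1 (by linarith)
  have y1 : 0 < qnum q (k (F.edge 1) - ((ε 1 : ℤ) : ℝ) + 1) := by
    have : (0 : ℝ) ≤ k (F.edge 1) - ((ε 1 : ℤ) : ℝ) := by exact_mod_cast k1
    exact qnum_pos hq hq1 (by linarith)
  have yp : 0 < qnum q (k (F.edge p) - ((ε p : ℤ) : ℝ) + 1) := by
    have : (0 : ℝ) ≤ k (F.edge p) - ((ε p : ℤ) : ℝ) := by exact_mod_cast kp
    exact qnum_pos hq hq1 (by linarith)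
  -- Source of `α`: the ratio of norms is inverted compared with the first sum, and the squares of
  -- the norms are products of dimensions.
  have hmain : (qnum q (k (F.edge p) - ((ε p : ℤ) : ℝ) + 1))⁻¹ *
      (F.edgeNorm q ε k p / F.edgeNorm q ε k 1) =
      (qnum q (k (F.edge 1) + 1))⁻¹ * (F.edgeNorm q ε k 1 / F.edgeNorm q ε k p) *
        (qnum q (k (F.edge p) + 1) / qnum q (k (F.edge 1) - ((ε 1 : ℤ) : ℝ) + 1)) := by
    field_simp
    linear_combination qnum q (k (F.edge 1) + 1) * qnum q (k (F.edge 1) - ((ε 1 : ℤ) : ℝ) + 1) * sp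
      - qnum q (k (F.edge p) + 1) * qnum q (k (F.edge p) - ((ε p : ℤ) : ℝ) + 1) * s1
  linear_combination ((((ε 1 * ε p : ℤˣ) : ℤ) : ℝ) *
    (∏ i ∈ Finset.Icc (p + 1) (d + 1), F.stepCoef q ε k i) *
    ∏ i ∈ Finset.Icc (p + 1) (d + 1), coeffB q (F.o i) (η i) (η (i - 1))
            (k (F.edge i) - (ε i : ℤ)) (k (F.edge (i - 1)) - (ε (i - 1) : ℤ))
            (k (F.legEdge i))) * hmain

end Rescaling

/-! ### Comparison of the constraint with the difference equation. -/

section Equivalence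

variable {V E : Type*} {Γ : RibbonGraph V E} {d : ℕ} (F : Face Γ d) {q : ℝ} {p : ℕ}
  {ε : ZMod d → ℤˣ} {k : E → ℤ}

theorem Face.edge_sub_nonneg (hpd : p ≤ d)
    (hT : ∀ i ∈ Finset.Icc (p + 1) (d + 1), Triad (k (F.edge (i - 1)) - (ε (i - 1) : ℤ))
      (k (F.edge i) - (ε i : ℤ)) (k (F.legEdge i))) :
    ∀ i ∈ Finset.Icc p (d + 1), 0 ≤ k (F.edge i) - (ε i : ℤ) := by
  intro i hi
  rw [Finset.mem_Icc] at hi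
  rcases Nat.lt_or_ge p i with h | h
  · exact (hT i (by rw [Finset.mem_Icc]; omega)).2.1
  · obtain rfl : i = p := by omega
    have := (hT (i + 1) (by rw [Finset.mem_Icc]; omega)).1
    rwa [Nat.cast_add_one, add_sub_cancel_right] at this

variable [NeZero d] (ψ : Γ.Label → ℂ)

theorem Face.left_sum_eq_mul (hq : 0 < q) (hq1 : q ≠ 1) (hp : 2 ≤ p) (hpd : p ≤ d)
    (hk : Γ.Admissible k)
    (hT : ∀ i ∈ Finset.Icc (p + 1) (d + 1), Triad (k (F.edge (i - 1)) - (ε (i - 1) : ℤ))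
      (k (F.edge i) - (ε i : ℤ)) (k (F.legEdge i))) :
    ∑ η ∈ freeSigns (Finset.Ioo 1 p) ε, ((F.leftCoef q p ε η k : ℝ) : ℂ) *
          Γ.coeff ψ (F.shift k fun i => -(η i : ℤ)) +
        (-1 : ℂ) ^ (d - p) * (((ε 1 * ε p : ℤˣ) : ℤ) : ℂ) *
          ∑ η ∈ freeSigns (Finset.Ioc p d) ε, ((F.rightCoef q p ε η k : ℝ) : ℂ) *
            Γ.coeff ψ (F.shift k fun i => -(ε i : ℤ) + (η i : ℤ)) =
      (((∏ i ∈ Finset.Icc (p + 1) (d + 1), F.stepCoef q ε k i) *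
        ((qnum q (k (F.edge 1) + 1))⁻¹ * (F.edgeNorm q ε k 1 / F.edgeNorm q ε k p)) : ℝ) : ℂ) *
        F.differenceLHS q p ε ψ k := by
  rw [Face.differenceLHS, mul_add, Finset.mul_sum, Finset.mul_sum, Finset.mul_sum, Finset.mul_sum]
  congr 1
  · exact Finset.sum_congr rfl fun η hη => F.leftCoef_mul_coeff hq hq1 hp hpd hk hη ψ
  · refine Finset.sum_congr rfl fun η hη => ?_
    have := F.rightCoef_mul_coeff hq hq1 hp hpd hk (F.edge_sub_nonneg hpd hT) hη ψ
    push_cast at this ⊢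
    linear_combination (-1 : ℂ) ^ (d - p) * this

theorem Face.coeff_shift_eq_zero {s : ZMod d → ℤ} {i : ZMod d}
    (h : ¬Triad (k (F.edge (i - 1)) + s (i - 1)) (k (F.edge i) + s i) (k (F.legEdge i))) :
    Γ.coeff ψ (F.shift k s) = 0 := by
  rw [RibbonGraph.coeff, dif_neg]
  intro hA
  have := F.triad_of_admissible hA i
  rw [F.shift_edge, F.shift_edge, F.shift_legEdge] at this
  exact h this

/-- If the labels lowered by `ε` violate a triangle condition, then both the matrix element and
the difference equation are trivial. -/
theorem Face.sums_eq_zero (hpd : p ≤ d) {i : ℕ} (hi : i ∈ Finset.Icc (p + 1) (d + 1))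
    (hT : ¬Triad (k (F.edge (i - 1)) - (ε (i - 1) : ℤ))
      (k (F.edge i) - (ε i : ℤ)) (k (F.legEdge i))) :
    (∀ η ∈ freeSigns (Finset.Ioo 1 p) ε, Γ.coeff ψ (F.shift k fun i => -(η i : ℤ)) = 0) ∧
    (∀ η : ZMod d → ℤˣ, F.rightCoef q p ε η k = 0) ∧
    (∀ η : ZMod d → ℤˣ, ∏ i ∈ Finset.Icc (p + 1) (d + 1), coeffB q (F.o i) (η i) (η (i - 1))
            (k (F.edge i) - (ε i : ℤ)) (k (F.edge (i - 1)) - (ε (i - 1) : ℤ))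
            (k (F.legEdge i)) = 0) := by
  have hi' := Finset.mem_Icc.mp hi
  refine ⟨fun η hη => F.coeff_shift_eq_zero ψ (i := i) ?_, fun η => ?_, fun η => ?_⟩
  · have e1 : η i = ε i := eq_of_mem_freeSigns_Ioo hpd hη (by omega) hi'.2
    have e2 := eq_of_mem_freeSigns_Ioo (i := i - 1) hpd hη (by omega) (by omega)
    rw [cast_pred (by omega)] at e2
    rw [e1, e2, ← sub_eq_add_neg, ← sub_eq_add_neg]
    exact hT
  · rw [Face.rightCoef, Finset.prod_eq_zero (i := i) (s := Finset.Icc (p + 1) (d + 1))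
      (f := fun i : ℕ => (((F.o i * η i : ℤˣ) : ℤ) : ℝ) *
        (qnum q (k (F.edge i) - ((ε i : ℤ) : ℝ) + ((η i : ℤ) : ℝ) + 1))⁻¹ *
        F.stepCoef q (fun i => -η i) (F.shift k fun i => -(ε i : ℤ)) i) hi, mul_zero, mul_zero]
    rw [Face.stepCoef, scalarCoef_eq_zero, mul_zero]
    rintro ⟨h, -⟩
    rw [F.shift_edge, F.shift_edge, F.shift_legEdge, ← sub_eq_add_neg, ← sub_eq_add_neg] at h
    exact hT h.swap
  · refine Finset.prod_eq_zero hi ?_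
    rw [coeffB, sixj, if_neg, mul_zero]
    rintro ⟨-, h, -⟩
    exact hT h.swap

/-- The Hamiltonian constraint at `{k_e}` is the difference equation at `{k_e}`. -/
theorem Face.matrixElement_eq_zero_iff [Fintype V] [Fintype E] (hq : 0 < q) (hq1 : q ≠ 1)
    (hp : 2 ≤ p) (hpd : p ≤ d) (k : Γ.Label) :
    Γ.matrixElement q (F.hamiltonian q p ε) k ψ = 0 ↔ F.differenceLHS q p ε ψ k.1 = 0 := by
  rw [F.matrixElement_hamiltonian hq hq1 hp hpd, mul_eq_zero,
    or_iff_left (braket_splitNet_self_ne_zero hq hq1 k.2)]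
  -- These triads decide whether the leftmost product of scalar operators can vanish. If all hold, a
  -- non-zero factor is divided out; otherwise both expressions are identically zero, and dividing
  -- is avoided.
  by_cases hT : ∀ i ∈ Finset.Icc (p + 1) (d + 1), Triad
      (k.1 (F.edge (i - 1)) - (ε (i - 1) : ℤ)) (k.1 (F.edge i) - (ε i : ℤ)) (k.1 (F.legEdge i))
  · rw [F.left_sum_eq_mul ψ hq hq1 hp hpd k.2 hT, mul_eq_zero, or_iff_right]
    have hpos := F.edge_sub_nonneg hpd hT
    have hp1 := F.edgeNorm_pos hq hq1 (k.2.nonneg _) (hpos p (by rw [Finset.mem_Icc]; omega))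
    have h1 := hpos (d + 1) (by rw [Finset.mem_Icc]; omega)
    rw [Nat.cast_add_one, ZMod.natCast_self, zero_add] at h1
    have h1' := F.edgeNorm_pos hq hq1 (k.2.nonneg _) h1
    have hx : 0 < qnum q (k.1 (F.edge 1) + 1) := by
      have : (0 : ℝ) ≤ k.1 (F.edge 1) := by exact_mod_cast k.2.nonneg _
      exact qnum_pos hq hq1 (by linarith)
    rw [Complex.ofReal_eq_zero]
    refine mul_ne_zero (Finset.prod_ne_zero_iff.mpr fun i hi => ?_)
      (mul_pos (inv_pos.mpr hx) (div_pos h1' hp1)).ne'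
    exact scalarCoef_ne_zero hq hq1 (F.triad_of_admissible k.2 i).swap (hT i hi)
  · push Not at hT
    obtain ⟨i, hi, hT⟩ := hT
    obtain ⟨h1, h2, h3⟩ := F.sums_eq_zero (q := q) ψ hpd hi hT
    refine iff_of_true ?_ ?_
    · rw [Finset.sum_eq_zero fun η hη => by rw [h1 η hη, mul_zero],
        Finset.sum_eq_zero fun η _ => by rw [h2 η, Complex.ofReal_zero, zero_mul]]
      ring
    · rw [Face.differenceLHS, Finset.sum_eq_zero fun η hη => by rw [h1 η hη, mul_zero],
        Finset.sum_eq_zero fun η _ => by rw [h3 η, Complex.ofReal_zero, zero_mul]]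
      ring

end Equivalence

end QHam

end


/-- The two conditions already agree at each individual label, so the quantifiers play no role. -/
theorem mainTheorem1 {V E : Type*} [Fintype V] [Fintype E] (Γ : QHam.RibbonGraph V E)
    (q : ℝ) (hq : 0 < q) (hq1 : q ≠ 1)
    (d : ℕ) [NeZero d] (F : QHam.Face Γ d) (p : ℕ) (hp : 2 ≤ p) (hpd : p ≤ d)
    (ε : ZMod d → ℤˣ) (ψ : Γ.Label → ℂ) :
    (∀ k : Γ.Label, Γ.matrixElement q (F.hamiltonian q p ε) k ψ = 0) ↔
      (∀ k : Γ.Label, F.differenceLHS q p ε ψ k.1 = 0) :=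
  forall_congr' fun k => F.matrixElement_eq_zero_iff ψ hq hq1 hp hpd k
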